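/- **Setting.** Let $\mathfrak g$ be a finite-dimensional simple Lie algebra over $\mathbb C$ of rank $n$, with Cartan subalgebra $\mathfrak h$, Weyl generators $E_i,F_i$ ($1\le i\le n$), highest root $\theta$, Coxeter number $h$, dual Coxeter number $h^\vee$, exponents $1=m_1\le\dots\le m_n=h-1$, and normalized form $(x|y)=\frac1{2h^\vee}\operatorname{tr}(\operatorname{ad}_x\operatorname{ad}_y)$. Put $\eta_{ab}=\delta_{a+b,n+1}$. The principal gradation of $\mathfrak g((\lambda^{-1}))$ is given by $\deg E_i=-\deg F_i=1$, $\deg\lambda=h$. Choose $E_{\pm\theta}\in\mathfrak g_{\pm\theta}$ with $(E_\theta|E_{-\theta})=1$ and $\omega(E_{-\theta})=-E_\theta$, $\omega$ being the Chevalley involution, and let $\Lambda(\lambda)=\sum_iE_i+\lambda E_{-\theta}$. Let $\Lambda_{m_a}(\lambda)$ ($1\le a\le n$) be homogeneous elements of degree $m_a$ forming a $\mathbb C((\lambda^{-1}))$-basis of $\operatorname{Ker}\operatorname{ad}_{\Lambda(\lambda)}$, with $\Lambda_{m_1}=\Lambda$ and $(\Lambda_{m_a}|\Lambda_{m_b})=h\eta_{ab}\lambda$.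 Let $(e_j)$ be a homogeneous basis of $\mathfrak g$ with $\deg e_j=d_j$, let $(e^j)$ be its dual basis, and write $[e^i,e^j]=\sum_sC^{ij}_se^s$. Let $\mathcal P=\mathbb C[u^j_k : k\in\mathbb Z,\ k\ge d_j/h-1]$, $$u^j(\lambda)=\sum_ku^j_k\lambda^{-k-1},\qquad W(\lambda)=\Lambda(\lambda)+\sum_ju^j(\lambda)e_j,$$ with the Poisson bracket on $\mathcal P$ $$\{u^i(\lambda),u^j(\mu)\}=\sum_sC^{ij}_s\frac{u^s(\lambda)-u^s(\mu)}{\lambda-\mu}+\frac{([e^i,e^j]\,|\,\Lambda(\lambda)-\Lambda(\mu))}{\lambda-\mu}.$$ Let $(U(\lambda),H(\lambda))$ be the unique pair of $\mathfrak g$-valued Laurent series in $\lambda^{-1}$ over $\mathcal P$ such that $U\in\operatorname{Im}\operatorname{ad}_\Lambda$ has only components of degree $\le-1$, $H\in\operatorname{Ker}\operatorname{ad}_\Lambda$ has only components of degree $\le0$, and $e^{-\operatorname{ad}_U}W=\Lambda+H$. Define the hamiltonians $h_{a,k}\in\mathcal P$ by $H=\sum_{a=1}^n\sum_{k\ge-1}\frac{h_{n+1-a,k}}h\lambda^{-k-2}\Lambda_{m_a}$,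 the flows by $\frac{d}{dT^a_k}=\{h_{a,k},\cdot\}$ ($k\ge0$), the basic resolvents by $R_a(\lambda)=e^{\operatorname{ad}_U}\Lambda_{m_a}(\lambda)$, and $\omega_{a,k;b,l}\in\mathcal P$ by $$\sum_{k,l\ge0}\frac{\omega_{a,k;b,l}}{\lambda^{k+1}\mu^{l+1}}=\frac{(R_a(\lambda)|R_b(\mu))}{(\lambda-\mu)^2}-\eta_{ab}\frac{m_a\lambda+m_b\mu}{(\lambda-\mu)^2}.$$ For $m\ge3$ let $\omega_{a_1,k_1;\dots;a_m,k_m}\in\mathcal P$ be obtained from $\omega_{a_1,k_1;a_2,k_2}$ by applying $\frac{d}{dT^{a_3}_{k_3}}\cdots\frac{d}{dT^{a_m}_{k_m}}$. A formal solution is a choice of $u^j_k(\mathbf T)\in\mathbb C[[\mathbf T]]$ satisfying $\frac{\partial W}{\partial T^a_k}=\{h_{a,k},W\}$ for all $a$ and all $k\ge0$; $R_a(\lambda,\mathbf T)$ denotes $R_a(\lambda)$ evaluated on it. A $\tau$-function of the solution is a $\tau\in\mathbb C[[\mathbf T]]$ with $\tau(\mathbf 0)\ne0$ and $\frac{\partial^2\log\tau}{\partial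 T^a_k\partial T^b_l}=\omega_{a,k;b,l}(\mathbf T)$ for all $a,b,k,l$. Let $B(x_1,\dots,x_m)=\operatorname{tr}(\operatorname{ad}_{x_1}\cdots\operatorname{ad}_{x_m})$. **Theorem.** Let $m\ge2$ and $1\le a_1,\dots,a_m\le n$. Then $$\sum_{k_1,\dots,k_m\ge0}\frac{\omega_{a_1,k_1;\dots;a_m,k_m}}{\lambda_1^{k_1+1}\cdots\lambda_m^{k_m+1}}=-\frac1{2mh^\vee}\sum_{s\in S_m}\frac{B\bigl(R_{a_{s_1}}(\lambda_{s_1}),\dots,R_{a_{s_m}}(\lambda_{s_m})\bigr)}{\prod_{i=1}^m(\lambda_{s_i}-\lambda_{s_{i+1}})}-\delta_{m,2}\,\eta_{a_1a_2}\frac{m_{a_1}\lambda_1+m_{a_2}\lambda_2}{(\lambda_1-\lambda_2)^2},$$ where $s_{m+1}=s_1$, as an identity in the fraction field of $\mathcal P[[\lambda_1^{-1},\dots,\lambda_m^{-1}]]$. Moreover, for every formal solution and every $\tau$-function $\tau$ of it, $$\sum_{k_1,\dots,k_m\ge0}\frac{\frac{\partial^m\log\tau}{\partial T^{a_1}_{k_1}\cdots\partial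 T^{a_m}_{k_m}}(\mathbf T)}{\lambda_1^{k_1+1}\cdots\lambda_m^{k_m+1}}=-\frac1{2mh^\vee}\sum_{s\in S_m}\frac{B\bigl(R_{a_{s_1}}(\lambda_{s_1},\mathbf T),\dots,R_{a_{s_m}}(\lambda_{s_m},\mathbf T)\bigr)}{\prod_{i=1}^m(\lambda_{s_i}-\lambda_{s_{i+1}})}-\delta_{m,2}\,\eta_{a_1a_2}\frac{m_{a_1}\lambda_1+m_{a_2}\lambda_2}{(\lambda_1-\lambda_2)^2}$$ in the fraction field of $\mathbb C[[\mathbf T]][[\lambda_1^{-1},\dots,\lambda_m^{-1}]]$, and likewise with $\mathbf T=\mathbf 0$ on both sides, in the fraction field of $\mathbb C[[\lambda_1^{-1},\dots,\lambda_m^{-1}]]$. The last identity gives the Taylor coefficients of $\log\tau$ of every order $m\ge2$ in terms of the $R_a(\lambda,\mathbf 0)$. -/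

import Mathlib

open scoped TensorProduct

noncomputable section

namespace DrinfeldSokolov

/-! ### Coefficient rings, Laurent series and generating series

Laurent series `A((λ⁻¹))` are `LaurentSeries A`, the variable of which is `z = λ⁻¹`. -/

/-- The spectral parameter `λ = z⁻¹` in `A((λ⁻¹))`. -/
def spec (A : Type*) [CommRing A] : LaurentSeries A := HahnSeries.single (-1 : ℤ) 1

instance isDomain_mvPowerSeries (σ A : Type*) [CommRing A] [IsDomain A] :
    IsDomain (MvPowerSeries σ A) :=
  NoZeroDivisors.to_isDomain _

/-- The fraction field of `A[[λ₁⁻¹, …, λₘ⁻¹]]`; the variable `X i` is `λᵢ⁻¹`. -/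
abbrev GenField (A : Type*) [CommRing A] (m : ℕ) := FractionRing (MvPowerSeries (Fin m) A)

/-- `λᵢ` as an element of the fraction field. -/
def lam (A : Type*) [CommRing A] [IsDomain A] {m : ℕ} (i : Fin m) : GenField A m :=
  (algebraMap (MvPowerSeries (Fin m) A) (GenField A m) (MvPowerSeries.X i))⁻¹

theorem isUnit_subst_X (A : Type*) [CommRing A] [IsDomain A] {m : ℕ} (i : Fin m) :
    IsUnit (((algebraMap (MvPowerSeries (Fin m) A) (GenField A m)).comp
      (PowerSeries.substAlgHom (R := A) (PowerSeries.HasSubst.X (S := A) i)).toRingHom)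
        PowerSeries.X) := by
  have h1 : (PowerSeries.substAlgHom (R := A) (PowerSeries.HasSubst.X (S := A) i))
      PowerSeries.X = MvPowerSeries.X i := by
    rw [PowerSeries.coe_substAlgHom, PowerSeries.subst_X (PowerSeries.HasSubst.X i)]
  rw [RingHom.comp_apply]
  change IsUnit ((algebraMap (MvPowerSeries (Fin m) A) (GenField A m))
    ((PowerSeries.substAlgHom (R := A) (PowerSeries.HasSubst.X (S := A) i)) PowerSeries.X))
  rw [h1, isUnit_iff_ne_zero]
  intro h0
  have h2 : (MvPowerSeries.X i : MvPowerSeries (Fin m) A) = 0 :=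
    IsFractionRing.injective (MvPowerSeries (Fin m) A) (GenField A m) (by rw [h0, map_zero])
  have h3 := congrArg (MvPowerSeries.coeff (Finsupp.single i 1)) h2
  simp at h3

/-- The substitution `λ = λᵢ`, from `A((λ⁻¹))` to the fraction field of `A[[λ₁⁻¹, …, λₘ⁻¹]]`. -/
def substLam (A : Type*) [CommRing A] [IsDomain A] {m : ℕ} (i : Fin m) :
    LaurentSeries A →+* GenField A m :=
  IsLocalization.Away.lift (PowerSeries.X : PowerSeries A) (isUnit_subst_X A i)

/-- The coefficient of `λ^(-p) μ^(-q)` in `(f(λ) - f(μ)) / (λ - μ)` for a series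
`f(λ) = ∑ r, f r * λ^(-r)`. -/
def divDiff {A : Type*} [CommRing A] (f : ℤ → A) (p q : ℤ) : A :=
  if 1 ≤ p ∧ 1 ≤ q then - f (p + q - 1)
  else if p ≤ 0 ∧ q ≤ 0 then f (p + q - 1) else 0

/-- Multiplying `divDiff f` by `λ - μ` gives back `f(λ) - f(μ)`, coefficient by coefficient. -/
theorem divDiff_spec {A : Type*} [CommRing A] (f : ℤ → A) (p q : ℤ) :
    divDiff f (p + 1) q - divDiff f p (q + 1) =
      (if q = 0 then f p else 0) - (if p = 0 then f q else 0) := by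
  unfold divDiff
  have e1 : p + 1 + q - 1 = p + q := by ring
  have e2 : p + (q + 1) - 1 = p + q := by ring
  rw [e1, e2]
  split_ifs <;> first | omega | (subst_vars; simp)

/-- `log τ` for a formal power series `τ` with nonzero constant term `c`:
`log c + log (1 + (τ / c - 1))`. -/
def logSeries {σ : Type*} (τ : MvPowerSeries σ ℂ) : MvPowerSeries σ ℂ :=
  MvPowerSeries.C (Complex.log (MvPowerSeries.constantCoeff τ)) +
    (PowerSeries.log ℂ).subst
      (MvPowerSeries.C (MvPowerSeries.constantCoeff τ)⁻¹ * τ - 1)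

/-! ### The Lie algebra -/

variable {𝔤 : Type*} [LieRing 𝔤] [LieAlgebra ℂ 𝔤] [FiniteDimensional ℂ 𝔤]
  [LieAlgebra.IsSimple ℂ 𝔤] {H : LieSubalgebra ℂ 𝔤} [H.IsCartanSubalgebra] {n N : ℕ}

/-- The extension of scalars `K ⊗ 𝔤`, a Lie algebra over `K`. -/
abbrev Ext (K : Type*) [CommRing K] [Algebra ℂ K] (𝔤 : Type*) [LieRing 𝔤] [LieAlgebra ℂ 𝔤] :=
  K ⊗[ℂ] 𝔤

/-- The pure tensor `k ⊗ x`. -/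
abbrev Ext.tmul {K : Type*} [CommRing K] [Algebra ℂ K] {𝔤 : Type*} [LieRing 𝔤] [LieAlgebra ℂ 𝔤]
    (k : K) (x : 𝔤) : Ext K 𝔤 := k ⊗ₜ[ℂ] x

/-- `𝔤((λ⁻¹))` with coefficients extended to `A`, realised as `A((λ⁻¹)) ⊗ 𝔤`. -/
abbrev Loop (A : Type*) [CommRing A] [Algebra ℂ A] (𝔤 : Type*) [LieRing 𝔤] [LieAlgebra ℂ 𝔤] :=
  Ext (LaurentSeries A) 𝔤

/-- The root `θ` is the highest root with respect to the base of `B`. -/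
def IsHighestRoot (B : LieAlgebra.Basis (Fin n) H) (θ : H.root) : Prop :=
  ∀ β : H.root, (LieAlgebra.IsKilling.rootSystem H).root θ -
      (LieAlgebra.IsKilling.rootSystem H).root β ∈
    AddSubmonoid.closure ((LieAlgebra.IsKilling.rootSystem H).root '' (B.base.support : Set H.root))

/-- The Coxeter number: one plus the height of the highest root. -/
def coxeter (B : LieAlgebra.Basis (Fin n) H) (θ : H.root) : ℤ := B.base.height θ + 1

/-- The dual Coxeter number: one plus the height of the coroot `θ^∨` with respect to the
simple coroots. -/
def dualCoxeter (B : LieAlgebra.Basis (Fin n) H) (θ : H.root) : ℤ := B.base.flip.height θ + 1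

/-- The normalised Cartan-Killing form `(x | y) = tr (ad x ∘ ad y) / (2 h^∨)`, extended
`K`-bilinearly to `K ⊗ 𝔤`. -/
def form (B : LieAlgebra.Basis (Fin n) H) (θ : H.root) (K : Type*) [CommRing K] [Algebra ℂ K]
    (x y : Ext K 𝔤) : K :=
  algebraMap ℂ K (2 * (dualCoxeter B θ : ℂ))⁻¹ *
    LinearMap.trace K (Ext K 𝔤)
      (LieAlgebra.ad K (Ext K 𝔤) x * LieAlgebra.ad K (Ext K 𝔤) y)

/-- The normalised Cartan-Killing form of `𝔤`. -/
def form₀ (B : LieAlgebra.Basis (Fin n) H) (θ : H.root) (x y : 𝔤) : ℂ :=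
  (2 * (dualCoxeter B θ : ℂ))⁻¹ *
    LinearMap.trace ℂ 𝔤 (LieAlgebra.ad ℂ 𝔤 x * LieAlgebra.ad ℂ 𝔤 y)

/-- The homogeneous subspace `𝔤^k` of the principal gradation: `𝔤^0` is the Cartan subalgebra,
and `𝔤^k` is the sum of the root spaces of roots of height `k`. -/
def principalPiece (B : LieAlgebra.Basis (Fin n) H) (k : ℤ) : Submodule ℂ 𝔤 :=
  if k = 0 then H.toSubmodule
  else ⨆ (α : H.root) (_ : B.base.height α = k), (LieAlgebra.rootSpace H α.1).toSubmodule

/-- The principal nilpotent element `I₊ = ∑ E_a`. -/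
def principalNilpotent (B : LieAlgebra.Basis (Fin n) H) : 𝔤 := ∑ a, B.e a

/-- `m` lists the exponents of `𝔤` in increasing order: the multiplicity of `k` is the dimension
of the degree `k` part of the centraliser of the principal nilpotent element. -/
def IsExponents (B : LieAlgebra.Basis (Fin n) H) (m : Fin n → ℕ) : Prop :=
  Monotone m ∧ ∀ k : ℕ, Fintype.card {a // m a = k} =
    Module.finrank ℂ ↥(LinearMap.ker (LieAlgebra.ad ℂ 𝔤 (principalNilpotent B)) ⊓
      principalPiece B (k : ℤ))

/-- The coefficient of `e_j * λ^(-r)` in `X`, for a basis `e` of `𝔤`. -/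
def loopCoeff (e : Module.Basis (Fin N) ℂ 𝔤) {A : Type*} [CommRing A] [Algebra ℂ A]
    (j : Fin N) (r : ℤ) (X : Loop A 𝔤) : A :=
  ((e.baseChange (LaurentSeries A)).repr X j).coeff r

/-- Only components of principal degree satisfying `S` occur in `X`; here `e_j` has degree `d j`
and `λ` has degree `h`. -/
def DegIn (e : Module.Basis (Fin N) ℂ 𝔤) (d : Fin N → ℤ) (h : ℤ) (S : ℤ → Prop)
    {A : Type*} [CommRing A] [Algebra ℂ A] (X : Loop A 𝔤) : Prop :=
  ∀ j r, loopCoeff e j r X ≠ 0 → S (d j - h * r)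

/-- Apply `φ` to the coordinates of an element of `A ⊗ 𝔤` (extension of scalars along `φ`). -/
def mapCoord (e : Module.Basis (Fin N) ℂ 𝔤) {A B : Type*} [CommRing A] [Algebra ℂ A]
    [CommRing B] [Algebra ℂ B] (φ : A → B) (X : Ext A 𝔤) : Ext B 𝔤 :=
  ∑ j, Ext.tmul (φ ((e.baseChange A).repr X j)) (e j)

/-- Apply a ring homomorphism `A → B` to all coefficients of an element of `𝔤((λ⁻¹))` over `A`. -/
def mapLoop (e : Module.Basis (Fin N) ℂ 𝔤) {A B : Type*} [CommRing A] [Algebra ℂ A]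
    [CommRing B] [Algebra ℂ B] (φ : A →+* B) : Loop A 𝔤 → Loop B 𝔤 :=
  mapCoord e fun f : LaurentSeries A => (HahnSeries.map f φ : LaurentSeries B)

/-- The cyclic element `Λ(λ) = I₊ + λ E_{-θ}`. -/
def cyclicElement (A : Type*) [CommRing A] [Algebra ℂ A] (B : LieAlgebra.Basis (Fin n) H)
    (Fθ : 𝔤) : Loop A 𝔤 :=
  Ext.tmul (1 : LaurentSeries A) (principalNilpotent B) + Ext.tmul (spec A) Fθ

/-- `η_{ab} = δ_{a+b, n+1}` for indices `1, …, n`. -/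
def eta (a b : Fin n) : ℂ := if b = a.rev then 1 else 0

/-- The choices on which the construction depends: Weyl generators, root vectors for the highest
root, a homogeneous basis, and the normalised generators `Λ_{m_a}(λ)` of the centraliser of the
cyclic element. -/
structure Data (H : LieSubalgebra ℂ 𝔤) [H.IsCartanSubalgebra] (n N : ℕ) where
  /-- Weyl generators `E_i, F_i`, with `H` as Cartan subalgebra. -/
  gen : LieAlgebra.Basis (Fin n) H
  /-- The highest root. -/
  θ : H.root
  highest : IsHighestRoot gen θ
  /-- The Chevalley involution. -/
  chevalley : 𝔤 →ₗ⁅ℂ⁆ 𝔤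
  chevalley_e (i : Fin n) : chevalley (gen.e i) = - gen.f i
  chevalley_f (i : Fin n) : chevalley (gen.f i) = - gen.e i
  /-- `E_θ`. -/
  Eθ : 𝔤
  /-- `E_{-θ}`. -/
  Fθ : 𝔤
  Eθ_mem : Eθ ∈ LieAlgebra.rootSpace H (θ.1 : H → ℂ)
  Fθ_mem : Fθ ∈ LieAlgebra.rootSpace H (-(θ.1 : H → ℂ))
  form_Eθ_Fθ : form₀ gen θ Eθ Fθ = 1
  chevalley_Fθ : chevalley Fθ = - Eθ
  /-- A homogeneous basis of `𝔤`. -/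
  e : Module.Basis (Fin N) ℂ 𝔤
  /-- The principal degrees of the basis vectors. -/
  d : Fin N → ℤ
  e_mem (j : Fin N) : e j ∈ principalPiece gen (d j)
  /-- The exponents. -/
  m : Fin n → ℕ
  exponents : IsExponents gen m
  /-- `Λ_{m_a}(λ)`. -/
  Λ : Fin n → Loop ℂ 𝔤
  Λ_deg (a : Fin n) : DegIn e d (coxeter gen θ) (fun k => k = (m a : ℤ)) (Λ a)
  Λ_linearIndependent : LinearIndependent (LaurentSeries ℂ) Λ
  Λ_span : Submodule.span (LaurentSeries ℂ) (Set.range Λ) =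
    LinearMap.ker (LieAlgebra.ad (LaurentSeries ℂ) (Loop ℂ 𝔤) (cyclicElement ℂ gen Fθ))
  Λ_first (a : Fin n) : (a : ℕ) = 0 → Λ a = cyclicElement ℂ gen Fθ
  Λ_form (a b : Fin n) : form gen θ (LaurentSeries ℂ) (Λ a) (Λ b) =
    algebraMap ℂ (LaurentSeries ℂ) ((coxeter gen θ : ℂ) * eta a b) * spec ℂ

namespace Data

variable (D : Data H n N)

/-- The Coxeter number `h`. -/
def cox : ℤ := coxeter D.gen D.θ

/-- The dual Coxeter number `h^∨`. -/
def dualCox : ℤ := dualCoxeter D.gen D.θ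

/-! ### The polynomial ring and its Poisson bracket -/

/-- Index set of the indeterminates `u^j_k`, with `k ≥ d_j / h - 1`. -/
def Var : Type := {v : Fin N × ℤ // (D.d v.1 : ℚ) / (D.cox : ℚ) - 1 ≤ (v.2 : ℚ)}

/-- The polynomial ring `𝒫`. -/
abbrev Poly : Type := MvPolynomial D.Var ℂ

open Classical in
/-- The coefficient of `λ^(-r)` in `u^j(λ) = ∑ k, u^j_k * λ^(-k-1)`. -/
def uCoeff (j : Fin N) (r : ℤ) : D.Poly :=
  if hv : (D.d j : ℚ) / (D.cox : ℚ) - 1 ≤ ((r - 1 : ℤ) : ℚ) then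
    MvPolynomial.X ⟨(j, r - 1), hv⟩ else 0

/-- The series `u^j(λ)` (all powers of `λ` in it are nonpositive, since `d_j > -h`). -/
def uSeries (j : Fin N) : LaurentSeries D.Poly :=
  HahnSeries.ofPowerSeries ℤ D.Poly (PowerSeries.mk fun r => D.uCoeff j (r : ℤ))

/-- `W(λ) = Λ(λ) + ∑ j, u^j(λ) e_j`. -/
def W : Loop D.Poly 𝔤 :=
  cyclicElement D.Poly D.gen D.Fθ + ∑ j, Ext.tmul (D.uSeries j) (D.e j)

/-- The dual basis `e^i = ∑ j, K^{ij} e_j`, where `(K^{ij})` is the inverse of the Gram matrix. -/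
def dualVec (i : Fin N) : 𝔤 :=
  ∑ j, (Matrix.of fun i j => form₀ D.gen D.θ (D.e i) (D.e j))⁻¹ i j • D.e j

/-- The structure constants `C^{ij}_k`, determined by `[e^i, e^j] = ∑ k, C^{ij}_k e^k`; as
`(e^k | e_l) = δ_{kl}`, they are `([e^i, e^j] | e_k)`. -/
def structConst (i j k : Fin N) : ℂ := form₀ D.gen D.θ ⁅D.dualVec i, D.dualVec j⁆ (D.e k)

/-- The bracket `{u^i_k, u^j_l}` of two generators: the coefficient of `λ^(-k-1) μ^(-l-1)` in
`∑ s, C^{ij}_s (u^s(λ) - u^s(μ)) / (λ - μ) + ([e^i, e^j] | Λ(λ) - Λ(μ)) / (λ - μ)`, where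
`Λ(λ) - Λ(μ) = (λ - μ) E_{-θ}`. -/
def genBracket (v w : D.Var) : D.Poly :=
  (∑ s, MvPolynomial.C (D.structConst v.1.1 w.1.1 s) *
      divDiff (D.uCoeff s) (v.1.2 + 1) (w.1.2 + 1)) +
    if v.1.2 + 1 = 0 ∧ w.1.2 + 1 = 0 then
      MvPolynomial.C (form₀ D.gen D.θ ⁅D.dualVec v.1.1, D.dualVec w.1.1⁆ D.Fθ) else 0

/-- The Poisson bracket: `poisson f g = {f, g} = ∑ (∂f/∂v) (∂g/∂w) {v, w}`. -/
def poisson (f : D.Poly) : Derivation ℂ D.Poly D.Poly :=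
  MvPolynomial.mkDerivation ℂ fun w =>
    MvPolynomial.mkDerivation ℂ (fun v => D.genBracket v w) f

/-! ### Dressing, hamiltonians, basic resolvents -/

/-- `Y = e^{ad U} X`: every coefficient of the partial sums of the exponential series is
eventually constant, with the coefficient of `Y` as its value. -/
def IsExpAd {A : Type*} [CommRing A] [Algebra ℂ A] (U X Y : Loop A 𝔤) : Prop :=
  ∀ j r, ∃ M₀ : ℕ, ∀ M ≥ M₀, loopCoeff D.e j r
    (∑ s ∈ Finset.range M, ((s.factorial : ℂ)⁻¹ •
      ((LieAlgebra.ad (LaurentSeries A) (Loop A 𝔤) U) ^ s) X)) = loopCoeff D.e j r Y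

open Classical in
/-- `e^{ad U} X` (and `0` if the exponential series does not converge). -/
def expAd {A : Type*} [CommRing A] [Algebra ℂ A] (U X : Loop A 𝔤) : Loop A 𝔤 :=
  if h : ∃ Y, D.IsExpAd U X Y then h.choose else 0

/-- The pair `(U(λ), H(λ))`: `U` lies in the image of `ad Λ(λ)` and has components of degree
`≤ -1` only, `H` lies in the kernel of `ad Λ(λ)` and has components of degree `≤ 0` only, and
`e^{-ad U} W = Λ + H`. -/
def IsDressing (p : Loop D.Poly 𝔤 × Loop D.Poly 𝔤) : Prop :=
  p.1 ∈ LinearMap.range (LieAlgebra.ad (LaurentSeries D.Poly) (Loop D.Poly 𝔤)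
      (cyclicElement D.Poly D.gen D.Fθ)) ∧
  DegIn D.e D.d D.cox (fun k => k ≤ -1) p.1 ∧
  p.2 ∈ LinearMap.ker (LieAlgebra.ad (LaurentSeries D.Poly) (Loop D.Poly 𝔤)
      (cyclicElement D.Poly D.gen D.Fθ)) ∧
  DegIn D.e D.d D.cox (fun k => k ≤ 0) p.2 ∧
  D.IsExpAd (-p.1) D.W (cyclicElement D.Poly D.gen D.Fθ + p.2)

open Classical in
/-- The unique pair `(U(λ), H(λ))`. -/
def dressing : Loop D.Poly 𝔤 × Loop D.Poly 𝔤 :=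
  if h : ∃ p, D.IsDressing p then h.choose else 0

/-- `Λ_{m_a}(λ)` with coefficients in `𝒫`. -/
def ΛP (a : Fin n) : Loop D.Poly 𝔤 := mapLoop D.e (algebraMap ℂ D.Poly) (D.Λ a)

/-- `g b = ∑ k ≥ -1, h_{b,k} z^(k+1)` are the coefficients in
`H(λ) = ∑ a, ∑ k ≥ -1, (h_{n+1-a,k} / h) λ^(-k-2) Λ_{m_a}(λ)`. -/
def IsHamiltonianSeries (g : Fin n → PowerSeries D.Poly) : Prop :=
  D.dressing.2 = ∑ a : Fin n,
    (algebraMap ℂ (LaurentSeries D.Poly) (D.cox : ℂ)⁻¹ * HahnSeries.single (1 : ℤ) 1 *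
      HahnSeries.ofPowerSeries ℤ D.Poly (g a.rev)) • D.ΛP a

open Classical in
/-- The generating series of the hamiltonians. -/
def hamiltonianSeries : Fin n → PowerSeries D.Poly :=
  if h : ∃ g, D.IsHamiltonianSeries g then h.choose else 0

/-- The hamiltonian `h_{a,k}`, `k ≥ 0`. -/
def hamiltonian (x : Fin n × ℕ) : D.Poly := PowerSeries.coeff (x.2 + 1) (D.hamiltonianSeries x.1)

/-- The flow `d/dT^a_k = {h_{a,k}, ·}` on `𝒫`. -/
def flow (x : Fin n × ℕ) : Derivation ℂ D.Poly D.Poly := D.poisson (D.hamiltonian x)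

/-- The basic resolvent `R_a(λ) = e^{ad U(λ)} Λ_{m_a}(λ)`. -/
def R (a : Fin n) : Loop D.Poly 𝔤 := D.expAd D.dressing.1 (D.ΛP a)

/-! ### Generating series, `τ`-structure, `τ`-functions -/

/-- `X(λᵢ)`. -/
def evalAt {A : Type*} [CommRing A] [IsDomain A] [Algebra ℂ A] {m : ℕ} (i : Fin m)
    (X : Loop A 𝔤) : Ext (GenField A m) 𝔤 :=
  mapCoord D.e (substLam A i) X

/-- `∑ w((a₁,k₁), …, (aₘ,kₘ)) / (λ₁^(k₁+1) ⋯ λₘ^(kₘ+1))`, the sum over all `k₁, …, kₘ ≥ 0`. -/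
def genSeries {A : Type*} [CommRing A] {m : ℕ} (a : Fin m → Fin n)
    (w : (Fin m → Fin n × ℕ) → A) : GenField A m :=
  algebraMap (MvPowerSeries (Fin m) A) (GenField A m)
    ((∏ i, MvPowerSeries.X i) *
      (show MvPowerSeries (Fin m) A from fun k : Fin m →₀ ℕ => w fun i => (a i, k i)))

/-- `η_{ab} (m_a x + m_b y) / (x - y)²`. -/
def etaTerm {K : Type*} [Field K] [Algebra ℂ K] (a b : Fin n) (x y : K) : K :=
  algebraMap ℂ K (eta a b) * ((D.m a : K) * x + (D.m b : K) * y) / (x - y) ^ 2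

/-- `B(x₁, …, xₘ) = tr (ad x₁ ∘ ⋯ ∘ ad xₘ)`. -/
def multiTrace {K : Type*} [Field K] [Algebra ℂ K] {m : ℕ} (x : Fin m → Ext K 𝔤) : K :=
  LinearMap.trace K (Ext K 𝔤)
    (List.ofFn fun i => LieAlgebra.ad K (Ext K 𝔤) (x i)).prod

/-- `∑ s ∈ Sₘ, B(R_{a_{s₁}}(λ_{s₁}), …, R_{a_{sₘ}}(λ_{sₘ})) / ∏ᵢ (λ_{sᵢ} - λ_{sᵢ₊₁})`, with
`sₘ₊₁ = s₁`. -/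
def traceSum {A : Type*} [CommRing A] [IsDomain A] [Algebra ℂ A]
    (R : Fin n → Loop A 𝔤) {m : ℕ} (a : Fin m → Fin n) : GenField A m :=
  ∑ s : Equiv.Perm (Fin m),
    multiTrace (K := GenField A m) (fun i => D.evalAt (s i) (R (a (s i)))) /
      ∏ i, (lam A (s i) - lam A (s (finRotate m i)))

/-- `ω` is the `τ`-structure:
`∑ ω_{a,k;b,l} / (λ^(k+1) μ^(l+1)) = ((R_a(λ) | R_b(μ)) - η_{ab} (m_a λ + m_b μ)) / (λ - μ)²`. -/
def IsTauStructure (ω : Fin n × ℕ → Fin n × ℕ → D.Poly) : Prop :=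
  ∀ a b : Fin n, genSeries ![a, b] (fun x => ω (x 0) (x 1)) =
    form D.gen D.θ (GenField D.Poly 2) (D.evalAt 0 (D.R a)) (D.evalAt 1 (D.R b)) /
        (lam D.Poly 0 - lam D.Poly 1) ^ 2 -
      D.etaTerm a b (lam D.Poly (0 : Fin 2)) (lam D.Poly 1)

open Classical in
/-- The `τ`-structure `ω_{a,k;b,l}`. -/
def tauStructure : Fin n × ℕ → Fin n × ℕ → D.Poly :=
  if h : ∃ ω, D.IsTauStructure ω then h.choose else 0

/-- `ω_{a₁,k₁;…;aₘ,kₘ}` as an element of `𝒫`: the `τ`-structure for `m = 2`, differentiated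
along the flows for `m > 2`. -/
def omega : List (Fin n × ℕ) → D.Poly
  | x :: y :: l => l.foldr (fun t f => D.flow t f) (D.tauStructure x y)
  | _ => 0

/-- `u` is a formal solution `W(λ, T)` of `dW/dT^a_k = {h_{a,k}, W}`, given by the values
`u^j_k(T)` of the coordinates. -/
def IsSolution (u : D.Var → MvPowerSeries (Fin n × ℕ) ℂ) : Prop :=
  ∀ (x : Fin n × ℕ) (v : D.Var), MvPowerSeries.pderiv ℂ x (u v) =
    MvPolynomial.aeval u (D.flow x (MvPolynomial.X v))

/-- `R_a(λ, T)`, the basic resolvent evaluated on `u`. -/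
def Rsol (u : D.Var → MvPowerSeries (Fin n × ℕ) ℂ) (a : Fin n) :
    Loop (MvPowerSeries (Fin n × ℕ) ℂ) 𝔤 :=
  mapLoop D.e (MvPolynomial.aeval u).toRingHom (D.R a)

/-- `R_a(λ, 0)`. -/
def Rsol₀ (u : D.Var → MvPowerSeries (Fin n × ℕ) ℂ) (a : Fin n) : Loop ℂ 𝔤 :=
  mapLoop D.e (MvPowerSeries.constantCoeff (σ := Fin n × ℕ) (R := ℂ)) (D.Rsol u a)

/-- `τ` is a `τ`-function of the solution `u`. -/
def IsTauFunction (u : D.Var → MvPowerSeries (Fin n × ℕ) ℂ)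
    (τ : MvPowerSeries (Fin n × ℕ) ℂ) : Prop :=
  MvPowerSeries.constantCoeff τ ≠ 0 ∧
  ∀ x y : Fin n × ℕ, MvPowerSeries.pderiv ℂ x (MvPowerSeries.pderiv ℂ y (logSeries τ)) =
    MvPolynomial.aeval u (D.tauStructure x y)

end Data

/-- The iterated derivative `dᵐ log τ / dT^{a₁}_{k₁} ⋯ dT^{aₘ}_{kₘ}`. -/
def logDeriv {σ : Type*} (τ : MvPowerSeries σ ℂ) (l : List σ) : MvPowerSeries σ ℂ :=
  l.foldr (fun t f => MvPowerSeries.pderiv ℂ t f) (logSeries τ)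

end DrinfeldSokolov

end

set_option linter.unusedSectionVars false

noncomputable section

namespace DrinfeldSokolov

/-! ### Extension of scalars of a Lie algebra -/

section Extension

variable {𝔤 : Type*} [LieRing 𝔤] [LieAlgebra ℂ 𝔤] {N : ℕ}
  {K : Type*} [CommRing K] [Algebra ℂ K] {K' : Type*} [CommRing K'] [Algebra ℂ K']

/-! For two indices the formula is the definition of `ω`: a 2-cycle has denominator `-(λ₁ - λ₂)²`,
and `B(x, y) = 2 h^∨ (x | y)`. Further indices come from the generating derivations `∇_c = ∑
λ_c^(-k-1) d/dT^a_k`, and everything rests on one identity, `∇_c R_b(λ) = [R_a(λ_c), R_b(λ)] / (λ_c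
- λ) - [Q_a, R_b(λ)]`, where `Q_a`, the coefficient of `λ` in `R_a`, does not depend on `λ`
(`deriv_evalAt_eq`, up to a factor `λ_c`). Apply it to a cyclic product `tr (A_1 ⋯ A_m) / ∏ (λ_i -
λ_{i+1})`. The `Q`-terms form a simultaneous commutator and vanish under the trace. The commutators
with `R_a(λ_c)` at two neighbouring factors combine, by partial fractions, into the product with
`R_a(λ_c)` inserted between them (`deriv_trace_mul_pathProd`). Summing over all cycles on `m`
letters gives all cycles on `m + 1` letters (`deriv_cycleSum`). Each cycle is listed by `m`
permutations, whence the factor `1/m`.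

The identity for `∇_c` is the resummed form of `dR_b/dT^a_k = [(λ^k R_a)_+, R_b]` (`flow_R`). Write
`g = e^{ad U}`. The `R_a` are images under `g` of elements of the centraliser of `Λ`, so they
commute with each other and with `W`. For a derivation `δ` of the coefficients, `g⁻¹ δ g - δ` is a
linear derivation, hence inner (`exists_deriv_dress`). This yields `δ (H | Λ_{m_a}) = (δW | R_a)`
(`deriv_hamSeries`), which the Poisson bracket turns into `dW/dT^a_k = [(λ^k R_a)_+, W]` (`flow_W`).
A descent on degrees carries this equation over to `R_b`.

The structure behind this is the decomposition of the loop algebra into kernel and image of `ad Λ`,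
with abelian kernel. It is direct because the pairing of the `Λ_{m_a}` is nondegenerate. The kernel
is abelian because its dimension `n` is the least possible for a centraliser (`le_finrank_ker_ad`),
and a centraliser of minimal dimension which meets the image trivially is abelian
(`lie_eq_zero_of_minimal`).

The objects chosen in the definitions must be shown to exist: the dressing by successive
approximation (`exists_dressing`), and `ω` by a Taylor expansion showing that its numerator vanishes
to second order at `λ = μ` (`sum_ev_resSeries`). For solutions, coefficients are pushed along
homomorphisms which need not extend to the fraction fields; this is harmless because all
denominators have complex coefficients (`Corr`). -/

theorem mapCoord_eq_rTensor (e : Module.Basis (Fin N) ℂ 𝔤) (φ : K →ₗ[ℂ] K') (X : Ext K 𝔤) :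
    mapCoord e φ X = LinearMap.rTensor 𝔤 φ X := by
  conv_rhs => rw [← (e.baseChange K).sum_repr X]
  rw [map_sum]
  refine Finset.sum_congr rfl fun j _ => ?_
  rw [Module.Basis.baseChange_apply, TensorProduct.smul_tmul', smul_eq_mul, mul_one,
    LinearMap.rTensor_tmul]

theorem repr_rTensor (e : Module.Basis (Fin N) ℂ 𝔤) (φ : K →ₗ[ℂ] K') (X : Ext K 𝔤) (j : Fin N) :
    (e.baseChange K').repr (LinearMap.rTensor 𝔤 φ X) j = φ ((e.baseChange K).repr X j) := by
  induction X using TensorProduct.induction_on with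
  | zero => simp
  | tmul a x =>
    simp only [LinearMap.rTensor_tmul, Module.Basis.baseChange_repr_tmul, map_smul]
  | add x y hx hy => simp only [map_add, Finsupp.add_apply, hx, hy]

theorem rTensor_smul (φ : K →ₐ[ℂ] K') (f : K) (X : Ext K 𝔤) :
    LinearMap.rTensor 𝔤 φ.toLinearMap (f • X) = φ f • LinearMap.rTensor 𝔤 φ.toLinearMap X := by
  induction X using TensorProduct.induction_on with
  | zero => simp
  | tmul a x => simp [TensorProduct.smul_tmul']
  | add x y hx hy => simp only [smul_add, map_add, hx, hy]

theorem rTensor_lie (φ : K →ₐ[ℂ] K') (X Y : Ext K 𝔤) :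
    LinearMap.rTensor 𝔤 φ.toLinearMap ⁅X, Y⁆ =
      ⁅LinearMap.rTensor 𝔤 φ.toLinearMap X, LinearMap.rTensor 𝔤 φ.toLinearMap Y⁆ := by
  induction X using TensorProduct.induction_on with
  | zero => simp
  | add x y hx hy => simp only [add_lie, map_add, hx, hy]
  | tmul a x =>
    induction Y using TensorProduct.induction_on with
    | zero => simp
    | add x y hx hy => simp only [lie_add, map_add, hx, hy]
    | tmul b y => simp [LieAlgebra.ExtendScalars.bracket_tmul]

/-- A derivation of the scalars acts on `K ⊗ 𝔤`. -/
def derivExt (𝔤 : Type*) [LieRing 𝔤] [LieAlgebra ℂ 𝔤] (δ : Derivation ℂ K K) :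
    Ext K 𝔤 →ₗ[ℂ] Ext K 𝔤 := LinearMap.rTensor 𝔤 (δ : K →ₗ[ℂ] K)

theorem derivExt_tmul (δ : Derivation ℂ K K) (a : K) (x : 𝔤) :
    derivExt 𝔤 δ (a ⊗ₜ x) = δ a ⊗ₜ x := rfl

theorem repr_derivExt (e : Module.Basis (Fin N) ℂ 𝔤) (δ : Derivation ℂ K K) (X : Ext K 𝔤)
    (j : Fin N) : (e.baseChange K).repr (derivExt 𝔤 δ X) j = δ ((e.baseChange K).repr X j) :=
  repr_rTensor e _ X j

theorem derivExt_smul (δ : Derivation ℂ K K) (f : K) (X : Ext K 𝔤) :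
    derivExt 𝔤 δ (f • X) = δ f • X + f • derivExt 𝔤 δ X := by
  induction X using TensorProduct.induction_on with
  | zero => simp
  | tmul a x =>
    simp only [TensorProduct.smul_tmul', derivExt_tmul, smul_eq_mul, Derivation.leibniz,
      TensorProduct.add_tmul]
    rw [mul_comm a, add_comm]
  | add x y hx hy => simp only [smul_add, map_add, hx, hy]; abel

theorem derivExt_lie (δ : Derivation ℂ K K) (X Y : Ext K 𝔤) :
    derivExt 𝔤 δ ⁅X, Y⁆ = ⁅derivExt 𝔤 δ X, Y⁆ + ⁅X, derivExt 𝔤 δ Y⁆ := by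
  induction X using TensorProduct.induction_on with
  | zero => simp
  | add x y hx hy => simp only [add_lie, map_add, hx, hy]; abel
  | tmul a x =>
    induction Y using TensorProduct.induction_on with
    | zero => simp
    | add x y hx hy => simp only [lie_add, map_add, hx, hy]; abel
    | tmul b y =>
      simp only [LieAlgebra.ExtendScalars.bracket_tmul, derivExt_tmul, Derivation.leibniz,
        TensorProduct.add_tmul, smul_eq_mul]
      rw [mul_comm b, add_comm]

/-- The matrix of `ad X` in the basis obtained from `e`. -/
def adMat (e : Module.Basis (Fin N) ℂ 𝔤) (X : Ext K 𝔤) : Matrix (Fin N) (Fin N) K :=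
  LinearMap.toMatrixAlgEquiv (e.baseChange K) (LieAlgebra.ad K (Ext K 𝔤) X)

theorem adMat_apply (e : Module.Basis (Fin N) ℂ 𝔤) (X : Ext K 𝔤) (i j : Fin N) :
    adMat e X i j = (e.baseChange K).repr ⁅X, (1 : K) ⊗ₜ[ℂ] e j⁆ i := by
  rw [adMat, LinearMap.toMatrixAlgEquiv_apply, LieAlgebra.ad_apply, Module.Basis.baseChange_apply]

theorem adMat_sub (e : Module.Basis (Fin N) ℂ 𝔤) (X Y : Ext K 𝔤) :
    adMat e (X - Y) = adMat e X - adMat e Y := by simp [adMat]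

theorem adMat_smul (e : Module.Basis (Fin N) ℂ 𝔤) (f : K) (X : Ext K 𝔤) :
    adMat e (f • X) = f • adMat e X := by simp [adMat]

theorem adMat_lie (e : Module.Basis (Fin N) ℂ 𝔤) (X Y : Ext K 𝔤) :
    adMat e ⁅X, Y⁆ = adMat e X * adMat e Y - adMat e Y * adMat e X := by
  have h : LieAlgebra.ad K (Ext K 𝔤) ⁅X, Y⁆ = LieAlgebra.ad K (Ext K 𝔤) X *
      LieAlgebra.ad K (Ext K 𝔤) Y - LieAlgebra.ad K (Ext K 𝔤) Y * LieAlgebra.ad K (Ext K 𝔤) X := by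
    refine LinearMap.ext fun Z => ?_
    simp
  rw [adMat, h, map_sub, map_mul, map_mul]
  rfl

theorem adMat_rTensor (e : Module.Basis (Fin N) ℂ 𝔤) (φ : K →ₐ[ℂ] K') (X : Ext K 𝔤) :
    adMat e (LinearMap.rTensor 𝔤 φ.toLinearMap X) = (adMat e X).map φ := by
  ext i j
  have h : (1 : K') ⊗ₜ[ℂ] e j = LinearMap.rTensor 𝔤 φ.toLinearMap ((1 : K) ⊗ₜ[ℂ] e j) := by simp
  rw [adMat_apply, Matrix.map_apply, adMat_apply, h, ← rTensor_lie, repr_rTensor]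
  rfl

/-- The vectors `1 ⊗ e_j` are killed by the derivation, so only the coefficients of `X` get
differentiated. -/
theorem adMat_derivExt (e : Module.Basis (Fin N) ℂ 𝔤) (δ : Derivation ℂ K K) (X : Ext K 𝔤) :
    adMat e (derivExt 𝔤 δ X) = (adMat e X).map δ := by
  ext i j
  rw [adMat_apply, Matrix.map_apply, adMat_apply, ← repr_derivExt, derivExt_lie, derivExt_tmul]
  simp

theorem trace_ad_list (e : Module.Basis (Fin N) ℂ 𝔤) (l : List (Ext K 𝔤)) :
    LinearMap.trace K (Ext K 𝔤) (l.map fun x => LieAlgebra.ad K (Ext K 𝔤) x).prod =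
      ((l.map (adMat e)).prod).trace := by
  rw [LinearMap.trace_eq_matrix_trace K (e.baseChange K)]
  change (LinearMap.toMatrixAlgEquiv (e.baseChange K) _).trace = _
  rw [map_list_prod, List.map_map]
  rfl

/-- The Killing form of `K ⊗ 𝔤`. -/
def kap (K : Type*) [CommRing K] [Algebra ℂ K] (X Y : Ext K 𝔤) : K := killingForm K (Ext K 𝔤) X Y

theorem kap_comm (X Y : Ext K 𝔤) : kap K X Y = kap K Y X := LieModule.traceForm_comm _ _ _ _ _

theorem kap_lie (X Y Z : Ext K 𝔤) : kap K ⁅X, Y⁆ Z = kap K X ⁅Y, Z⁆ :=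
  LieModule.traceForm_apply_lie_apply _ _ _ _ _ _

theorem kap_add_left (X Y Z : Ext K 𝔤) : kap K (X + Y) Z = kap K X Z + kap K Y Z := by
  simp [kap]

theorem kap_sub_left (X Y Z : Ext K 𝔤) : kap K (X - Y) Z = kap K X Z - kap K Y Z := by
  simp [kap]

theorem kap_smul_left (f : K) (X Y : Ext K 𝔤) : kap K (f • X) Y = f * kap K X Y := by
  simp [kap]

theorem kap_sum_left {ι : Type*} (s : Finset ι) (f : ι → Ext K 𝔤) (Y : Ext K 𝔤) :
    kap K (∑ i ∈ s, f i) Y = ∑ i ∈ s, kap K (f i) Y := by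
  simp [kap]

theorem kap_add_right (X Y Z : Ext K 𝔤) : kap K X (Y + Z) = kap K X Y + kap K X Z := by
  simp [kap]

theorem kap_smul_right (f : K) (X Y : Ext K 𝔤) : kap K X (f • Y) = f * kap K X Y := by
  simp [kap]

theorem kap_sum_right {ι : Type*} (s : Finset ι) (f : ι → Ext K 𝔤) (Y : Ext K 𝔤) :
    kap K Y (∑ i ∈ s, f i) = ∑ i ∈ s, kap K Y (f i) := by
  simp [kap]

theorem kap_eq_trace (e : Module.Basis (Fin N) ℂ 𝔤) (X Y : Ext K 𝔤) :
    kap K X Y = (adMat e X * adMat e Y).trace := by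
  rw [kap, killingForm_apply_apply, LinearMap.trace_eq_matrix_trace K (e.baseChange K),
    LinearMap.toMatrix_comp _ (e.baseChange K)]
  rfl

theorem kap_tmul [FiniteDimensional ℂ 𝔤] (x y : 𝔤) (a b : K) :
    kap K (a ⊗ₜ[ℂ] x) (b ⊗ₜ[ℂ] y) = a * b * algebraMap ℂ K (killingForm ℂ 𝔤 x y) := by
  rw [kap, show killingForm K (Ext K 𝔤) = (killingForm ℂ 𝔤).baseChange K from
    LieModule.traceForm_baseChange ℂ 𝔤 𝔤 K]
  simp [LinearMap.BilinForm.baseChange_tmul, Algebra.algebraMap_eq_smul_one]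

theorem map_kap [FiniteDimensional ℂ 𝔤] (φ : K →ₐ[ℂ] K') (X Y : Ext K 𝔤) :
    kap K' (LinearMap.rTensor 𝔤 φ.toLinearMap X) (LinearMap.rTensor 𝔤 φ.toLinearMap Y) =
      φ (kap K X Y) := by
  have e := Module.finBasis ℂ 𝔤
  rw [kap_eq_trace e, kap_eq_trace e, adMat_rTensor, adMat_rTensor]
  simp only [Matrix.trace, Matrix.diag, Matrix.mul_apply, Matrix.map_apply, map_sum, map_mul]

theorem deriv_kap [FiniteDimensional ℂ 𝔤] (δ : Derivation ℂ K K) (X Y : Ext K 𝔤) :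
    δ (kap K X Y) = kap K (derivExt 𝔤 δ X) Y + kap K X (derivExt 𝔤 δ Y) := by
  have e := Module.finBasis ℂ 𝔤
  rw [kap_eq_trace e, kap_eq_trace e, kap_eq_trace e, adMat_derivExt, adMat_derivExt]
  simp only [Matrix.trace, Matrix.diag, Matrix.mul_apply, map_sum, Derivation.leibniz,
    smul_eq_mul, Matrix.map_apply, ← Finset.sum_add_distrib]
  refine Finset.sum_congr rfl fun i _ => Finset.sum_congr rfl fun j _ => ?_
  ring

/-- The Killing form of `𝔤` has dual bases. -/
theorem exists_dual_family [FiniteDimensional ℂ 𝔤] [LieAlgebra.IsKilling ℂ 𝔤] (e : Module.Basis (Fin N) ℂ 𝔤) :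
    ∃ e' : Fin N → 𝔤, ∀ i j, killingForm ℂ 𝔤 (e' i) (e j) = if j = i then 1 else 0 :=
  ⟨(killingForm ℂ 𝔤).dualBasis (LieAlgebra.IsKilling.killingForm_nondegenerate ℂ 𝔤) e,
    fun i j => by
      classical
      convert! LinearMap.BilinForm.apply_dualBasis_left
        (LieAlgebra.IsKilling.killingForm_nondegenerate ℂ 𝔤) e i j⟩

theorem kap_dual_eq_repr [FiniteDimensional ℂ 𝔤] (e : Module.Basis (Fin N) ℂ 𝔤) (e' : Fin N → 𝔤)
    (h : ∀ i j, killingForm ℂ 𝔤 (e' i) (e j) = if j = i then 1 else 0) (X : Ext K 𝔤)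
    (i : Fin N) : kap K ((1 : K) ⊗ₜ e' i) X = (e.baseChange K).repr X i := by
  conv_lhs => rw [← (e.baseChange K).sum_repr X]
  rw [kap_sum_right, Finset.sum_eq_single i]
  · rw [Module.Basis.baseChange_apply, kap_smul_right, kap_tmul, h]
    simp
  · intro j _ hj
    rw [Module.Basis.baseChange_apply, kap_smul_right, kap_tmul, h, if_neg hj]
    simp
  · simp

theorem eq_zero_of_kap [FiniteDimensional ℂ 𝔤] [LieAlgebra.IsKilling ℂ 𝔤] (X : Ext K 𝔤) (h : ∀ Y, kap K X Y = 0) :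
    X = 0 := by
  have e := Module.finBasis ℂ 𝔤
  obtain ⟨e', he'⟩ := exists_dual_family e
  apply (e.baseChange K).repr.injective
  ext j
  rw [← kap_dual_eq_repr e e' he', kap_comm, h]
  simp

theorem exists_kap_eq [FiniteDimensional ℂ 𝔤] [LieAlgebra.IsKilling ℂ 𝔤] (f : Ext K 𝔤 →ₗ[K] K) :
    ∃ Z : Ext K 𝔤, ∀ X, kap K Z X = f X := by
  have e := Module.finBasis ℂ 𝔤
  obtain ⟨e', he'⟩ := exists_dual_family e
  refine ⟨∑ i, f ((e.baseChange K) i) • ((1 : K) ⊗ₜ e' i), fun X => ?_⟩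
  conv_rhs => rw [← (e.baseChange K).sum_repr X]
  rw [kap_sum_left, map_sum]
  refine Finset.sum_congr rfl fun i _ => ?_
  rw [kap_smul_left, kap_dual_eq_repr e e' he', map_smul, smul_eq_mul, mul_comm]

/-- A derivation satisfies `ad (T X) = T ∘ ad X - ad X ∘ T`; cyclicity of the trace moves the
commutator onto `ad X` and `ad Y`. -/
theorem trace_ad_mul_lie (T : Module.End K (Ext K 𝔤)) (X Y : Ext K 𝔤)
    (hT : ∀ X Y, T ⁅X, Y⁆ = ⁅T X, Y⁆ + ⁅X, T Y⁆) :
    kap K (T X) Y = LinearMap.trace K _ (T * LieAlgebra.ad K (Ext K 𝔤) ⁅X, Y⁆) := by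
  have h : LieAlgebra.ad K (Ext K 𝔤) (T X) = T * LieAlgebra.ad K (Ext K 𝔤) X -
      LieAlgebra.ad K (Ext K 𝔤) X * T := by
    refine LinearMap.ext fun Z => ?_
    simp [hT]
  have h' : LieAlgebra.ad K (Ext K 𝔤) ⁅X, Y⁆ = LieAlgebra.ad K (Ext K 𝔤) X *
      LieAlgebra.ad K (Ext K 𝔤) Y - LieAlgebra.ad K (Ext K 𝔤) Y * LieAlgebra.ad K (Ext K 𝔤) X := by
    refine LinearMap.ext fun Z => ?_
    simp
  rw [kap, killingForm_apply_apply, ← Module.End.mul_eq_comp, h, h', sub_mul, mul_sub, map_sub,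
    map_sub, mul_assoc, mul_assoc, LinearMap.trace_mul_comm K _ (T * _), mul_assoc]

/-- Every derivation of `K ⊗ 𝔤` is inner. -/
theorem exists_ad_eq_of_leibniz [FiniteDimensional ℂ 𝔤] [LieAlgebra.IsKilling ℂ 𝔤] (T : Ext K 𝔤 →ₗ[K] Ext K 𝔤)
    (hT : ∀ X Y : Ext K 𝔤, T ⁅X, Y⁆ = ⁅T X, Y⁆ + ⁅X, T Y⁆) : ∃ Z : Ext K 𝔤, ∀ X, T X = ⁅Z, X⁆ := by
  -- `Z` represents the functional `X ↦ tr (T ∘ ad X)`, which for `T = ad Z'` would be the Killing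
  -- form with `Z'`.
  obtain ⟨Z, hZ⟩ := exists_kap_eq ((LinearMap.trace K _).comp
    ((LinearMap.mulLeft K (T : Module.End K (Ext K 𝔤))).comp
      (LieAlgebra.ad K (Ext K 𝔤) : Ext K 𝔤 →ₗ[K] Module.End K (Ext K 𝔤))))
  refine ⟨Z, fun X => sub_eq_zero.1 (eq_zero_of_kap _ fun Y => ?_)⟩
  rw [kap_sub_left, kap_lie, hZ, trace_ad_mul_lie T X Y hT, sub_eq_zero]
  rfl

end Extension

/-! ### The principal gradation -/

section Principal

variable {𝔤 : Type*} [LieRing 𝔤] [LieAlgebra ℂ 𝔤] [FiniteDimensional ℂ 𝔤]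
  [LieAlgebra.IsSimple ℂ 𝔤] {H : LieSubalgebra ℂ 𝔤} [H.IsCartanSubalgebra] {n N : ℕ}

open LieAlgebra.IsKilling

/-- The simple roots are linearly independent, so some functional takes the value `1` on all of
them; by reflexivity it is an element of `H`. Heights become eigenvalues of `ad ρ`, and statements
about degrees become comparisons of eigenvalues. -/
theorem exists_rho (B : LieAlgebra.Basis (Fin n) H) :
    ∃ ρ : H, ∀ α : H.root, (α.1 : H → ℂ) ρ = (B.base.height α : ℂ) := by
  obtain ⟨f, hf⟩ := Module.exists_dual_forall_apply_eq_one B.base.linearIndepOn_root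
  refine ⟨(Module.evalEquiv ℂ H).symm f, fun α => ?_⟩
  have h1 : ∀ β : H.root, (β.1 : H → ℂ) ((Module.evalEquiv ℂ H).symm f) =
      f ((rootSystem H).root β) := by
    intro β
    have := Module.apply_evalEquiv_symm_apply ℂ H ((rootSystem H).root β) f
    rw [← this]
    rfl
  obtain ⟨g, -, -, hg⟩ := B.base.exists_root_eq_sum_int α
  rw [h1, RootPairing.Base.height_eq_sum hg, hg, map_sum, Int.cast_sum]
  refine Finset.sum_congr rfl fun j hj => ?_
  rw [map_zsmul, hf j hj]
  simp

/-- The grading element of the principal gradation. -/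
def rho (B : LieAlgebra.Basis (Fin n) H) : H := (exists_rho B).choose

theorem root_rho (B : LieAlgebra.Basis (Fin n) H) (α : H.root) :
    (α.1 : H → ℂ) (rho B) = (B.base.height α : ℂ) := (exists_rho B).choose_spec α

theorem lie_rho (B : LieAlgebra.Basis (Fin n) H) (k : ℤ) (x : 𝔤) (hx : x ∈ principalPiece B k) :
    ⁅(rho B : 𝔤), x⁆ = (k : ℂ) • x := by
  unfold principalPiece at hx
  split_ifs at hx with hk
  · subst hk
    have := B.isLieAbelian_cartan
    have h2 : ⁅rho B, (⟨x, hx⟩ : H)⁆ = 0 := trivial_lie_zero _ _ _ _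
    have h3 := congrArg (Subtype.val) h2
    simpa using h3
  · suffices h : (⨆ (α : H.root) (_ : B.base.height α = k),
        (LieAlgebra.rootSpace H α.1).toSubmodule) ≤
        LinearMap.ker (LieAlgebra.ad ℂ 𝔤 (rho B : 𝔤) - (k : ℂ) • LinearMap.id) by
      have h1 := h hx
      rw [LinearMap.mem_ker, LinearMap.sub_apply, sub_eq_zero] at h1
      simpa using h1
    refine iSup_le fun α => iSup_le fun hα y hy => ?_
    rw [LinearMap.mem_ker, LinearMap.sub_apply, sub_eq_zero]
    have := lie_eq_smul_of_mem_rootSpace hy (rho B)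
    rw [root_rho, hα] at this
    simpa using this

theorem lie_rho_e (B : LieAlgebra.Basis (Fin n) H) (i : Fin n) :
    ⁅(rho B : 𝔤), B.e i⁆ = B.e i := by
  have h := B.baseSupp_apply_smul_e i (rho B)
  have h1 : B.baseSupp i (rho B) = 1 := by
    have h2 := root_rho B (B.baseSupportEquiv i).1
    rw [RootPairing.Base.height_one_of_mem_support (B.baseSupportEquiv i).2] at h2
    rw [Int.cast_one] at h2
    exact h2
  rw [h1, one_smul] at h
  exact h.symm

theorem lie_rho_principalNilpotent (B : LieAlgebra.Basis (Fin n) H) :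
    ⁅(rho B : 𝔤), principalNilpotent B⁆ = principalNilpotent B := by
  rw [principalNilpotent, lie_sum]
  exact Finset.sum_congr rfl fun i _ => lie_rho_e B i

theorem lie_rho_of_mem_neg (B : LieAlgebra.Basis (Fin n) H) (θ : H.root) (x : 𝔤)
    (hx : x ∈ LieAlgebra.rootSpace H (-(θ.1 : H → ℂ))) :
    ⁅(rho B : 𝔤), x⁆ = ((-B.base.height θ : ℤ) : ℂ) • x := by
  have := lie_eq_smul_of_mem_rootSpace hx (rho B)
  rw [Pi.neg_apply, root_rho] at this
  simpa using this

/-- `θ - β` is a sum of simple roots, so its value at `rho B` is a natural number. -/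
theorem height_le_of_isHighestRoot {B : LieAlgebra.Basis (Fin n) H} {θ : H.root}
    (hθ : IsHighestRoot B θ) (β : H.root) : B.base.height β ≤ B.base.height θ := by
  have key : ∀ x ∈ AddSubmonoid.closure ((rootSystem H).root '' (B.base.support : Set H.root)),
      ∃ k : ℕ, x (rho B) = k := by
    intro x hx
    induction hx using AddSubmonoid.closure_induction with
    | mem x hx =>
      obtain ⟨α, hα, rfl⟩ := hx
      refine ⟨1, ?_⟩
      have h2 := root_rho B α
      rw [RootPairing.Base.height_one_of_mem_support hα] at h2
      simpa using h2
    | zero => exact ⟨0, by simp⟩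
    | add x y _ _ hx hy =>
      obtain ⟨k, hk⟩ := hx
      obtain ⟨l, hl⟩ := hy
      exact ⟨k + l, by simp [hk, hl]⟩
  obtain ⟨k, hk⟩ := key _ (hθ β)
  have h1 : (B.base.height θ : ℂ) - B.base.height β = k := by
    rw [← root_rho, ← root_rho, ← hk]
    rfl
  have h2 : B.base.height θ - B.base.height β = k := by exact_mod_cast h1
  omega

theorem neg_height_le_of_isHighestRoot {B : LieAlgebra.Basis (Fin n) H} {θ : H.root}
    (hθ : IsHighestRoot B θ) (β : H.root) : -B.base.height β ≤ B.base.height θ := by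
  let := (rootSystem H).indexNeg
  rw [← RootPairing.Base.height_reflectionPerm_self]
  exact height_le_of_isHighestRoot hθ _

theorem one_le_height_of_isHighestRoot {B : LieAlgebra.Basis (Fin n) H} {θ : H.root}
    (hθ : IsHighestRoot B θ) : 1 ≤ B.base.height θ := by
  have h1 := neg_height_le_of_isHighestRoot hθ θ
  have h2 := B.base.height_ne_zero θ
  omega

theorem abs_le_of_principalPiece_ne_bot {B : LieAlgebra.Basis (Fin n) H} {θ : H.root}
    (hθ : IsHighestRoot B θ) {k : ℤ} (hk : principalPiece B k ≠ ⊥) :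
    |k| ≤ B.base.height θ := by
  have h0 := one_le_height_of_isHighestRoot hθ
  by_cases hk0 : k = 0
  · subst hk0; simp; omega
  · rw [principalPiece, if_neg hk0] at hk
    by_contra hlt
    apply hk
    simp only [iSup_eq_bot]
    intro α hα
    exfalso
    have h1 := height_le_of_isHighestRoot hθ α
    have h2 := neg_height_le_of_isHighestRoot hθ α
    rw [hα] at h1 h2
    exact hlt (abs_le.2 ⟨by omega, h1⟩)

namespace Data

variable (D : Data H n N)

theorem two_le_cox : 2 ≤ D.cox := by
  have := one_le_height_of_isHighestRoot D.highest
  unfold cox coxeter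
  omega

theorem cox_pos : 0 < D.cox := by have := D.two_le_cox; omega

/-- Strictness is what keeps positive powers of `λ` out of `u^j(λ)` and powers above the first out
of `R_a(λ)`. -/
theorem abs_d_lt (j : Fin N) : |D.d j| < D.cox := by
  have h : principalPiece D.gen (D.d j) ≠ ⊥ := by
    intro h
    have h1 := D.e_mem j
    rw [h, Submodule.mem_bot] at h1
    exact D.e.ne_zero j h1
  have := abs_le_of_principalPiece_ne_bot D.highest h
  unfold cox coxeter
  omega

theorem d_lt (j : Fin N) : D.d j < D.cox := (abs_lt.1 (D.abs_d_lt j)).2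

theorem neg_cox_lt_d (j : Fin N) : -D.cox < D.d j := (abs_lt.1 (D.abs_d_lt j)).1

theorem m_lt (a : Fin n) : (D.m a : ℤ) < D.cox := by
  have h1 := D.exponents.2 (D.m a)
  have h : principalPiece D.gen (D.m a) ≠ ⊥ := by
    intro h
    rw [h, inf_bot_eq, finrank_bot, Fintype.card_eq_zero_iff] at h1
    exact h1.false ⟨a, rfl⟩
  have := abs_le_of_principalPiece_ne_bot D.highest h
  rw [Nat.abs_cast] at this
  unfold cox coxeter
  omega

/-- The factor `1 / (2 h^∨)` relating the normalised form to the Killing form. -/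
def nrm : ℂ := (2 * (dualCoxeter D.gen D.θ : ℂ))⁻¹

theorem form₀_eq (x y : 𝔤) : form₀ D.gen D.θ x y = D.nrm * killingForm ℂ 𝔤 x y := rfl

theorem form_eq (K : Type*) [CommRing K] [Algebra ℂ K] (X Y : Ext K 𝔤) :
    form D.gen D.θ K X Y = algebraMap ℂ K D.nrm * kap K X Y := rfl

/-- The normalisation `(E_θ | E_{-θ}) = 1` alone excludes a vanishing factor, so the value of `h^∨`
never matters. -/
theorem nrm_ne_zero : D.nrm ≠ 0 := by
  intro h
  have := D.form_Eθ_Fθ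
  rw [form₀_eq, h, zero_mul] at this
  exact zero_ne_one this

theorem lie_rho_basis (j : Fin N) : ⁅(rho D.gen : 𝔤), D.e j⁆ = (D.d j : ℂ) • D.e j :=
  lie_rho D.gen _ _ (D.e_mem j)

/-- In a basis of eigenvectors of `ad ρ`, an eigenvector only has components along basis vectors
with the same eigenvalue. -/
theorem d_eq_of_repr_ne_zero {x : 𝔤} {k : ℤ} (hx : ⁅(rho D.gen : 𝔤), x⁆ = (k : ℂ) • x) {j : Fin N}
    (hj : D.e.repr x j ≠ 0) : D.d j = k := by
  have h1 : D.e.repr ⁅(rho D.gen : 𝔤), x⁆ j = (D.d j : ℂ) * D.e.repr x j := by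
    conv_lhs => rw [← D.e.sum_repr x]
    simp only [lie_sum, lie_smul, lie_rho_basis, map_sum, map_smul, Finsupp.coe_finsetSum,
      Finset.sum_apply, Finsupp.smul_apply, Module.Basis.repr_self, smul_eq_mul]
    rw [Finset.sum_eq_single j]
    · simp; ring
    · intro i _ hi
      simp [hi]
    · simp
  rw [hx, map_smul, Finsupp.smul_apply, smul_eq_mul] at h1
  have := mul_right_cancel₀ hj h1
  exact_mod_cast this.symm

/-- Invariance of the form under `ad ρ` gives `(k + l) (x | y) = 0`. -/
theorem killingForm_eq_zero {x y : 𝔤} {k l : ℤ} (hx : ⁅(rho D.gen : 𝔤), x⁆ = (k : ℂ) • x)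
    (hy : ⁅(rho D.gen : 𝔤), y⁆ = (l : ℂ) • y) (hkl : k + l ≠ 0) : killingForm ℂ 𝔤 x y = 0 := by
  have h := LieModule.traceForm_apply_lie_apply ℂ 𝔤 𝔤 x (rho D.gen : 𝔤) y
  rw [← lie_skew, hx, hy] at h
  have h2 : ((k : ℂ) + l) * killingForm ℂ 𝔤 x y = 0 := by
    have h3 : -((k : ℂ) * killingForm ℂ 𝔤 x y) = l * killingForm ℂ 𝔤 x y := by simpa using h
    linear_combination -h3
  rcases mul_eq_zero.1 h2 with h3 | h3
  · exact absurd (by exact_mod_cast h3) hkl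
  · exact h3

theorem d_bracket {i j s : Fin N} (h : D.e.repr ⁅D.e i, D.e j⁆ s ≠ 0) :
    D.d s = D.d i + D.d j := by
  refine D.d_eq_of_repr_ne_zero ?_ h
  rw [leibniz_lie, lie_rho_basis, lie_rho_basis]
  simp [add_smul]

theorem d_killingForm {i j : Fin N} (h : killingForm ℂ 𝔤 (D.e i) (D.e j) ≠ 0) :
    D.d i + D.d j = 0 := by
  by_contra hne
  exact h (D.killingForm_eq_zero (D.lie_rho_basis i) (D.lie_rho_basis j) hne)

theorem lie_rho_Fθ : ⁅(rho D.gen : 𝔤), D.Fθ⁆ = ((1 - D.cox : ℤ) : ℂ) • D.Fθ := by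
  rw [lie_rho_of_mem_neg D.gen D.θ D.Fθ D.Fθ_mem]
  congr 2
  unfold cox coxeter
  ring

end Data
end Principal

/-! ### Centralisers of minimal dimension -/

section Centraliser

variable {𝔤 : Type*} [LieRing 𝔤] [LieAlgebra ℂ 𝔤] {N : ℕ}
  {K : Type*} [CommRing K] [Algebra ℂ K] {K' : Type*} [CommRing K'] [Algebra ℂ K']

theorem adMat_one_tmul (e : Module.Basis (Fin N) ℂ 𝔤) (x : 𝔤) :
    adMat e ((1 : K) ⊗ₜ[ℂ] x) =
      (LinearMap.toMatrixAlgEquiv e (LieAlgebra.ad ℂ 𝔤 x)).map (algebraMap ℂ K) := by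
  ext i j
  rw [adMat_apply, LieAlgebra.ExtendScalars.bracket_tmul, Module.Basis.baseChange_repr_tmul,
    Matrix.map_apply, LinearMap.toMatrixAlgEquiv_apply, LieAlgebra.ad_apply]
  simp [Algebra.algebraMap_eq_smul_one]

/-- The matrix of the functionals `y ↦ tr (q(ad X) ad y)`. -/
def traceFunctionals (e : Module.Basis (Fin N) ℂ 𝔤) {r : ℕ} (q : Fin r → Polynomial ℂ)
    (X : Ext K 𝔤) : Matrix (Fin r) (Fin N) K :=
  Matrix.of fun a i => (Polynomial.aeval (adMat e X) (q a) * adMat e ((1 : K) ⊗ₜ[ℂ] e i)).trace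

theorem adMat_sum (e : Module.Basis (Fin N) ℂ 𝔤) {ι : Type*} (s : Finset ι) (f : ι → Ext K 𝔤) :
    adMat e (∑ i ∈ s, f i) = ∑ i ∈ s, adMat e (f i) := by simp [adMat]

/-- `q(ad X)` commutes with `ad X`, so `tr (q(ad X) [ad X, ad e_j]) = 0`: the functionals vanish on
the image of `ad X`, and independent ones bound its rank. -/
theorem traceFunctionals_mul_adMat (e : Module.Basis (Fin N) ℂ 𝔤) {r : ℕ}
    (q : Fin r → Polynomial ℂ) (X : Ext K 𝔤) : traceFunctionals e q X * adMat e X = 0 := by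
  ext a j
  have h1 : ⁅X, (1 : K) ⊗ₜ[ℂ] e j⁆ = ∑ i, adMat e X i j • ((1 : K) ⊗ₜ[ℂ] e i) := by
    conv_lhs => rw [← (e.baseChange K).sum_repr ⁅X, (1 : K) ⊗ₜ[ℂ] e j⁆]
    refine Finset.sum_congr rfl fun i _ => ?_
    rw [adMat_apply, Module.Basis.baseChange_apply]
  have h2 : (traceFunctionals e q X * adMat e X) a j =
      (Polynomial.aeval (adMat e X) (q a) * adMat e ⁅X, (1 : K) ⊗ₜ[ℂ] e j⁆).trace := by
    rw [h1, adMat_sum, Finset.mul_sum, Matrix.trace_sum, Matrix.mul_apply]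
    refine Finset.sum_congr rfl fun i _ => ?_
    rw [adMat_smul, Matrix.mul_smul, Matrix.trace_smul, smul_eq_mul, mul_comm]
    rfl
  have h3 : Commute (Polynomial.aeval (adMat e X) (q a)) (adMat e X) :=
    by simpa using (Commute.all (q a) Polynomial.X).map (Polynomial.aeval (adMat e X))
  rw [h2, adMat_lie, mul_sub, Matrix.trace_sub, ← mul_assoc, h3.eq, mul_assoc,
    Matrix.trace_mul_comm, mul_assoc, sub_self]
  rfl

theorem traceFunctionals_rTensor (e : Module.Basis (Fin N) ℂ 𝔤) {r : ℕ}
    (q : Fin r → Polynomial ℂ) (φ : K →ₐ[ℂ] K') (X : Ext K 𝔤) :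
    traceFunctionals e q (LinearMap.rTensor 𝔤 φ.toLinearMap X) = (traceFunctionals e q X).map φ := by
  ext a i
  have h1 : adMat e ((1 : K') ⊗ₜ[ℂ] e i) = φ.mapMatrix (adMat e ((1 : K) ⊗ₜ[ℂ] e i)) := by
    rw [AlgHom.mapMatrix_apply, ← adMat_rTensor]
    simp
  have h2 : adMat e (LinearMap.rTensor 𝔤 φ.toLinearMap X) = φ.mapMatrix (adMat e X) := by
    rw [AlgHom.mapMatrix_apply, ← adMat_rTensor]
  rw [traceFunctionals, Matrix.of_apply, h1, h2, Polynomial.aeval_algHom_apply, ← map_mul,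
    AlgHom.mapMatrix_apply]
  simp only [Matrix.trace, Matrix.diag, Matrix.map_apply, traceFunctionals, Matrix.of_apply,
    map_sum]

/-- Certifies the rank by a nonzero determinant, a condition that can be carried along a family of
matrices. -/
theorem exists_mul_mul_eq_one {F : Type*} [Field F] {m n : ℕ} (M : Matrix (Fin m) (Fin n) F) :
    ∃ (A : Matrix (Fin M.rank) (Fin m) F) (B : Matrix (Fin n) (Fin M.rank) F), A * M * B = 1 := by
  have b : Module.Basis (Fin M.rank) F (LinearMap.range M.mulVecLin) := Module.finBasis F _
  choose u hu using fun i => (b i).2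
  have hli : LinearIndependent F (fun i => M.mulVecLin (u i)) := by
    have h : LinearIndependent F (fun i => (b i : Fin m → F)) :=
      b.linearIndependent.map' (LinearMap.range M.mulVecLin).subtype (by simp)
    simpa only [hu] using h
  obtain ⟨f, hf⟩ : ∃ f : (Fin m → F) →ₗ[F] (Fin M.rank → F),
      ∀ i, f (M.mulVecLin (u i)) = Pi.single i 1 := by
    obtain ⟨g, hg⟩ := LinearMap.exists_leftInverse_of_injective
      (Fintype.linearCombination F (fun i => M.mulVecLin (u i)))
      (LinearMap.ker_eq_bot.2 hli.fintypeLinearCombination_injective)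
    refine ⟨g, fun i => ?_⟩
    have := LinearMap.congr_fun hg (Pi.single i 1)
    simpa [Fintype.linearCombination_apply] using this
  refine ⟨LinearMap.toMatrix' f, (Matrix.of u).transpose, ?_⟩
  ext i j
  have h1 := congrFun (hf j) i
  rw [← LinearMap.toMatrix'_mulVec, Pi.single_apply, Matrix.mulVec, dotProduct] at h1
  rw [Matrix.mul_assoc, Matrix.mul_apply, Matrix.one_apply, ← h1]
  rfl

theorem le_rank_of_mul_det_ne_zero {F : Type*} [Field F] {r m n : ℕ} (A : Matrix (Fin r) (Fin m) F)
    (M : Matrix (Fin m) (Fin n) F) (B : Matrix (Fin n) (Fin r) F) (h : (A * M * B).det ≠ 0) :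
    r ≤ M.rank := by
  have h1 := Matrix.rank_of_isUnit (A * M * B)
    ((Matrix.isUnit_iff_isUnit_det _).2 (isUnit_iff_ne_zero.2 h))
  have h2 := Matrix.rank_mul_le_left (A * M) B
  have h3 := Matrix.rank_mul_le_right A M
  rw [Fintype.card_fin] at h1
  omega

/-- If the functionals `y ↦ tr (q(ad x) ad y)` are independent for some `x`, then they bound the
rank of `ad X` for all `X`. -/
theorem rank_adMat_le {F : Type*} [Field F] [Algebra ℂ F] (e : Module.Basis (Fin N) ℂ 𝔤) {r : ℕ}
    (q : Fin r → Polynomial ℂ) (x : Ext F 𝔤) (B : Matrix (Fin N) (Fin r) F)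
    (hB : traceFunctionals e q x * B = 1) (X : Ext F 𝔤) : r + (adMat e X).rank ≤ N := by
  let R := Polynomial F
  let ι : F →ₐ[ℂ] R := Algebra.algHom ℂ F R
  let ev (t : F) : R →ₐ[ℂ] F := (Polynomial.aeval t).restrictScalars ℂ
  have hev : ∀ t, (ev t).comp ι = AlgHom.id ℂ F := by
    intro t
    ext y
    exact (Polynomial.aeval_C t y).trans rfl
  have hevX : ∀ (t : F) (Y : Ext F 𝔤), LinearMap.rTensor 𝔤 (ev t).toLinearMap
      (LinearMap.rTensor 𝔤 ι.toLinearMap Y) = Y := by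
    intro t Y
    rw [← LinearMap.comp_apply, ← LinearMap.rTensor_comp]
    have : (ev t).toLinearMap ∘ₗ ι.toLinearMap = LinearMap.id := by
      rw [← AlgHom.comp_toLinearMap, hev]; rfl
    rw [this, LinearMap.rTensor_id, LinearMap.id_apply]
  -- The line from `x` at `t = 0` to `X` at `t = 1`, over `F[t]`. The two determinants below are
  -- polynomials in `t`, one nonzero at `0` and the other at `1`, so both are nonzero in `F(t)`.
  let Z : Ext R 𝔤 := LinearMap.rTensor 𝔤 ι.toLinearMap x +
    (Polynomial.X : R) • LinearMap.rTensor 𝔤 ι.toLinearMap (X - x)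
  have hZ : ∀ t : F, LinearMap.rTensor 𝔤 (ev t).toLinearMap Z = x + t • (X - x) := by
    intro t
    rw [map_add, rTensor_smul, hevX, hevX]
    simp [ev, R]
  have hevC : ∀ (t : F) {a b : ℕ} (M : Matrix (Fin a) (Fin b) F), (M.map ι).map (ev t) = M := by
    intro t a b M
    ext i j
    exact DFunLike.congr_fun (hev t) (M i j)
  have h0 : (traceFunctionals e q Z * B.map ι).det ≠ 0 := by
    intro h
    have h1 := congrArg (ev 0) h
    rw [map_zero, AlgHom.map_det, AlgHom.mapMatrix_apply, Matrix.map_mul, hevC,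
      ← traceFunctionals_rTensor, hZ, zero_smul, add_zero, hB, Matrix.det_one] at h1
    exact one_ne_zero h1
  obtain ⟨A', B', hAB⟩ := exists_mul_mul_eq_one (adMat e X)
  have h1 : (A'.map ι * adMat e Z * B'.map ι).det ≠ 0 := by
    intro h
    have h1 := congrArg (ev 1) h
    rw [map_zero, AlgHom.map_det, AlgHom.mapMatrix_apply, Matrix.map_mul, Matrix.map_mul, hevC,
      hevC, ← adMat_rTensor, hZ, one_smul, add_sub_cancel, hAB, Matrix.det_one] at h1
    exact one_ne_zero h1
  let j := algebraMap R (FractionRing R)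
  have hj : Function.Injective j := IsFractionRing.injective R (FractionRing R)
  have h0' : ((1 : Matrix (Fin r) (Fin r) (FractionRing R)) * (traceFunctionals e q Z).map j *
      (B.map ι).map j).det ≠ 0 := by
    rw [Matrix.one_mul, ← Matrix.map_mul, ← RingHom.mapMatrix_apply, ← RingHom.map_det]
    exact fun h => h0 (hj (by rw [h, map_zero]))
  have h1' : ((A'.map ι).map j * (adMat e Z).map j * (B'.map ι).map j).det ≠ 0 := by
    rw [← Matrix.map_mul, ← Matrix.map_mul, ← RingHom.mapMatrix_apply, ← RingHom.map_det]
    exact fun h => h1 (hj (by rw [h, map_zero]))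
  have h2 := le_rank_of_mul_det_ne_zero _ _ _ h0'
  have h3 := le_rank_of_mul_det_ne_zero _ _ _ h1'
  -- Over `F(t)` the functionals have rank at least `r`, `ad Z` has rank at least that of `ad X`,
  -- and the product of the two matrices vanishes.
  have h4 : (traceFunctionals e q Z).map j * (adMat e Z).map j = 0 := by
    rw [← Matrix.map_mul, traceFunctionals_mul_adMat]
    ext; simp
  have h5 := Matrix.rank_add_rank_le_card_of_mul_eq_zero h4
  rw [Fintype.card_fin] at h5
  omega

/-- A centraliser of minimal dimension which meets the image trivially is abelian. -/
theorem lie_eq_zero_of_minimal {F : Type*} [Field F] [CharZero F] {L : Type*} [LieRing L]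
    [LieAlgebra F L] [FiniteDimensional F L] {n : ℕ}
    (hmin : ∀ X : L, n ≤ Module.finrank F (LinearMap.ker (LieAlgebra.ad F L X))) (x : L)
    (hx : Module.finrank F (LinearMap.ker (LieAlgebra.ad F L x)) ≤ n)
    (hd : ∀ y : L, ⁅x, ⁅x, y⁆⁆ = 0 → ⁅x, y⁆ = 0) (y z : L) (hy : ⁅x, y⁆ = 0) (hz : ⁅x, z⁆ = 0) :
    ⁅y, z⁆ = 0 := by
  let T := LieAlgebra.ad F L x
  have hcompl : IsCompl (LinearMap.ker T) (LinearMap.range T) := by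
    have hdis : Disjoint (LinearMap.ker T) (LinearMap.range T) := by
      rw [Submodule.disjoint_def]
      rintro _ h1 ⟨w, rfl⟩
      exact hd w h1
    refine ⟨hdis, ?_⟩
    rw [codisjoint_iff]
    refine Submodule.eq_top_of_disjoint _ _ ?_ hdis
    rw [add_comm, LinearMap.finrank_range_add_finrank_ker]
  let J := LinearMap.range T
  have hTJ : ∀ v ∈ J, T v ∈ J := fun v _ => ⟨v, rfl⟩
  have hyJ : ∀ v ∈ J, ⁅y, v⁆ ∈ J := by
    rintro _ ⟨w, rfl⟩
    refine ⟨⁅y, w⁆, ?_⟩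
    have h1 : ⁅y, ⁅x, w⁆⁆ = ⁅⁅y, x⁆, w⁆ + ⁅x, ⁅y, w⁆⁆ := leibniz_lie y x w
    rw [← lie_skew y x, hy, neg_zero, zero_lie, zero_add] at h1
    exact h1.symm
  let TJ : Module.End F J := T.restrict hTJ
  let YJ : Module.End F J := (LieAlgebra.ad F L y).restrict hyJ
  have hTinj : Function.Injective TJ := by
    rw [← LinearMap.ker_eq_bot, LinearMap.ker_eq_bot']
    rintro ⟨_, w, rfl⟩ h
    have h1 : ⁅x, ⁅x, w⁆⁆ = 0 := congrArg Subtype.val h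
    exact Subtype.ext (hd w h1)
  let E : J ≃ₗ[F] J := LinearEquiv.ofInjectiveEndo TJ hTinj
  -- An eigenvector of `S` for `μ` is a nonzero vector of the image `J` killed by `y - μ x`.
  -- Avoiding the finitely many eigenvalues makes `ad (y - μ x)` injective on `J`, which forces its
  -- kernel into that of `ad x`.
  let S : Module.End F J := E.symm.toLinearMap ∘ₗ YJ
  obtain ⟨μ, hμ⟩ : ∃ μ : F, μ ∉ {μ | S.HasEigenvalue μ} :=
    (Module.End.finite_hasEigenvalue S).infinite_compl.nonempty
  have hker : LinearMap.ker (LieAlgebra.ad F L (y - μ • x)) ≤ LinearMap.ker T := by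
    intro v hv
    obtain ⟨c, hc, j, hj, rfl⟩ : ∃ c ∈ LinearMap.ker T, ∃ j ∈ J, c + j = v := by
      have : v ∈ LinearMap.ker T ⊔ J := by rw [hcompl.sup_eq_top]; trivial
      simpa [Submodule.mem_sup] using this
    have hc' : ⁅x, c⁆ = 0 := hc
    have h1 : ⁅y, c⁆ + ⁅y - μ • x, j⁆ = 0 := by
      have h2 : ⁅y - μ • x, c + j⁆ = 0 := hv
      rw [lie_add, sub_lie y, smul_lie, hc', smul_zero, sub_zero] at h2
      exact h2
    have h3 : ⁅y, c⁆ ∈ LinearMap.ker T := by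
      change ⁅x, ⁅y, c⁆⁆ = 0
      rw [leibniz_lie, hy, hc', zero_lie, lie_zero, add_zero]
    have h4 : ⁅y - μ • x, j⁆ ∈ J := by
      rw [sub_lie, smul_lie]
      exact J.sub_mem (hyJ j hj) (J.smul_mem _ (hTJ j hj))
    have h5 : ⁅y - μ • x, j⁆ = 0 := by
      have h6 : ⁅y - μ • x, j⁆ = -⁅y, c⁆ := eq_neg_of_add_eq_zero_right h1
      exact Submodule.disjoint_def.1 hcompl.disjoint _ (h6 ▸ Submodule.neg_mem _ h3) h4
    have h6 : (⟨j, hj⟩ : J) = 0 := by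
      by_contra hne
      apply hμ
      refine Module.End.hasEigenvalue_of_hasEigenvector (x := ⟨j, hj⟩)
        ⟨Module.End.mem_eigenspace_iff.2 ?_, hne⟩
      change E.symm (YJ ⟨j, hj⟩) = μ • ⟨j, hj⟩
      rw [LinearEquiv.symm_apply_eq, map_smul]
      apply Subtype.ext
      change ⁅y, j⁆ = μ • ⁅x, j⁆
      rwa [sub_lie, smul_lie, sub_eq_zero] at h5
    have h7 : j = 0 := congrArg Subtype.val h6
    rw [h7, add_zero]
    exact hc
  -- Minimality turns the inclusion of kernels into an equality, so `z` commutes with `y - μ x` as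
  -- well as with `x`, hence with `y`.
  have heq := Submodule.eq_of_le_of_finrank_le hker (hx.trans (hmin _))
  have h1 : z ∈ LinearMap.ker (LieAlgebra.ad F L (y - μ • x)) := heq ▸ hz
  have h2 : ⁅y - μ • x, z⁆ = 0 := h1
  rwa [sub_lie, smul_lie, hz, smul_zero, sub_zero] at h2

end Centraliser

/-! ### The rank as a lower bound for the dimension of centralisers -/

section GenericRank

variable {𝔤 : Type*} [LieRing 𝔤] [LieAlgebra ℂ 𝔤] [FiniteDimensional ℂ 𝔤]
  [LieAlgebra.IsSimple ℂ 𝔤] {H : LieSubalgebra ℂ 𝔤} [H.IsCartanSubalgebra] {n N : ℕ}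

open LieAlgebra.IsKilling LieModule

theorem aeval_ad_of_mem_rootSpace (q : Polynomial ℂ) (h : H) (χ : H → ℂ) (v : 𝔤)
    (hv : v ∈ LieAlgebra.rootSpace H χ) :
    Polynomial.aeval (LieAlgebra.ad ℂ 𝔤 (h : 𝔤)) q v = q.eval (χ h) • v := by
  have h1 : LieAlgebra.ad ℂ 𝔤 (h : 𝔤) v = χ h • v := lie_eq_smul_of_mem_rootSpace hv h
  by_cases hv0 : v = 0
  · simp [hv0]
  · exact Module.End.aeval_apply_of_hasEigenvector
      ⟨Module.End.mem_eigenspace_iff.2 h1, hv0⟩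

/-- The weight spaces are simultaneous eigenspaces of `ad H`, so both factors act on each of them by
scalars. -/
theorem trace_aeval_ad_mul_ad (q : Polynomial ℂ) (h y : H) :
    LinearMap.trace ℂ 𝔤 (Polynomial.aeval (LieAlgebra.ad ℂ 𝔤 (h : 𝔤)) q *
      LieAlgebra.ad ℂ 𝔤 (y : 𝔤)) =
    ∑ χ : Weight ℂ H 𝔤, Module.finrank ℂ (genWeightSpace 𝔤 (χ : H → ℂ)) •
      (q.eval (χ h) * χ y) := by
  have hact : ∀ (χ : Weight ℂ H 𝔤), ∀ v ∈ (genWeightSpace 𝔤 (χ : H → ℂ)),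
      (Polynomial.aeval (LieAlgebra.ad ℂ 𝔤 (h : 𝔤)) q * LieAlgebra.ad ℂ 𝔤 (y : 𝔤)) v =
        (q.eval (χ h) * χ y) • v := by
    intro χ v hv
    have h1 : LieAlgebra.ad ℂ 𝔤 (y : 𝔤) v = χ y • v := lie_eq_smul_of_mem_rootSpace hv y
    rw [Module.End.mul_apply, h1, map_smul, aeval_ad_of_mem_rootSpace q h χ v hv, smul_smul,
      mul_comm]
  have hmaps : ∀ χ : Weight ℂ H 𝔤, Set.MapsTo (Polynomial.aeval (LieAlgebra.ad ℂ 𝔤 (h : 𝔤)) q *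
      LieAlgebra.ad ℂ 𝔤 (y : 𝔤)) (genWeightSpace 𝔤 (χ : H → ℂ)).toSubmodule
      (genWeightSpace 𝔤 (χ : H → ℂ)).toSubmodule := by
    intro χ v hv
    rw [hact χ v hv]
    exact Submodule.smul_mem _ _ hv
  classical
  have hds := DirectSum.isInternal_submodule_of_iSupIndep_of_iSup_eq_top
    (LieSubmodule.iSupIndep_toSubmodule.mpr <| iSupIndep_genWeightSpace' ℂ H 𝔤)
    (LieSubmodule.iSup_toSubmodule_eq_top.mpr <| iSup_genWeightSpace_eq_top' ℂ H 𝔤)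
  rw [LinearMap.trace_eq_sum_trace_restrict hds hmaps]
  refine Finset.sum_congr rfl fun χ _ => ?_
  have h1 : (Polynomial.aeval (LieAlgebra.ad ℂ 𝔤 (h : 𝔤)) q *
      LieAlgebra.ad ℂ 𝔤 (y : 𝔤)).restrict (hmaps χ) = (q.eval (χ h) * χ y) • LinearMap.id := by
    ext v
    exact hact χ v v.2
  rw [h1, map_smul, LinearMap.trace_id, smul_eq_mul, nsmul_eq_mul, mul_comm]
  rfl

/-- Differences of distinct weights are finitely many nonzero linear forms, and finitely many
hyperplanes do not cover `H`. -/
theorem exists_separating : ∃ h : H, ∀ χ ψ : Weight ℂ H 𝔤, χ ≠ ψ → χ h ≠ ψ h := by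
  obtain ⟨h, hh⟩ := Module.Dual.exists_forall_ne_zero_of_forall_exists
    (K := ℂ) (M := H) (fun p : {p : Weight ℂ H 𝔤 × Weight ℂ H 𝔤 // p.1 ≠ p.2} =>
      Weight.toLinear ℂ H 𝔤 p.1.1 - Weight.toLinear ℂ H 𝔤 p.1.2) (by
      rintro ⟨⟨χ, ψ⟩, hne⟩
      by_contra! hcon
      apply hne
      ext x
      have := hcon x
      rwa [LinearMap.sub_apply, sub_eq_zero] at this)
  refine ⟨h, fun χ ψ hne heq => hh ⟨(χ, ψ), hne⟩ ?_⟩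
  rw [LinearMap.sub_apply, sub_eq_zero]
  exact heq

theorem exists_trace_dual (B : LieAlgebra.Basis (Fin n) H) :
    ∃ (h : H) (q : Fin n → Polynomial ℂ) (y : Fin n → H), ∀ a b,
      LinearMap.trace ℂ 𝔤 (Polynomial.aeval (LieAlgebra.ad ℂ 𝔤 (h : 𝔤)) (q a) *
        LieAlgebra.ad ℂ 𝔤 (y b : 𝔤)) = if a = b then 1 else 0 := by
  classical
  obtain ⟨h, hh⟩ := exists_separating (𝔤 := 𝔤) (H := H)
  let wt : Fin n → Weight ℂ H 𝔤 := fun a => (B.baseSupp' a).1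
  have hinj : Set.InjOn (fun χ : Weight ℂ H 𝔤 => χ h) (Finset.univ : Finset (Weight ℂ H 𝔤)) := by
    intro χ _ ψ _ heq
    by_contra hne
    exact hh χ ψ hne heq
  -- Interpolation at the distinct values `χ h` isolates one simple root: the trace becomes a
  -- multiple of that root at `y`.
  let q : Fin n → Polynomial ℂ := fun a => Lagrange.interpolate Finset.univ
    (fun χ : Weight ℂ H 𝔤 => χ h) (fun χ => if χ = wt a then 1 else 0)
  have hq : ∀ a (χ : Weight ℂ H 𝔤), (q a).eval (χ h) = if χ = wt a then 1 else 0 := fun a χ =>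
    Lagrange.eval_interpolate_at_node (fun χ => if χ = wt a then (1 : ℂ) else 0) hinj
      (Finset.mem_univ χ)
  have htr : ∀ a (y : H), LinearMap.trace ℂ 𝔤 (Polynomial.aeval (LieAlgebra.ad ℂ 𝔤 (h : 𝔤)) (q a) *
        LieAlgebra.ad ℂ 𝔤 (y : 𝔤)) =
      (Module.finrank ℂ (genWeightSpace 𝔤 (wt a : H → ℂ)) : ℂ) * B.baseSupp a y := by
    intro a y
    rw [trace_aeval_ad_mul_ad, Finset.sum_eq_single (wt a)]
    · rw [hq, if_pos rfl, one_mul, nsmul_eq_mul]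
      rfl
    · intro χ _ hne
      rw [hq, if_neg hne, zero_mul, smul_zero]
    · simp
  have hfin : ∀ a, (Module.finrank ℂ (genWeightSpace 𝔤 (wt a : H → ℂ)) : ℂ) ≠ 0 := by
    intro a
    have h1 : (genWeightSpace 𝔤 (wt a : H → ℂ)) ≠ ⊥ := (wt a).genWeightSpace_ne_bot
    rw [Ne, Nat.cast_eq_zero]
    exact fun h2 => h1 ((LieSubmodule.toSubmodule_eq_bot _).1 (Submodule.finrank_eq_zero.1 h2))
  let A : Matrix (Fin n) (Fin n) ℂ := B.A.map (Int.cast : ℤ → ℂ)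
  have hA : IsUnit A.det := by
    have h1 : A.det = (B.A.det : ℂ) := ((Int.castRingHom ℂ).map_det B.A).symm
    rw [h1, isUnit_iff_ne_zero]
    exact_mod_cast B.nondegen.det_ne_zero
  -- The simple roots take on the `B.h' j` the entries of the Cartan matrix, so its inverse yields
  -- dual vectors; the scalar in front cancels the dimension of the root space.
  refine ⟨h, q, fun b => (Module.finrank ℂ (genWeightSpace 𝔤 (wt b : H → ℂ)) : ℂ)⁻¹ •
    ∑ j, A⁻¹ j b • B.h' j, fun a b => ?_⟩
  rw [htr, map_smul, map_sum]
  have h2 : ∑ j, B.baseSupp a (A⁻¹ j b • B.h' j) = (A * A⁻¹) a b := by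
    rw [Matrix.mul_apply]
    refine Finset.sum_congr rfl fun j _ => ?_
    rw [map_smul, B.baseSupp_apply_h', smul_eq_mul, mul_comm]
    rfl
  rw [h2, Matrix.mul_nonsing_inv A hA, Matrix.one_apply, smul_eq_mul]
  split_ifs with hab
  · subst hab
    field_simp [hfin a]
  · simp

theorem exists_traceFunctionals_right_inverse (B : LieAlgebra.Basis (Fin n) H)
    (e : Module.Basis (Fin N) ℂ 𝔤) (F : Type*) [Field F] [Algebra ℂ F] :
    ∃ (h : 𝔤) (q : Fin n → Polynomial ℂ) (C : Matrix (Fin N) (Fin n) F),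
      traceFunctionals e q ((1 : F) ⊗ₜ[ℂ] h) * C = 1 := by
  obtain ⟨h, q, y, hy⟩ := exists_trace_dual B
  refine ⟨h, q, Matrix.of fun i b => algebraMap ℂ F (e.repr (y b : 𝔤) i), ?_⟩
  ext a b
  have h1 : ∀ x : 𝔤, (Polynomial.aeval (adMat e ((1 : F) ⊗ₜ[ℂ] (h : 𝔤))) (q a) *
      adMat e ((1 : F) ⊗ₜ[ℂ] x)).trace = algebraMap ℂ F (LinearMap.trace ℂ 𝔤
        (Polynomial.aeval (LieAlgebra.ad ℂ 𝔤 (h : 𝔤)) (q a) * LieAlgebra.ad ℂ 𝔤 x)) := by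
    intro x
    have h2 : ∀ z : 𝔤, adMat e ((1 : F) ⊗ₜ[ℂ] z) = (Algebra.ofId ℂ F).mapMatrix
        (LinearMap.toMatrixAlgEquiv e (LieAlgebra.ad ℂ 𝔤 z)) := fun z => adMat_one_tmul e z
    rw [h2, h2, Polynomial.aeval_algHom_apply, ← map_mul,
      show (LinearMap.toMatrixAlgEquiv e (LieAlgebra.ad ℂ 𝔤 (h : 𝔤))) =
        (LinearMap.toMatrixAlgEquiv e : Module.End ℂ 𝔤 →ₐ[ℂ] _) (LieAlgebra.ad ℂ 𝔤 (h : 𝔤)) from rfl,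
      Polynomial.aeval_algHom_apply, LinearMap.trace_eq_matrix_trace ℂ e]
    change _ = algebraMap ℂ F (LinearMap.toMatrixAlgEquiv e _).trace
    conv_rhs => rw [map_mul]
    simp only [Matrix.trace, Matrix.diag, map_sum]
    rfl
  rw [Matrix.mul_apply, Matrix.one_apply]
  have h3 : ∑ i, traceFunctionals e q ((1 : F) ⊗ₜ[ℂ] (h : 𝔤)) a i *
      (Matrix.of fun i b => algebraMap ℂ F (e.repr (y b : 𝔤) i)) i b =
      algebraMap ℂ F (LinearMap.trace ℂ 𝔤
        (Polynomial.aeval (LieAlgebra.ad ℂ 𝔤 (h : 𝔤)) (q a) * LieAlgebra.ad ℂ 𝔤 (y b : 𝔤))) := by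
    conv_rhs => rw [← e.sum_repr (y b : 𝔤)]
    simp only [map_sum, map_smul, Finset.mul_sum, mul_smul_comm, smul_eq_mul, map_mul]
    refine Finset.sum_congr rfl fun i _ => ?_
    rw [traceFunctionals, Matrix.of_apply, Matrix.of_apply, h1, mul_comm]
  rw [h3, hy]
  split_ifs <;> simp

theorem le_finrank_ker_ad (B : LieAlgebra.Basis (Fin n) H) (F : Type*) [Field F] [Algebra ℂ F]
    (X : Ext F 𝔤) : n ≤ Module.finrank F (LinearMap.ker (LieAlgebra.ad F (Ext F 𝔤) X)) := by
  have e := Module.finBasis ℂ 𝔤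
  obtain ⟨h, q, C, hC⟩ := exists_traceFunctionals_right_inverse B e F
  have h1 := rank_adMat_le e q _ C hC X
  have h2 : (adMat e X).rank = Module.finrank F
      (LinearMap.range (LieAlgebra.ad F (Ext F 𝔤) X)) := by
    have h5 : Matrix.toLin (e.baseChange F) (e.baseChange F) (adMat e X) =
        LieAlgebra.ad F (Ext F 𝔤) X := Matrix.toLin_toMatrix (e.baseChange F) (e.baseChange F) _
    rw [Matrix.rank_eq_finrank_range_toLin _ (e.baseChange F) (e.baseChange F), h5]
  have h3 := LinearMap.finrank_range_add_finrank_ker (LieAlgebra.ad F (Ext F 𝔤) X)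
  have h4 : Module.finrank F (Ext F 𝔤) = Module.finrank ℂ 𝔤 := by
    rw [Module.finrank_eq_card_basis (e.baseChange F), Fintype.card_fin]
  omega

end GenericRank

/-! ### Laurent series -/

section Laurent

variable {A : Type*} [CommRing A] [Algebra ℂ A] {B : Type*} [CommRing B] [Algebra ℂ B]

theorem laurent_ext {f g : LaurentSeries A} (h : ∀ r, f.coeff r = g.coeff r) : f = g :=
  HahnSeries.ext (funext h)

theorem algebraMap_laurent (c : ℂ) :
    algebraMap ℂ (LaurentSeries A) c = HahnSeries.C (algebraMap ℂ A c) := by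
  rw [HahnSeries.algebraMap_apply']
  simp [PowerSeries.algebraMap_apply]

theorem coeff_algebraMap (c : ℂ) (r : ℤ) :
    (algebraMap ℂ (LaurentSeries A) c).coeff r = if r = 0 then algebraMap ℂ A c else 0 := by
  rw [algebraMap_laurent, HahnSeries.C_apply, HahnSeries.coeff_single]
  split_ifs <;> rfl

theorem coeff_algebraMap_mul (c : ℂ) (f : LaurentSeries A) (r : ℤ) :
    (algebraMap ℂ (LaurentSeries A) c * f).coeff r = c • f.coeff r := by
  rw [algebraMap_laurent, HahnSeries.C_apply, HahnSeries.coeff_single_zero_mul, Algebra.smul_def]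

/-- A derivation over `ℂ` from its Leibniz rule. -/
def derivationOfLeibniz {K : Type*} [CommRing K] [Algebra ℂ K] (δ : K → K)
    (add : ∀ f g, δ (f + g) = δ f + δ g)
    (smul : ∀ c f, δ (algebraMap ℂ K c * f) = algebraMap ℂ K c * δ f)
    (leibniz : ∀ f g, δ (f * g) = f * δ g + g * δ f) : Derivation ℂ K K :=
  Derivation.mk'
    { toFun := δ
      map_add' := add
      map_smul' := fun c f => by rw [Algebra.smul_def, smul, RingHom.id_apply, Algebra.smul_def] }
    leibniz

/-- Apply an algebra homomorphism to the coefficients of a Laurent series. -/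
def laurentMap (φ : A →ₐ[ℂ] B) : LaurentSeries A →ₐ[ℂ] LaurentSeries B where
  toFun f := HahnSeries.map f φ
  map_one' := by ext r; simp [HahnSeries.coeff_one, apply_ite φ]
  map_mul' f g := HahnSeries.map_mul (φ : A →ₙ+* B)
  map_zero' := by ext; simp
  map_add' f g := by ext; simp
  commutes' c := by
    ext r
    simp [coeff_algebraMap, apply_ite φ]

theorem coeff_laurentMap (φ : A →ₐ[ℂ] B) (f : LaurentSeries A) (r : ℤ) :
    (laurentMap φ f).coeff r = φ (f.coeff r) := rfl

/-- The derivation `∑ f_r z^r ↦ ∑ (δ f_r + c r f_r) z^r`. -/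
def laurentDeriv (δ : Derivation ℂ A A) (c : ℂ) :=
  derivationOfLeibniz (K := LaurentSeries A)
    (fun f =>
        { coeff := fun r => δ (f.coeff r) + (c * r) • f.coeff r
          isPWO_support' := f.isPWO_support.mono fun r hr => by
            rw [HahnSeries.mem_support]
            intro h
            apply hr
            change δ (f.coeff r) + (c * r) • f.coeff r = 0
            rw [h]
            simp })
    (fun f g => by ext r; simp [smul_add]; abel)
    (fun t f => by
      ext r
      rw [coeff_algebraMap_mul]
      change δ ((algebraMap ℂ (LaurentSeries A) t * f).coeff r) +
        (c * r) • (algebraMap ℂ (LaurentSeries A) t * f).coeff r = _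
      rw [coeff_algebraMap_mul, Derivation.map_smul, smul_comm _ t, ← smul_add])
    (fun f g => by
      ext r
      change δ ((f * g).coeff r) + (c * r) • (f * g).coeff r = (f * _ + g * _ : LaurentSeries A).coeff r
      rw [mul_comm g, HahnSeries.coeff_add, HahnSeries.coeff_mul,
        HahnSeries.coeff_mul_right' g.isPWO_support, HahnSeries.coeff_mul_left' f.isPWO_support,
        map_sum, Finset.smul_sum, ← Finset.sum_add_distrib, ← Finset.sum_add_distrib]
      · refine Finset.sum_congr rfl fun ij hij => ?_
        have h : ij.1 + ij.2 = r := (Finset.mem_antidiagonal.1 hij).2.2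
        subst h
        change _ = f.coeff ij.1 * (δ (g.coeff ij.2) + (c * ij.2) • g.coeff ij.2) +
          (δ (f.coeff ij.1) + (c * ij.1) • f.coeff ij.1) * g.coeff ij.2
        rw [Derivation.leibniz, smul_eq_mul, smul_eq_mul]
        simp only [Algebra.smul_def, map_mul, map_intCast, Int.cast_add, map_add]
        ring
      · intro r hr h
        apply hr
        change δ (f.coeff r) + (c * r) • f.coeff r = 0
        rw [h]
        simp
      · intro r hr h
        apply hr
        change δ (g.coeff r) + (c * r) • g.coeff r = 0
        rw [h]
        simp)

theorem coeff_laurentDeriv (δ : Derivation ℂ A A) (c : ℂ) (f : LaurentSeries A) (r : ℤ) :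
    (laurentDeriv δ c f).coeff r = δ (f.coeff r) + (c * r) • f.coeff r := rfl

open Classical in
/-- Keep only the powers `z^r` with `p r`. -/
def cut (p : ℤ → Prop) (f : LaurentSeries A) : LaurentSeries A where
  coeff r := if p r then f.coeff r else 0
  isPWO_support' := f.isPWO_support.mono fun r hr => by
    rw [HahnSeries.mem_support]
    intro h
    apply hr
    simp [h]

open Classical in
theorem coeff_cut (p : ℤ → Prop) (f : LaurentSeries A) (r : ℤ) :
    (cut p f).coeff r = if p r then f.coeff r else 0 := rfl

theorem exists_coeff_eq_zero (f : LaurentSeries A) : ∃ r₀ : ℤ, ∀ r < r₀, f.coeff r = 0 := by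
  by_cases hf : f = 0
  · exact ⟨0, fun r _ => by simp [hf]⟩
  · exact ⟨f.order, fun r hr => HahnSeries.coeff_eq_zero_of_lt_order hr⟩

theorem exists_of_coeff_mul_ne_zero {f g : LaurentSeries A} {r : ℤ} (h : (f * g).coeff r ≠ 0) :
    ∃ p q, p + q = r ∧ f.coeff p ≠ 0 ∧ g.coeff q ≠ 0 := by
  rw [HahnSeries.coeff_mul] at h
  obtain ⟨ij, hij, -⟩ := Finset.exists_ne_zero_of_sum_ne_zero h
  obtain ⟨h1, h2, h3⟩ := Finset.mem_antidiagonal.1 hij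
  exact ⟨ij.1, ij.2, h3, h1, h2⟩

/-- Only powers `λ^k` with `T (h k)` occur in the series. -/
def CoeffIn (h : ℤ) (T : ℤ → Prop) (f : LaurentSeries A) : Prop :=
  ∀ r, f.coeff r ≠ 0 → T (-(h * r))

variable {h : ℤ} {S T U : ℤ → Prop}

theorem CoeffIn.mono {f : LaurentSeries A} (hf : CoeffIn h S f) (hST : ∀ k, S k → T k) :
    CoeffIn h T f := fun r hr => hST _ (hf r hr)

theorem CoeffIn.zero : CoeffIn h S (0 : LaurentSeries A) := fun _ hr => absurd rfl hr

theorem CoeffIn.add {f g : LaurentSeries A} (hf : CoeffIn h S f) (hg : CoeffIn h S g) :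
    CoeffIn h S (f + g) := by
  intro r hr
  by_cases h1 : f.coeff r = 0
  · exact hg r (by simpa [h1] using hr)
  · exact hf r h1

theorem CoeffIn.neg {f : LaurentSeries A} (hf : CoeffIn h S f) : CoeffIn h S (-f) :=
  fun r hr => hf r (by simpa using hr)

theorem CoeffIn.sum {ι : Type*} (s : Finset ι) {f : ι → LaurentSeries A}
    (hf : ∀ i ∈ s, CoeffIn h S (f i)) : CoeffIn h S (∑ i ∈ s, f i) := by
  classical
  induction s using Finset.induction_on with
  | empty => simpa using CoeffIn.zero
  | insert a s ha ih =>
    rw [Finset.sum_insert ha]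
    exact (hf a (Finset.mem_insert_self _ _)).add
      (ih fun i hi => hf i (Finset.mem_insert_of_mem hi))

theorem CoeffIn.mul {f g : LaurentSeries A} (hf : CoeffIn h S f) (hg : CoeffIn h T g)
    (hU : ∀ a b, S a → T b → U (a + b)) : CoeffIn h U (f * g) := by
  intro r hr
  obtain ⟨p, q, rfl, hp, hq⟩ := exists_of_coeff_mul_ne_zero hr
  have := hU _ _ (hf p hp) (hg q hq)
  rwa [← neg_add, ← mul_add] at this

theorem CoeffIn.of_algebraMap (hS : S 0) (c : ℂ) :
    CoeffIn h S (algebraMap ℂ (LaurentSeries A) c) := by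
  intro r hr
  rw [coeff_algebraMap] at hr
  by_cases h0 : r = 0
  · simpa [h0] using hS
  · exact absurd (if_neg h0) hr

theorem CoeffIn.mul_algebraMap {f : LaurentSeries A} (hf : CoeffIn h S f) (c : ℂ) :
    CoeffIn h S (f * algebraMap ℂ (LaurentSeries A) c) :=
  hf.mul (T := fun k => k = 0) (CoeffIn.of_algebraMap (S := fun k => k = 0) rfl c) (by rintro a b ha rfl; simpa using ha)

theorem CoeffIn.map {f : LaurentSeries A} (hf : CoeffIn h S f) (φ : A →ₐ[ℂ] B) :
    CoeffIn h S (laurentMap φ f) := by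
  intro r hr
  apply hf r
  intro h0
  apply hr
  rw [coeff_laurentMap, h0, map_zero]

end Laurent

/-! ### Degrees in the loop algebra -/

section Expand

variable {𝔤 : Type*} [LieRing 𝔤] [LieAlgebra ℂ 𝔤] {N : ℕ}
  {K : Type*} [CommRing K] [Algebra ℂ K]

theorem sum_repr_tmul (e : Module.Basis (Fin N) ℂ 𝔤) (X : Ext K 𝔤) :
    ∑ i, (e.baseChange K).repr X i • ((1 : K) ⊗ₜ[ℂ] e i) = X := by
  conv_rhs => rw [← (e.baseChange K).sum_repr X]
  simp only [Module.Basis.baseChange_apply]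

theorem repr_lie (e : Module.Basis (Fin N) ℂ 𝔤) (X Y : Ext K 𝔤) (s : Fin N) :
    (e.baseChange K).repr ⁅X, Y⁆ s = ∑ i, ∑ j, (e.baseChange K).repr X i *
      (e.baseChange K).repr Y j * algebraMap ℂ K (e.repr ⁅e i, e j⁆ s) := by
  conv_lhs => rw [← sum_repr_tmul e X, ← sum_repr_tmul e Y]
  rw [sum_lie, map_sum, Finsupp.coe_finsetSum, Finset.sum_apply]
  refine Finset.sum_congr rfl fun i _ => ?_
  rw [lie_sum, map_sum, Finsupp.coe_finsetSum, Finset.sum_apply]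
  refine Finset.sum_congr rfl fun j _ => ?_
  simp only [smul_lie, lie_smul, map_smul, Finsupp.smul_apply, smul_eq_mul,
    LieAlgebra.ExtendScalars.bracket_tmul, Module.Basis.baseChange_repr_tmul,
    Algebra.algebraMap_eq_smul_one, mul_one]
  ring

theorem kap_expand [FiniteDimensional ℂ 𝔤] (e : Module.Basis (Fin N) ℂ 𝔤) (X Y : Ext K 𝔤) :
    kap K X Y = ∑ i, ∑ j, (e.baseChange K).repr X i *
      (e.baseChange K).repr Y j * algebraMap ℂ K (killingForm ℂ 𝔤 (e i) (e j)) := by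
  conv_lhs => rw [← sum_repr_tmul e X, ← sum_repr_tmul e Y]
  rw [kap_sum_left]
  refine Finset.sum_congr rfl fun i _ => ?_
  rw [kap_sum_right]
  refine Finset.sum_congr rfl fun j _ => ?_
  simp only [kap_smul_left, kap_smul_right, kap_tmul, one_mul]
  ring

end Expand

/-- The `ℂ`-module structure underlying the `ℂ`-algebra structure on Laurent series. -/
instance (priority := 2000) laurentModule (A : Type*) [CommRing A] [Algebra ℂ A] :
    Module ℂ (LaurentSeries A) := Algebra.toModule

section Loops

variable {𝔤 : Type*} [LieRing 𝔤] [LieAlgebra ℂ 𝔤] [FiniteDimensional ℂ 𝔤]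
  [LieAlgebra.IsSimple ℂ 𝔤] {H : LieSubalgebra ℂ 𝔤} [H.IsCartanSubalgebra] {n N : ℕ}
  {A : Type*} [CommRing A] [Algebra ℂ A] {B : Type*} [CommRing B] [Algebra ℂ B]

/-- Apply an algebra homomorphism to the coefficients of an element of the loop algebra. -/
def loopMap (φ : A →ₐ[ℂ] B) : Loop A 𝔤 →ₗ[ℂ] Loop B 𝔤 :=
  LinearMap.rTensor 𝔤 (laurentMap φ).toLinearMap

theorem loopMap_tmul (φ : A →ₐ[ℂ] B) (f : LaurentSeries A) (x : 𝔤) :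
    loopMap φ (f ⊗ₜ[ℂ] x : Loop A 𝔤) = laurentMap φ f ⊗ₜ x := rfl

theorem loopMap_lie (φ : A →ₐ[ℂ] B) (X Y : Loop A 𝔤) :
    loopMap φ ⁅X, Y⁆ = ⁅loopMap φ X, loopMap φ Y⁆ := rTensor_lie _ X Y

theorem loopMap_smul (φ : A →ₐ[ℂ] B) (f : LaurentSeries A) (X : Loop A 𝔤) :
    loopMap φ (f • X) = laurentMap φ f • loopMap φ X := rTensor_smul _ f X

theorem repr_loopMap (e : Module.Basis (Fin N) ℂ 𝔤) (φ : A →ₐ[ℂ] B) (X : Loop A 𝔤) (j : Fin N) :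
    (e.baseChange (LaurentSeries B)).repr (loopMap φ X) j =
      laurentMap φ ((e.baseChange (LaurentSeries A)).repr X j) := repr_rTensor e _ X j

theorem mapLoop_eq_loopMap (e : Module.Basis (Fin N) ℂ 𝔤) (φ : A →ₐ[ℂ] B) (X : Loop A 𝔤) :
    mapLoop e (φ : A →+* B) X = loopMap φ X :=
  mapCoord_eq_rTensor e (laurentMap φ).toLinearMap X

theorem laurentMap_single (φ : A →ₐ[ℂ] B) (r : ℤ) (a : A) :
    laurentMap φ (HahnSeries.single r a) = HahnSeries.single r (φ a) := by
  apply laurent_ext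
  intro s
  rw [coeff_laurentMap, HahnSeries.coeff_single, HahnSeries.coeff_single, apply_ite φ, map_zero]

theorem laurentMap_spec (φ : A →ₐ[ℂ] B) : laurentMap φ (spec A) = spec B := by
  rw [spec, laurentMap_single, map_one, spec]

theorem CoeffIn.single {h : ℤ} {S : ℤ → Prop} {r : ℤ} (hr : S (-(h * r))) (a : A) :
    CoeffIn h S (HahnSeries.single r a) := by
  intro s hs
  rw [HahnSeries.coeff_single] at hs
  by_cases h0 : s = r
  · rwa [h0]
  · exact absurd (if_neg h0) hs

theorem CoeffIn.one {h : ℤ} {S : ℤ → Prop} (hS : S 0) :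
    CoeffIn h S (1 : LaurentSeries A) := by
  have := CoeffIn.of_algebraMap (A := A) (h := h) hS 1
  rwa [map_one] at this

namespace Data

variable (D : Data H n N)

/-- All components of `X` have a principal degree satisfying `S`. -/
def Deg (S : ℤ → Prop) (X : Loop A 𝔤) : Prop := DegIn D.e D.d D.cox S X

theorem deg_iff {S : ℤ → Prop} {X : Loop A 𝔤} : D.Deg S X ↔ ∀ j, CoeffIn D.cox
    (fun k => S (D.d j + k)) ((D.e.baseChange (LaurentSeries A)).repr X j) := by
  simp only [Deg, DegIn, CoeffIn, sub_eq_add_neg, loopCoeff]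

variable {D} {S T U : ℤ → Prop}

theorem Deg.mono {X : Loop A 𝔤} (hX : D.Deg S X) (hST : ∀ k, S k → T k) : D.Deg T X :=
  fun j r h => hST _ (hX j r h)

theorem Deg.zero : D.Deg S (0 : Loop A 𝔤) := by
  intro j r h
  exact absurd (by simp [loopCoeff]) h

theorem Deg.add {X Y : Loop A 𝔤} (hX : D.Deg S X) (hY : D.Deg S Y) : D.Deg S (X + Y) := by
  rw [deg_iff] at *
  intro j
  rw [map_add, Finsupp.add_apply]
  exact (hX j).add (hY j)

theorem Deg.neg {X : Loop A 𝔤} (hX : D.Deg S X) : D.Deg S (-X) := by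
  rw [deg_iff] at *
  intro j
  rw [map_neg, Finsupp.neg_apply]
  exact (hX j).neg

theorem Deg.sub {X Y : Loop A 𝔤} (hX : D.Deg S X) (hY : D.Deg S Y) : D.Deg S (X - Y) := by
  rw [sub_eq_add_neg]
  exact hX.add hY.neg

theorem Deg.sum {ι : Type*} (s : Finset ι) {X : ι → Loop A 𝔤} (hX : ∀ i ∈ s, D.Deg S (X i)) :
    D.Deg S (∑ i ∈ s, X i) := by
  classical
  induction s using Finset.induction_on with
  | empty => simpa using Deg.zero
  | insert a s ha ih =>
    rw [Finset.sum_insert ha]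
    exact (hX a (Finset.mem_insert_self _ _)).add
      (ih fun i hi => hX i (Finset.mem_insert_of_mem hi))

theorem Deg.smul {f : LaurentSeries A} {X : Loop A 𝔤} (hf : CoeffIn D.cox S f) (hX : D.Deg T X)
    (hU : ∀ a b, S a → T b → U (a + b)) : D.Deg U (f • X) := by
  rw [deg_iff] at *
  intro j
  rw [map_smul, Finsupp.smul_apply, smul_eq_mul]
  refine hf.mul (hX j) fun a b ha hb => ?_
  have := hU _ _ ha hb
  rwa [add_left_comm] at this

theorem Deg.lie {X Y : Loop A 𝔤} (hX : D.Deg S X) (hY : D.Deg T Y)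
    (hU : ∀ a b, S a → T b → U (a + b)) : D.Deg U ⁅X, Y⁆ := by
  rw [deg_iff] at *
  intro s
  rw [repr_lie]
  refine CoeffIn.sum _ fun i _ => CoeffIn.sum _ fun j _ => ?_
  by_cases h0 : D.e.repr ⁅D.e i, D.e j⁆ s = 0
  · rw [h0, map_zero, mul_zero]
    exact CoeffIn.zero
  · refine CoeffIn.mul_algebraMap ((hX i).mul (hY j) fun a b ha hb => ?_) _
    have := hU _ _ ha hb
    rw [D.d_bracket h0]
    rwa [add_add_add_comm]

theorem Deg.coeffIn_kap {X Y : Loop A 𝔤} (hX : D.Deg S X) (hY : D.Deg T Y)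
    (hU : ∀ a b, S a → T b → U (a + b)) : CoeffIn D.cox U (kap (LaurentSeries A) X Y) := by
  rw [deg_iff] at *
  rw [kap_expand D.e]
  refine CoeffIn.sum _ fun i _ => CoeffIn.sum _ fun j _ => ?_
  by_cases h0 : killingForm ℂ 𝔤 (D.e i) (D.e j) = 0
  · rw [h0, map_zero, mul_zero]
    exact CoeffIn.zero
  · refine CoeffIn.mul_algebraMap ((hX i).mul (hY j) fun a b ha hb => ?_) _
    have := hU _ _ ha hb
    rwa [add_add_add_comm, D.d_killingForm h0, zero_add] at this

theorem Deg.tmul {f : LaurentSeries A} (hf : CoeffIn D.cox S f) {x : 𝔤} {k : ℤ}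
    (hx : ⁅(rho D.gen : 𝔤), x⁆ = (k : ℂ) • x) (hU : ∀ a, S a → U (k + a)) :
    D.Deg U (f ⊗ₜ[ℂ] x : Loop A 𝔤) := by
  rw [deg_iff]
  intro j
  rw [Module.Basis.baseChange_repr_tmul, Algebra.smul_def, mul_comm]
  by_cases h0 : D.e.repr x j = 0
  · rw [h0, map_zero, mul_zero]
    exact CoeffIn.zero
  · refine CoeffIn.mul_algebraMap (hf.mono fun a ha => ?_) _
    rw [D.d_eq_of_repr_ne_zero hx h0]
    exact hU a ha

theorem Deg.eq_zero {X : Loop A 𝔤} (hX : D.Deg S X) (hX' : D.Deg (fun k => ¬ S k) X) : X = 0 := by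
  apply (D.e.baseChange (LaurentSeries A)).repr.injective
  ext j r
  by_contra h
  exact hX' j r (by simpa [loopCoeff] using h) (hX j r (by simpa [loopCoeff] using h))

theorem Deg.map {X : Loop A 𝔤} (hX : D.Deg S X) (φ : A →ₐ[ℂ] B) : D.Deg S (loopMap φ X) := by
  rw [deg_iff] at *
  intro j
  rw [repr_loopMap]
  exact (hX j).map φ

variable (D)

/-- A Laurent series in `λ⁻¹` has bounded powers of `λ`; the sum of positive bounds for the single
coordinates is a common bound. -/
theorem exists_deg_le (X : Loop A 𝔤) : ∃ k : ℤ, D.Deg (fun l => l ≤ k) X := by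
  choose r hr using fun j => exists_coeff_eq_zero ((D.e.baseChange (LaurentSeries A)).repr X j)
  refine ⟨∑ j, (D.cox + D.cox * |r j|), fun j s hs => ?_⟩
  have h1 : r j ≤ s := by
    by_contra h
    exact hs (hr j s (by omega))
  have h2 : D.cox + D.cox * |r j| ≤ ∑ j, (D.cox + D.cox * |r j|) :=
    Finset.single_le_sum (f := fun j => D.cox + D.cox * |r j|)
      (fun j _ => by have := D.cox_pos; positivity) (Finset.mem_univ j)
  have h3 := D.d_lt j
  have h4 : D.cox * (-s) ≤ D.cox * |r j| :=
    mul_le_mul_of_nonneg_left (by have := neg_abs_le (r j); omega) D.cox_pos.le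
  linarith

theorem exists_deg_split (S : ℤ → Prop) (X : Loop A 𝔤) :
    ∃ Y, D.Deg S Y ∧ D.Deg (fun k => ¬ S k) (X - Y) := by
  classical
  let b := D.e.baseChange (LaurentSeries A)
  refine ⟨b.equivFun.symm fun j => cut (fun r => S (D.d j - D.cox * r)) (b.repr X j),
    fun j r h => ?_, fun j r h => ?_⟩
  · unfold loopCoeff at h
    rw [← Module.Basis.equivFun_apply, LinearEquiv.apply_symm_apply, coeff_cut] at h
    by_contra h'
    exact h (if_neg h')
  · unfold loopCoeff at h
    rw [map_sub, Finsupp.sub_apply, ← Module.Basis.equivFun_apply, ← Module.Basis.equivFun_apply,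
      LinearEquiv.apply_symm_apply, HahnSeries.coeff_sub, coeff_cut] at h
    intro h'
    apply h
    rw [if_pos h']
    exact sub_self _

/-! ### The normalised form -/

/-- The normalised form on `K ⊗ 𝔤`. -/
def pair (K : Type*) [CommRing K] [Algebra ℂ K] (X Y : Ext K 𝔤) : K := form D.gen D.θ K X Y

section Pair

variable {K : Type*} [CommRing K] [Algebra ℂ K] {K' : Type*} [CommRing K'] [Algebra ℂ K']

theorem pair_eq (X Y : Ext K 𝔤) : D.pair K X Y = algebraMap ℂ K D.nrm * kap K X Y := rfl

theorem kap_eq_pair (X Y : Ext K 𝔤) : kap K X Y = algebraMap ℂ K D.nrm⁻¹ * D.pair K X Y := by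
  rw [pair_eq, ← mul_assoc, ← map_mul, inv_mul_cancel₀ D.nrm_ne_zero, map_one, one_mul]

theorem pair_comm (X Y : Ext K 𝔤) : D.pair K X Y = D.pair K Y X := by
  rw [pair_eq, pair_eq, kap_comm]

theorem pair_lie (X Y Z : Ext K 𝔤) : D.pair K ⁅X, Y⁆ Z = D.pair K X ⁅Y, Z⁆ := by
  rw [pair_eq, pair_eq, kap_lie]

theorem pair_add_left (X Y Z : Ext K 𝔤) :
    D.pair K (X + Y) Z = D.pair K X Z + D.pair K Y Z := by
  simp only [pair_eq, kap_add_left, mul_add]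

theorem pair_add_right (X Y Z : Ext K 𝔤) :
    D.pair K X (Y + Z) = D.pair K X Y + D.pair K X Z := by
  simp only [pair_eq, kap_add_right, mul_add]

theorem pair_sub_left (X Y Z : Ext K 𝔤) :
    D.pair K (X - Y) Z = D.pair K X Z - D.pair K Y Z := by
  simp only [pair_eq, kap_sub_left, mul_sub]

theorem pair_smul_left (f : K) (X Y : Ext K 𝔤) : D.pair K (f • X) Y = f * D.pair K X Y := by
  simp only [pair_eq, kap_smul_left]; ring

theorem pair_smul_right (f : K) (X Y : Ext K 𝔤) : D.pair K X (f • Y) = f * D.pair K X Y := by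
  simp only [pair_eq, kap_smul_right]; ring

theorem pair_sum_left {ι : Type*} (s : Finset ι) (f : ι → Ext K 𝔤) (Y : Ext K 𝔤) :
    D.pair K (∑ i ∈ s, f i) Y = ∑ i ∈ s, D.pair K (f i) Y := by
  simp only [pair_eq, kap_sum_left, Finset.mul_sum]

theorem pair_sum_right {ι : Type*} (s : Finset ι) (f : ι → Ext K 𝔤) (Y : Ext K 𝔤) :
    D.pair K Y (∑ i ∈ s, f i) = ∑ i ∈ s, D.pair K Y (f i) := by
  simp only [pair_eq, kap_sum_right, Finset.mul_sum]

theorem pair_rTensor (φ : K →ₐ[ℂ] K') (X Y : Ext K 𝔤) :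
    D.pair K' (LinearMap.rTensor 𝔤 φ.toLinearMap X) (LinearMap.rTensor 𝔤 φ.toLinearMap Y) =
      φ (D.pair K X Y) := by
  rw [pair_eq, pair_eq, map_kap, map_mul, AlgHom.commutes]

theorem deriv_pair (δ : Derivation ℂ K K) (X Y : Ext K 𝔤) :
    δ (D.pair K X Y) = D.pair K (derivExt 𝔤 δ X) Y + D.pair K X (derivExt 𝔤 δ Y) := by
  rw [pair_eq, Derivation.leibniz, Derivation.map_algebraMap, smul_zero, add_zero, deriv_kap,
    smul_eq_mul, mul_add]
  rfl

end Pair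

theorem pair_loopMap (φ : A →ₐ[ℂ] B) (X Y : Loop A 𝔤) :
    D.pair (LaurentSeries B) (loopMap φ X) (loopMap φ Y) =
      laurentMap φ (D.pair (LaurentSeries A) X Y) := D.pair_rTensor _ X Y

theorem coeffIn_pair {D : Data H n N} {S T U : ℤ → Prop} {X Y : Loop A 𝔤} (hX : D.Deg S X)
    (hY : D.Deg T Y) (hU : ∀ a b, S a → T b → U (a + b)) :
    CoeffIn D.cox U (D.pair (LaurentSeries A) X Y) := by
  rw [pair_eq, mul_comm]
  exact (hX.coeffIn_kap hY hU).mul_algebraMap _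

/-! ### The centraliser of the cyclic element -/

variable (A)

/-- `Λ(λ)` with coefficients in `A`. -/
def cyc : Loop A 𝔤 := cyclicElement A D.gen D.Fθ

/-- `Λ_{m_a}(λ)` with coefficients in `A`. -/
def lamA (a : Fin n) : Loop A 𝔤 := loopMap (Algebra.ofId ℂ A) (D.Λ a)

variable {A}

theorem deg_cyc : D.Deg (fun k => k = 1) (D.cyc A) := by
  unfold cyc cyclicElement
  refine Deg.add ?_ ?_
  · refine Deg.tmul (S := fun k => k = 0) (k := 1) ?_ ?_ ?_
    · exact CoeffIn.one rfl
    · rw [lie_rho_principalNilpotent, Int.cast_one, one_smul]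
    · rintro a rfl; rfl
  · refine Deg.tmul (S := fun k => k = D.cox) (CoeffIn.single (by ring) _) D.lie_rho_Fθ ?_
    rintro a rfl
    ring

theorem loopMap_cyc (φ : A →ₐ[ℂ] B) : loopMap φ (D.cyc A) = D.cyc B := by
  unfold cyc cyclicElement Ext.tmul
  rw [map_add, loopMap_tmul, loopMap_tmul, map_one, laurentMap_spec]

theorem loopMap_ofId (φ : A →ₐ[ℂ] B) (X : Loop ℂ 𝔤) :
    loopMap φ (loopMap (Algebra.ofId ℂ A) X) = loopMap (Algebra.ofId ℂ B) X := by
  induction X using TensorProduct.induction_on with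
  | zero => simp
  | tmul f x =>
    simp only [loopMap_tmul]
    congr 1
    apply laurent_ext
    intro r
    simp [coeff_laurentMap, Algebra.ofId_apply]
  | add X Y hX hY => simp only [map_add, hX, hY]

theorem loopMap_lamA (φ : A →ₐ[ℂ] B) (a : Fin n) : loopMap φ (D.lamA A a) = D.lamA B a :=
  loopMap_ofId φ (D.Λ a)

theorem deg_Λ (a : Fin n) : D.Deg (fun k => k = (D.m a : ℤ)) (D.Λ a) := D.Λ_deg a

theorem deg_lamA (a : Fin n) : D.Deg (fun k => k = (D.m a : ℤ)) (D.lamA A a) := (D.deg_Λ a).map _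

theorem lie_cyc_Λ (a : Fin n) : ⁅D.cyc ℂ, D.Λ a⁆ = 0 := by
  have h : D.Λ a ∈ LinearMap.ker (LieAlgebra.ad (LaurentSeries ℂ) (Loop ℂ 𝔤)
      (cyclicElement ℂ D.gen D.Fθ)) := by
    rw [← D.Λ_span]
    exact Submodule.subset_span ⟨a, rfl⟩
  exact h

theorem lie_cyc_lamA (a : Fin n) : ⁅D.cyc A, D.lamA A a⁆ = 0 := by
  rw [lamA, ← D.loopMap_cyc (Algebra.ofId ℂ A), ← loopMap_lie, lie_cyc_Λ, map_zero]

theorem pair_Λ (a b : Fin n) : D.pair (LaurentSeries ℂ) (D.Λ a) (D.Λ b) =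
    algebraMap ℂ (LaurentSeries ℂ) ((D.cox : ℂ) * eta a b) * spec ℂ := D.Λ_form a b

theorem pair_lamA (a b : Fin n) : D.pair (LaurentSeries A) (D.lamA A a) (D.lamA A b) =
    algebraMap ℂ (LaurentSeries A) ((D.cox : ℂ) * eta a b) * spec A := by
  rw [lamA, lamA, pair_loopMap, pair_Λ, map_mul, laurentMap_spec, AlgHom.commutes]

theorem cox_ne_zero : (D.cox : ℂ) ≠ 0 := by
  exact_mod_cast D.cox_pos.ne'

theorem eta_rev (a b : Fin n) : eta a b.rev = if b = a then 1 else 0 := by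
  unfold eta
  simp only [Fin.rev_inj]

/-- The duality of exponents is read off from degrees: the pairing of `Λ_{m_a}` with its dual
partner is the nonzero `h λ`, of degree `h`. -/
theorem m_add_m_rev (a : Fin n) : (D.m a : ℤ) + D.m a.rev = D.cox := by
  have h := coeffIn_pair (U := fun k => k = (D.m a : ℤ) + D.m a.rev) (D.deg_Λ a) (D.deg_Λ a.rev)
    (by rintro a b rfl rfl; rfl)
  have h1 := h (-1) (by
    rw [pair_Λ, coeff_algebraMap_mul, spec, HahnSeries.coeff_single_same, eta, if_pos rfl]
    simpa using D.cox_ne_zero)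
  linarith

/-- `λ⁻¹` -/
def zvar (A : Type*) [CommRing A] : LaurentSeries A := HahnSeries.single (1 : ℤ) 1

theorem zvar_mul_spec : zvar A * spec A = 1 := by
  rw [zvar, spec, HahnSeries.single_mul_single]
  simp

theorem laurentMap_zvar (φ : A →ₐ[ℂ] B) : laurentMap φ (zvar A) = zvar B := by
  rw [zvar, laurentMap_single, map_one, zvar]

variable (A)

/-- The projection onto the centraliser of `Λ(λ)` along the image of `ad Λ(λ)`. -/
def proj : Loop A 𝔤 →ₗ[LaurentSeries A] Loop A 𝔤 where
  toFun X := ∑ a, (algebraMap ℂ (LaurentSeries A) (D.cox : ℂ)⁻¹ * zvar A *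
    D.pair (LaurentSeries A) X (D.lamA A a.rev)) • D.lamA A a
  map_add' X Y := by
    simp only [pair_add_left, mul_add, add_smul, Finset.sum_add_distrib]
  map_smul' f X := by
    simp only [pair_smul_left, RingHom.id_apply, Finset.smul_sum, smul_smul]
    refine Finset.sum_congr rfl fun a _ => ?_
    congr 1
    ring

variable {A}

theorem proj_apply (X : Loop A 𝔤) : D.proj A X = ∑ a, (algebraMap ℂ (LaurentSeries A)
    (D.cox : ℂ)⁻¹ * zvar A * D.pair (LaurentSeries A) X (D.lamA A a.rev)) • D.lamA A a := rfl

theorem lie_cyc_proj (X : Loop A 𝔤) : ⁅D.cyc A, D.proj A X⁆ = 0 := by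
  simp only [proj_apply, lie_sum, lie_smul, lie_cyc_lamA, smul_zero, Finset.sum_const_zero]

/-- By invariance the image of `ad Λ` is orthogonal to its kernel; this is why `proj` kills the
image. -/
theorem pair_lie_cyc (X Y : Loop A 𝔤) (hY : ⁅D.cyc A, Y⁆ = 0) :
    D.pair (LaurentSeries A) ⁅D.cyc A, X⁆ Y = 0 := by
  have h1 : D.pair (LaurentSeries A) X 0 = 0 := by
    have h := D.pair_smul_right (0 : LaurentSeries A) X 0
    rwa [zero_smul, zero_mul] at h
  have h2 : ⁅D.cyc A, X⁆ = (-1 : LaurentSeries A) • ⁅X, D.cyc A⁆ := by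
    rw [neg_smul, one_smul, lie_skew]
  rw [h2, pair_smul_left, pair_lie, hY, h1, mul_zero]

theorem proj_lie_cyc (X : Loop A 𝔤) : D.proj A ⁅D.cyc A, X⁆ = 0 := by
  simp only [proj_apply, D.pair_lie_cyc _ _ (D.lie_cyc_lamA _), mul_zero, zero_smul,
    Finset.sum_const_zero]

/-- Degrees balance: `λ⁻¹` contributes `-h`, the pairing contributes the dual exponent, and the
vector contributes `m_a`. -/
theorem Deg.proj {D : Data H n N} {S : ℤ → Prop} {X : Loop A 𝔤} (hX : D.Deg S X) :
    D.Deg S (D.proj A X) := by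
  rw [proj_apply]
  refine Deg.sum _ fun a _ => ?_
  refine Deg.smul (S := fun k => S (k + D.m a)) (T := fun k => k = (D.m a : ℤ)) ?_ (D.deg_lamA a)
    (by rintro x _ hx rfl; exact hx)
  rw [mul_assoc, mul_comm]
  refine CoeffIn.mul_algebraMap ?_ _
  refine CoeffIn.mul (S := fun k => k = -D.cox) (T := fun k => S (k - D.m a.rev))
    (CoeffIn.single (by ring) _) (coeffIn_pair hX (D.deg_lamA a.rev) ?_) ?_
  · rintro x _ hx rfl
    simpa using hx
  · rintro _ y rfl hy
    have : -D.cox + y + D.m a = y - D.m a.rev := by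
      rw [← D.m_add_m_rev a]; ring
    rwa [this]

theorem proj_Λ (a : Fin n) : D.proj A (D.lamA A a) = D.lamA A a := by
  rw [proj_apply, Finset.sum_eq_single a]
  · rw [pair_lamA, eta_rev, if_pos rfl, mul_one]
    have : algebraMap ℂ (LaurentSeries A) (D.cox : ℂ)⁻¹ * zvar A *
        (algebraMap ℂ (LaurentSeries A) (D.cox : ℂ) * spec A) = 1 := by
      rw [mul_mul_mul_comm, zvar_mul_spec, ← map_mul, inv_mul_cancel₀ D.cox_ne_zero, map_one,
        one_mul]
    rw [this, one_smul]
  · intro b _ hb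
    rw [pair_lamA, eta_rev, if_neg hb, mul_zero, map_zero, zero_mul, mul_zero, zero_smul]
  · exact fun h => absurd (Finset.mem_univ _) h

theorem loopMap_proj (φ : A →ₐ[ℂ] B) (X : Loop A 𝔤) :
    loopMap φ (D.proj A X) = D.proj B (loopMap φ X) := by
  simp only [proj_apply, map_sum, loopMap_smul, map_mul, AlgHom.commutes, laurentMap_zvar,
    ← pair_loopMap, loopMap_lamA]

/-! #### Over the field of complex Laurent series -/

theorem lamA_complex (a : Fin n) : D.lamA ℂ a = D.Λ a := by
  have h : (laurentMap (Algebra.ofId ℂ ℂ)).toLinearMap = LinearMap.id := by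
    exact LinearMap.ext fun f => laurent_ext fun r => rfl
  rw [lamA, loopMap, h, LinearMap.rTensor_id, LinearMap.id_apply]

theorem proj_eq_self_complex (X : Loop ℂ 𝔤) (hX : ⁅D.cyc ℂ, X⁆ = 0) : D.proj ℂ X = X := by
  have h : X ∈ Submodule.span (LaurentSeries ℂ) (Set.range D.Λ) := by
    rw [D.Λ_span]
    exact hX
  obtain ⟨c, rfl⟩ := (Submodule.mem_span_range_iff_exists_fun _).1 h
  rw [map_sum]
  refine Finset.sum_congr rfl fun a _ => ?_
  rw [map_smul, ← lamA_complex, proj_Λ]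

/-- An element of the image lying in the kernel equals its projection, but `proj` kills the image.
-/
theorem lie_cyc_eq_zero_complex (X : Loop ℂ 𝔤) (hX : ⁅D.cyc ℂ, ⁅D.cyc ℂ, X⁆⁆ = 0) :
    ⁅D.cyc ℂ, X⁆ = 0 := by
  rw [← D.proj_eq_self_complex _ hX, proj_lie_cyc]

theorem finrank_ker_complex : Module.finrank (LaurentSeries ℂ)
    (LinearMap.ker (LieAlgebra.ad (LaurentSeries ℂ) (Loop ℂ 𝔤) (D.cyc ℂ))) = n := by
  have h := finrank_span_eq_card D.Λ_linearIndependent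
  rw [D.Λ_span, Fintype.card_fin] at h
  exact h

/-- The kernel of `ad Λ` has dimension `n`, the minimum over all elements, and meets the image
trivially. -/
theorem lie_Λ_Λ (a b : Fin n) : ⁅D.Λ a, D.Λ b⁆ = 0 :=
  haveI : CharZero (LaurentSeries ℂ) := charZero_of_injective_algebraMap (R := ℂ) fun a b h => by
    have h1 := congrArg (fun f => HahnSeries.coeff f 0) h
    simpa [coeff_algebraMap] using h1
  lie_eq_zero_of_minimal (le_finrank_ker_ad D.gen (LaurentSeries ℂ)) (D.cyc ℂ)
    D.finrank_ker_complex.le D.lie_cyc_eq_zero_complex _ _ (D.lie_cyc_Λ a) (D.lie_cyc_Λ b)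

/-- Kernel and image are complementary by dimension. Dropping the kernel component of a preimage
exhibits the image part of `X` as a double bracket. -/
theorem exists_lie_lie_complex (X : Loop ℂ 𝔤) :
    ∃ Y, X - D.proj ℂ X = ⁅D.cyc ℂ, ⁅D.cyc ℂ, Y⁆⁆ := by
  let T := LieAlgebra.ad (LaurentSeries ℂ) (Loop ℂ 𝔤) (D.cyc ℂ)
  have hdis : Disjoint (LinearMap.ker T) (LinearMap.range T) := by
    rw [Submodule.disjoint_def]
    rintro _ h1 ⟨w, rfl⟩
    exact D.lie_cyc_eq_zero_complex w h1
  have htop : LinearMap.ker T ⊔ LinearMap.range T = ⊤ := by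
    refine Submodule.eq_top_of_disjoint _ _ ?_ hdis
    rw [add_comm, LinearMap.finrank_range_add_finrank_ker]
  have key : ∀ X : Loop ℂ 𝔤, ∃ Y, X = D.proj ℂ X + ⁅D.cyc ℂ, Y⁆ := by
    intro X
    have hX : X ∈ LinearMap.ker T ⊔ LinearMap.range T := htop ▸ Submodule.mem_top
    obtain ⟨c, hc, _, ⟨w, rfl⟩, rfl⟩ := Submodule.mem_sup.1 hX
    refine ⟨w, ?_⟩
    change c + ⁅D.cyc ℂ, w⁆ = D.proj ℂ (c + ⁅D.cyc ℂ, w⁆) + ⁅D.cyc ℂ, w⁆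
    rw [map_add, proj_lie_cyc, add_zero, D.proj_eq_self_complex c hc]
  obtain ⟨Y, hY⟩ := key X
  obtain ⟨Z, hZ⟩ := key Y
  refine ⟨Z, ?_⟩
  rw [sub_eq_iff_eq_add', ← sub_eq_iff_eq_add'.2 hZ, lie_sub, lie_cyc_proj, sub_zero]
  exact hY

theorem exists_section (j : Fin N) : ∃ Y : Loop ℂ 𝔤, D.Deg (fun k => k = D.d j - 2) Y ∧
    (1 ⊗ₜ[ℂ] D.e j : Loop ℂ 𝔤) - D.proj ℂ (1 ⊗ₜ[ℂ] D.e j) = ⁅D.cyc ℂ, ⁅D.cyc ℂ, Y⁆⁆ := by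
  have hdeg : D.Deg (fun k => k = D.d j) (1 ⊗ₜ[ℂ] D.e j : Loop ℂ 𝔤) := by
    refine Deg.tmul (S := fun k => k = 0) ?_ (D.lie_rho_basis j) (by rintro _ rfl; ring)
    exact CoeffIn.one rfl
  obtain ⟨Y, hY⟩ := D.exists_lie_lie_complex (1 ⊗ₜ[ℂ] D.e j)
  -- `(ad Λ)²` raises degrees by exactly `2`, so only the component of `Y` of degree `d_j - 2` can
  -- contribute.
  obtain ⟨Y₀, h0, h1⟩ := D.exists_deg_split (fun k => k = D.d j - 2) Y
  refine ⟨Y₀, h0, ?_⟩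
  have h2 : D.Deg (fun k => k = D.d j) ⁅D.cyc ℂ, ⁅D.cyc ℂ, Y₀⁆⁆ :=
    D.deg_cyc.lie (D.deg_cyc.lie h0 (U := fun k => k = D.d j - 1) (by rintro _ _ rfl rfl; ring))
      (by rintro _ _ rfl rfl; ring)
  have h3 : D.Deg (fun k => ¬ k = D.d j) ⁅D.cyc ℂ, ⁅D.cyc ℂ, Y - Y₀⁆⁆ :=
    D.deg_cyc.lie (D.deg_cyc.lie h1 (U := fun k => ¬ k = D.d j - 1)
      (by rintro _ b rfl hb; omega)) (by rintro _ b rfl hb; omega)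
  rw [lie_sub, lie_sub, ← hY] at h3
  exact sub_eq_zero.1 (Deg.eq_zero ((hdeg.sub hdeg.proj).sub h2) h3)

/-! #### Over an arbitrary algebra -/

variable (A)

/-- A right inverse of `(ad Λ)²` on the image of `ad Λ`, lowering the degree by `2`. -/
def sect : Loop A 𝔤 →ₗ[LaurentSeries A] Loop A 𝔤 :=
  (D.e.baseChange (LaurentSeries A)).constr (LaurentSeries A)
    fun j => loopMap (Algebra.ofId ℂ A) (D.exists_section j).choose

variable {A}

theorem sect_apply (X : Loop A 𝔤) : D.sect A X = ∑ j,
    (D.e.baseChange (LaurentSeries A)).repr X j •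
      loopMap (Algebra.ofId ℂ A) (D.exists_section j).choose := by
  rw [sect, Module.Basis.constr_apply_fintype]
  rfl

/-- All terms are linear over Laurent series, and on `1 ⊗ e_j` the identity is extended from complex
coefficients. -/
theorem eq_proj_add (X : Loop A 𝔤) : X = D.proj A X + ⁅D.cyc A, ⁅D.cyc A, D.sect A X⁆⁆ := by
  have key : ∀ j, (1 ⊗ₜ[ℂ] D.e j : Loop A 𝔤) = D.proj A (1 ⊗ₜ[ℂ] D.e j) + ⁅D.cyc A, ⁅D.cyc A,
      loopMap (Algebra.ofId ℂ A) (D.exists_section j).choose⁆⁆ := by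
    intro j
    have h := congrArg (loopMap (Algebra.ofId ℂ A)) (D.exists_section j).choose_spec.2
    rw [map_sub, loopMap_proj, loopMap_tmul, map_one, loopMap_lie, loopMap_lie, loopMap_cyc] at h
    rw [← h]
    abel
  conv_lhs => rw [← sum_repr_tmul D.e X]
  conv_rhs => rw [sect_apply, ← sum_repr_tmul D.e X]
  rw [map_sum, lie_sum, lie_sum, ← Finset.sum_add_distrib]
  refine Finset.sum_congr rfl fun j _ => ?_
  rw [sum_repr_tmul]
  conv_lhs => rw [key j]
  rw [map_smul, lie_smul, lie_smul, smul_add]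

theorem Deg.sect {D : Data H n N} {S T : ℤ → Prop} {X : Loop A 𝔤} (hX : D.Deg S X)
    (hT : ∀ k, S k → T (k - 2)) : D.Deg T (D.sect A X) := by
  rw [sect_apply]
  refine Deg.sum _ fun j _ => ?_
  refine Deg.smul (deg_iff D |>.1 hX j) ((D.exists_section j).choose_spec.1.map _) ?_
  rintro a _ ha rfl
  have := hT _ ha
  have e : D.d j + a - 2 = a + (D.d j - 2) := by ring
  rwa [e] at this

/-- Dimension counts are not available over a ring. But the image part of `X` is here also in the
kernel: as image it is orthogonal to the kernel, as kernel it is orthogonal to the image, so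
nondegeneracy kills it. -/
theorem proj_eq_self (X : Loop A 𝔤) (hX : ⁅D.cyc A, X⁆ = 0) : D.proj A X = X := by
  have h0 := D.eq_proj_add X
  have h1 : ⁅D.cyc A, D.sect A X⁆ = ⁅D.cyc A, D.sect A X⁆ := rfl
  have h2 : ⁅D.cyc A, ⁅D.cyc A, D.sect A X⁆⁆ = 0 := by
    apply eq_zero_of_kap
    intro Y
    have hk : ⁅D.cyc A, ⁅D.cyc A, ⁅D.cyc A, D.sect A X⁆⁆⁆ = 0 := by
      have h := congrArg (fun Z => ⁅D.cyc A, Z⁆) h0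
      simp only [lie_add, lie_cyc_proj, zero_add, hX] at h
      exact h.symm
    rw [kap_eq_pair D, D.eq_proj_add Y, pair_add_right, D.pair_lie_cyc _ _ (D.lie_cyc_proj Y),
      zero_add, pair_comm, D.pair_lie_cyc _ _ hk, mul_zero]
  rw [h2, add_zero] at h0
  exact h0.symm

theorem lie_lamA_lamA (a b : Fin n) : ⁅D.lamA A a, D.lamA A b⁆ = 0 := by
  rw [lamA, lamA, ← loopMap_lie, lie_Λ_Λ, map_zero]

theorem lie_eq_zero_of_ker {X Y : Loop A 𝔤} (hX : ⁅D.cyc A, X⁆ = 0) (hY : ⁅D.cyc A, Y⁆ = 0) :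
    ⁅X, Y⁆ = 0 := by
  rw [← D.proj_eq_self X hX, ← D.proj_eq_self Y hY, proj_apply, proj_apply]
  simp only [sum_lie, lie_sum, smul_lie, lie_smul, lie_lamA_lamA, smul_zero,
    Finset.sum_const_zero]

end Data
end Loops

theorem complex_smul_eq {𝔤 : Type*} [LieRing 𝔤] [LieAlgebra ℂ 𝔤] {K : Type*} [CommRing K]
    [Algebra ℂ K] (c : ℂ) (X : Ext K 𝔤) : c • X = algebraMap ℂ K c • X := by
  induction X using TensorProduct.induction_on with
  | zero => simp
  | tmul f x => rw [TensorProduct.smul_tmul', TensorProduct.smul_tmul', Algebra.smul_def, smul_eq_mul]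
  | add X Y hX hY => rw [smul_add, smul_add, hX, hY]

/-- As for Cauchy products, the square of indices splits into the triangle `i + j < M` and a rest,
which is negligible in the filtration. -/
theorem sum_range_mul_range {G : Type*} [AddCommGroup G] (a : ℕ → ℕ → G) (M : ℕ) :
    ∑ i ∈ Finset.range M, ∑ j ∈ Finset.range M, a i j =
      (∑ s ∈ Finset.range M, ∑ p ∈ Finset.HasAntidiagonal.antidiagonal s, a p.1 p.2) +
      ∑ p ∈ (Finset.range M ×ˢ Finset.range M).filter (fun p => ¬ p.1 + p.2 < M), a p.1 p.2 := by
  rw [← Finset.sum_product', ← Finset.sum_filter_add_sum_filter_not _ (fun p => p.1 + p.2 < M)]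
  congr 1
  rw [← Finset.sum_fiberwise_of_maps_to (g := fun p : ℕ × ℕ => p.1 + p.2) (t := Finset.range M)]
  · refine Finset.sum_congr rfl fun s hs => Finset.sum_congr ?_ fun _ _ => rfl
    ext p
    simp only [Finset.mem_filter, Finset.mem_product, Finset.mem_range,
      Finset.HasAntidiagonal.mem_antidiagonal] at hs ⊢
    omega
  · intro p hp
    simpa using (Finset.mem_filter.1 hp).2

/-- Up to the factor `1 / s!` this is the binomial expansion of `(-1 + 1)^s`. -/
theorem sum_antidiagonal_alternating (s : ℕ) :
    ∑ p ∈ Finset.HasAntidiagonal.antidiagonal s, ((p.1.factorial : ℂ)⁻¹ * (-1) ^ p.1 * (p.2.factorial : ℂ)⁻¹) =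
      if s = 0 then 1 else 0 := by
  have h := Commute.add_pow' (Commute.all (-1 : ℂ) 1) s
  have h1 : ∀ p ∈ Finset.HasAntidiagonal.antidiagonal s, ((p.1.factorial : ℂ)⁻¹ * (-1) ^ p.1 *
      (p.2.factorial : ℂ)⁻¹) = (s.factorial : ℂ)⁻¹ * (s.choose p.1 • ((-1 : ℂ) ^ p.1 * 1 ^ p.2)) := by
    intro p hp
    rw [Finset.HasAntidiagonal.mem_antidiagonal] at hp
    subst hp
    rw [Nat.choose_symm_add, Nat.add_choose, nsmul_eq_mul, Nat.cast_div (Nat.factorial_mul_factorial_dvd_factorial_add _ _)]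
    · push_cast
      have h1 : (p.1.factorial : ℂ) ≠ 0 := by exact_mod_cast p.1.factorial_ne_zero
      have h2 : (p.2.factorial : ℂ) ≠ 0 := by exact_mod_cast p.2.factorial_ne_zero
      have h3 : ((p.1 + p.2).factorial : ℂ) ≠ 0 := by exact_mod_cast (p.1 + p.2).factorial_ne_zero
      rw [one_pow]
      field_simp
    · exact_mod_cast mul_ne_zero p.1.factorial_ne_zero p.2.factorial_ne_zero
  rw [Finset.sum_congr rfl h1, ← Finset.mul_sum, ← h, neg_add_cancel]
  cases s <;> simp

namespace Data

variable {𝔤 : Type*} [LieRing 𝔤] [LieAlgebra ℂ 𝔤] [FiniteDimensional ℂ 𝔤]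
  [LieAlgebra.IsSimple ℂ 𝔤] {H : LieSubalgebra ℂ 𝔤} [H.IsCartanSubalgebra] {n N : ℕ}
  {A : Type*} [CommRing A] [Algebra ℂ A] (D : Data H n N)

/-! ### The degree filtration -/

/-- Only components of degree at most `k` occur in `X`. -/
def Fil (k : ℤ) (X : Loop A 𝔤) : Prop := D.Deg (fun l => l ≤ k) X

variable {D}

theorem Fil.mono {k l : ℤ} {X : Loop A 𝔤} (hX : D.Fil k X) (h : k ≤ l) : D.Fil l X :=
  Deg.mono hX fun _ h' => h'.trans h

theorem Fil.add {k : ℤ} {X Y : Loop A 𝔤} (hX : D.Fil k X) (hY : D.Fil k Y) : D.Fil k (X + Y) :=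
  Deg.add hX hY

theorem Fil.sub {k : ℤ} {X Y : Loop A 𝔤} (hX : D.Fil k X) (hY : D.Fil k Y) : D.Fil k (X - Y) :=
  Deg.sub hX hY

theorem Fil.neg {k : ℤ} {X : Loop A 𝔤} (hX : D.Fil k X) : D.Fil k (-X) := Deg.neg hX

theorem Fil.zero {k : ℤ} : D.Fil k (0 : Loop A 𝔤) := Deg.zero

theorem Fil.lie {k l : ℤ} {X Y : Loop A 𝔤} (hX : D.Fil k X) (hY : D.Fil l Y) :
    D.Fil (k + l) ⁅X, Y⁆ :=
  Deg.lie hX hY fun _ _ => add_le_add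

theorem Fil.sum {k : ℤ} {ι : Type*} (s : Finset ι) {X : ι → Loop A 𝔤}
    (hX : ∀ i ∈ s, D.Fil k (X i)) : D.Fil k (∑ i ∈ s, X i) := Deg.sum s hX

theorem Fil.const_smul {k : ℤ} {X : Loop A 𝔤} (hX : D.Fil k X) (c : ℂ) :
    D.Fil k (algebraMap ℂ (LaurentSeries A) c • X) :=
  Deg.smul (CoeffIn.of_algebraMap (S := fun l => l = 0) rfl c) hX
    (by rintro _ b rfl hb; simpa using hb)

theorem Fil.proj {k : ℤ} {X : Loop A 𝔤} (hX : D.Fil k X) : D.Fil k (D.proj A X) := Deg.proj hX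

theorem Fil.sect {k : ℤ} {X : Loop A 𝔤} (hX : D.Fil k X) : D.Fil (k - 2) (D.sect A X) :=
  Deg.sect hX fun _ h => by omega

variable (D)

theorem fil_cyc : D.Fil 1 (D.cyc A) := D.deg_cyc.mono fun _ h => h.le

variable {D}

theorem eq_zero_of_fil (c : ℤ) {X : Loop A 𝔤} (h : ∀ i : ℕ, D.Fil (c - i) X) : X = 0 := by
  apply (D.e.baseChange (LaurentSeries A)).repr.injective
  ext j r
  by_contra h0
  have := h (c - (D.d j - D.cox * r) + 1).toNat j r (by simpa [loopCoeff] using h0)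
  omega

theorem loopCoeff_sub (j : Fin N) (r : ℤ) (X Y : Loop A 𝔤) :
    loopCoeff D.e j r (X - Y) = loopCoeff D.e j r X - loopCoeff D.e j r Y := by
  simp [loopCoeff]

theorem Fil.loopCoeff_eq {k : ℤ} {X Y : Loop A 𝔤} (h : D.Fil k (X - Y)) {j : Fin N} {r : ℤ}
    (hk : k < D.d j - D.cox * r) : loopCoeff D.e j r X = loopCoeff D.e j r Y := by
  rw [← sub_eq_zero, ← loopCoeff_sub]
  by_contra h0
  have := h j r h0
  omega

theorem exists_limit (c : ℤ) (Z : ℕ → Loop A 𝔤) (hZ : ∀ i : ℕ, D.Fil (c - i) (Z (i + 1) - Z i)) :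
    ∃ Y, ∀ i : ℕ, D.Fil (c - i) (Y - Z i) := by
  have hc : ∀ i l : ℕ, D.Fil (c - i) (Z (i + l) - Z i) := by
    intro i l
    induction l with
    | zero => simpa using Fil.zero
    | succ l ih =>
      have := ((hZ (i + l)).mono (l := c - i) (by push_cast; omega)).add ih
      rwa [sub_add_sub_cancel] at this
  -- An index from which on the coefficient at `(j, r)`, of degree `d_j - h r`, no longer changes.
  let M : Fin N → ℤ → ℕ := fun j r => (c - (D.d j - D.cox * r) + 1).toNat
  have hM : ∀ (j : Fin N) (r : ℤ) (i : ℕ), c < i + (D.d j - D.cox * r) →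
      loopCoeff D.e j r (Z i) = loopCoeff D.e j r (Z (M j r)) := by
    intro j r i hi
    have hMr : M j r = (c - (D.d j - D.cox * r) + 1).toNat := rfl
    obtain ⟨l, hl⟩ := Nat.exists_eq_add_of_le (show M j r ≤ i by omega)
    rw [hl]
    exact (hc (M j r) l).loopCoeff_eq (by omega)
  -- For very negative `r` the degree exceeds `c`, so the coefficient is already that of `Z 0`,
  -- which vanishes there.
  have hb : ∀ j, BddBelow (Function.support fun r => loopCoeff D.e j r (Z (M j r))) := by
    intro j
    obtain ⟨r₀, hr₀⟩ := exists_coeff_eq_zero ((D.e.baseChange (LaurentSeries A)).repr (Z 0) j)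
    refine ⟨min r₀ (-(|c| + |D.d j|)), fun r hr => ?_⟩
    by_contra hlt
    rw [not_le, lt_min_iff] at hlt
    apply hr
    have hcd : c < D.d j - D.cox * r := by
      have h1 := D.cox_pos
      have h2 : -r ≤ D.cox * (-r) := le_mul_of_one_le_left (by
        have := abs_nonneg c; have := abs_nonneg (D.d j); omega) h1
      have h3 := le_abs_self c
      have h4 := neg_abs_le (D.d j)
      have h5 : D.cox * -r = -(D.cox * r) := by ring
      omega
    have := hM j r 0 (by simpa using hcd)
    change loopCoeff D.e j r (Z (M j r)) = 0
    rw [← this]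
    exact hr₀ r hlt.1
  refine ⟨(D.e.baseChange (LaurentSeries A)).equivFun.symm fun j =>
    HahnSeries.ofSuppBddBelow _ (hb j), fun i j r h => ?_⟩
  change _ ≤ _
  by_contra hlt
  apply h
  rw [loopCoeff_sub, hM j r i (by omega), loopCoeff, ← Module.Basis.equivFun_apply,
    LinearEquiv.apply_symm_apply]
  exact sub_self _

/-! ### Exponentials of inner derivations -/

/-- The `s`-th term of the exponential series of `ad U`. -/
def expTerm (U : Loop A 𝔤) (s : ℕ) : Loop A 𝔤 →ₗ[LaurentSeries A] Loop A 𝔤 :=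
  algebraMap ℂ (LaurentSeries A) (s.factorial : ℂ)⁻¹ •
    (LieAlgebra.ad (LaurentSeries A) (Loop A 𝔤) U) ^ s

theorem expTerm_apply (U X : Loop A 𝔤) (s : ℕ) : expTerm U s X =
    algebraMap ℂ (LaurentSeries A) (s.factorial : ℂ)⁻¹ •
      ((LieAlgebra.ad (LaurentSeries A) (Loop A 𝔤) U) ^ s) X := rfl

theorem ad_pow_succ (U X : Loop A 𝔤) (s : ℕ) :
    ((LieAlgebra.ad (LaurentSeries A) (Loop A 𝔤) U) ^ (s + 1)) X =
      ⁅U, ((LieAlgebra.ad (LaurentSeries A) (Loop A 𝔤) U) ^ s) X⁆ := by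
  rw [pow_succ', Module.End.mul_apply, LieAlgebra.ad_apply]

theorem Fil.ad_pow {U X : Loop A 𝔤} (hU : D.Fil (-1) U) {k : ℤ} (hX : D.Fil k X) (s : ℕ) :
    D.Fil (k - s) (((LieAlgebra.ad (LaurentSeries A) (Loop A 𝔤) U) ^ s) X) := by
  induction s with
  | zero => simpa using hX
  | succ s ih =>
    rw [ad_pow_succ]
    exact (hU.lie ih).mono (by push_cast; omega)

theorem Fil.expTerm {U X : Loop A 𝔤} (hU : D.Fil (-1) U) {k : ℤ} (hX : D.Fil k X) (s : ℕ) :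
    D.Fil (k - s) (expTerm U s X) :=
  (hU.ad_pow hX s).const_smul _

theorem expTerm_zero (U X : Loop A 𝔤) : Data.expTerm U 0 X = X := by
  simp [expTerm_apply]

theorem expTerm_one (U X : Loop A 𝔤) : Data.expTerm U 1 X = ⁅U, X⁆ := by
  simp [expTerm_apply]

variable (D)

theorem isExpAd_of_fil {U X Y : Loop A 𝔤} {k : ℤ}
    (h : ∀ M : ℕ, D.Fil (k - M) (Y - ∑ s ∈ Finset.range M, expTerm U s X)) : D.IsExpAd U X Y := by
  intro j r
  refine ⟨(k - (D.d j - D.cox * r) + 1).toNat, fun M hM => ?_⟩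
  have e : ∀ s, ((s.factorial : ℂ)⁻¹ • ((LieAlgebra.ad (LaurentSeries A) (Loop A 𝔤) U) ^ s) X) =
      expTerm U s X := fun s => complex_smul_eq _ _
  simp only [e]
  exact ((h M).loopCoeff_eq (by omega)).symm

theorem IsExpAd.unique {D : Data H n N} {U X Y Y' : Loop A 𝔤} (h : D.IsExpAd U X Y) (h' : D.IsExpAd U X Y') :
    Y = Y' := by
  apply (D.e.baseChange (LaurentSeries A)).repr.injective
  ext j r
  obtain ⟨M, hM⟩ := h j r
  obtain ⟨M', hM'⟩ := h' j r
  exact (hM (max M M') (le_max_left _ _)).symm.trans (hM' _ (le_max_right _ _))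

theorem IsExpAd.expAd_eq {D : Data H n N} {U X Y : Loop A 𝔤} (h : D.IsExpAd U X Y) : D.expAd U X = Y := by
  rw [expAd, dif_pos ⟨Y, h⟩]
  exact IsExpAd.unique (Exists.choose_spec (⟨Y, h⟩ : ∃ Y, D.IsExpAd U X Y)) h

variable {D}

/-- Each bracket with `U` lowers the degree by at least one, so the exponential series converges in
the filtration. -/
theorem fil_expAd_sub {U X : Loop A 𝔤} (hU : D.Fil (-1) U) {k : ℤ} (hX : D.Fil k X) (M : ℕ) :
    D.Fil (k - M) (D.expAd U X - ∑ s ∈ Finset.range M, expTerm U s X) := by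
  obtain ⟨Y, hY⟩ := exists_limit (D := D) k (fun M => ∑ s ∈ Finset.range M, expTerm U s X)
    fun i => by
      rw [Finset.sum_range_succ, add_sub_cancel_left]
      exact hU.expTerm hX i
  rw [(D.isExpAd_of_fil hY).expAd_eq]
  exact hY M

theorem fil_expAd {U X : Loop A 𝔤} (hU : D.Fil (-1) U) {k : ℤ} (hX : D.Fil k X) :
    D.Fil k (D.expAd U X) := by
  have := fil_expAd_sub hU hX 0
  simpa using this

theorem fil_expAd_sub_self {U X : Loop A 𝔤} (hU : D.Fil (-1) U) {k : ℤ} (hX : D.Fil k X) :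
    D.Fil (k - 1) (D.expAd U X - X) := by
  have := fil_expAd_sub hU hX 1
  rw [Finset.sum_range_one, expTerm_zero] at this
  simpa using this

theorem isExpAd_expAd {U X : Loop A 𝔤} (hU : D.Fil (-1) U) : D.IsExpAd U X (D.expAd U X) := by
  obtain ⟨k, hk⟩ := D.exists_deg_le X
  exact D.isExpAd_of_fil (fil_expAd_sub hU hk)

theorem expAd_add {U : Loop A 𝔤} (hU : D.Fil (-1) U) (X Y : Loop A 𝔤) :
    D.expAd U (X + Y) = D.expAd U X + D.expAd U Y := by
  obtain ⟨k, hk⟩ := D.exists_deg_le X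
  obtain ⟨l, hl⟩ := D.exists_deg_le Y
  have hk' : D.Fil (max k l) X := Fil.mono hk (le_max_left _ _)
  have hl' : D.Fil (max k l) Y := Fil.mono hl (le_max_right _ _)
  refine (D.isExpAd_of_fil (k := max k l) fun M => ?_).expAd_eq
  simp only [map_add, Finset.sum_add_distrib]
  rw [add_sub_add_comm]
  exact (fil_expAd_sub hU hk' M).add (fil_expAd_sub hU hl' M)

theorem expAd_smul {U : Loop A 𝔤} (hU : D.Fil (-1) U) (f : LaurentSeries A) (X : Loop A 𝔤) :
    D.expAd U (f • X) = f • D.expAd U X := by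
  obtain ⟨k, hk⟩ := D.exists_deg_le X
  obtain ⟨r₀, hr₀⟩ := exists_coeff_eq_zero f
  have hf : CoeffIn D.cox (fun l => l ≤ D.cox * |r₀|) f := by
    intro r hr
    have h1 : r₀ ≤ r := by
      by_contra h
      exact hr (hr₀ r (by omega))
    rw [← mul_neg]
    exact mul_le_mul_of_nonneg_left (by have := neg_abs_le r₀; omega) D.cox_pos.le
  refine (D.isExpAd_of_fil (k := D.cox * |r₀| + k) fun M => ?_).expAd_eq
  simp only [map_smul]
  rw [← Finset.smul_sum, ← smul_sub]
  exact Deg.smul hf (fil_expAd_sub hU hk M) fun a b ha hb => by omega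

theorem expTerm_lie (U X Y : Loop A 𝔤) (s : ℕ) : expTerm U s ⁅X, Y⁆ =
    ∑ p ∈ Finset.HasAntidiagonal.antidiagonal s, ⁅expTerm U p.1 X, expTerm U p.2 Y⁆ := by
  have h : ((LieAlgebra.ad (LaurentSeries A) (Loop A 𝔤) U) ^ s) ⁅X, Y⁆ =
      ∑ p ∈ Finset.HasAntidiagonal.antidiagonal s, s.choose p.1 •
        ⁅((LieAlgebra.ad (LaurentSeries A) (Loop A 𝔤) U) ^ p.1) X,
          ((LieAlgebra.ad (LaurentSeries A) (Loop A 𝔤) U) ^ p.2) Y⁆ := by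
    -- `LieDerivation.inner` of an element `v` is `X ↦ [X, v]`, so `-U` is needed to obtain `ad U`.
    have h := LieDerivation.iterate_apply_lie (LieDerivation.inner (LaurentSeries A) (Loop A 𝔤)
      (Loop A 𝔤) (-U)) s X Y
    have e : ∀ (s : ℕ) (Z : Loop A 𝔤), (⇑(LieDerivation.inner (LaurentSeries A) (Loop A 𝔤)
        (Loop A 𝔤) (-U)))^[s] Z = ((LieAlgebra.ad (LaurentSeries A) (Loop A 𝔤) U) ^ s) Z := by
      intro s Z
      induction s with
      | zero => rfl
      | succ s ih =>
        rw [Function.iterate_succ_apply', ih, ad_pow_succ, LieDerivation.inner_apply_apply,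
          lie_neg, lie_skew]
    simpa only [e] using h
  rw [expTerm_apply, h, Finset.smul_sum]
  refine Finset.sum_congr rfl fun p hp => ?_
  rw [Finset.HasAntidiagonal.mem_antidiagonal] at hp
  subst hp
  rw [expTerm_apply, expTerm_apply, smul_lie, lie_smul, smul_smul, ← map_mul,
    ← Nat.cast_smul_eq_nsmul (LaurentSeries A), smul_smul,
    ← map_natCast (algebraMap ℂ (LaurentSeries A)), ← map_mul]
  congr 2
  rw [Nat.choose_symm_add, Nat.add_choose, Nat.cast_div (Nat.factorial_mul_factorial_dvd_factorial_add _ _)]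
  · push_cast
    have h3 : ((p.1 + p.2).factorial : ℂ) ≠ 0 := by exact_mod_cast (p.1 + p.2).factorial_ne_zero
    field_simp
  · exact_mod_cast mul_ne_zero p.1.factorial_ne_zero p.2.factorial_ne_zero

theorem expAd_lie {U : Loop A 𝔤} (hU : D.Fil (-1) U) (X Y : Loop A 𝔤) :
    D.expAd U ⁅X, Y⁆ = ⁅D.expAd U X, D.expAd U Y⁆ := by
  obtain ⟨k, hk⟩ := D.exists_deg_le X
  obtain ⟨l, hl⟩ := D.exists_deg_le Y
  refine (D.isExpAd_of_fil (k := k + l) fun M => ?_).expAd_eq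
  -- Replace both exponentials by partial sums; the bracket of the partial sums differs from the
  -- partial sum for the bracket by the terms with `p.1 + p.2 ≥ M`.
  have e : ⁅D.expAd U X, D.expAd U Y⁆ - ∑ s ∈ Finset.range M, expTerm U s ⁅X, Y⁆ =
      ⁅D.expAd U X - ∑ s ∈ Finset.range M, expTerm U s X, D.expAd U Y⁆ +
      ⁅∑ s ∈ Finset.range M, expTerm U s X, D.expAd U Y - ∑ s ∈ Finset.range M, expTerm U s Y⁆ +
      ∑ p ∈ (Finset.range M ×ˢ Finset.range M).filter (fun p => ¬ p.1 + p.2 < M),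
        ⁅expTerm U p.1 X, expTerm U p.2 Y⁆ := by
    have h := sum_range_mul_range (fun i j => ⁅expTerm U i X, expTerm U j Y⁆) M
    simp only [← lie_sum, ← sum_lie] at h
    simp only [expTerm_lie]
    rw [sub_lie, lie_sub, h]
    abel
  rw [e]
  refine Fil.add (Fil.add ?_ ?_) ?_
  · exact ((fil_expAd_sub hU hk M).lie (fil_expAd hU hl)).mono (by omega)
  · refine Fil.mono (Fil.lie (k := k) (Fil.sum _ fun s _ => ?_) (fil_expAd_sub hU hl M)) (by omega)
    exact (hU.expTerm hk s).mono (by omega)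
  · refine Fil.sum _ fun p hp => ?_
    have := (Finset.mem_filter.1 hp).2
    exact ((hU.expTerm hk p.1).lie (hU.expTerm hl p.2)).mono (by omega)

theorem expTerm_neg_expTerm (U X : Loop A 𝔤) (i j : ℕ) : expTerm (-U) i (expTerm U j X) =
    algebraMap ℂ (LaurentSeries A) ((i.factorial : ℂ)⁻¹ * (-1) ^ i * (j.factorial : ℂ)⁻¹) •
      ((LieAlgebra.ad (LaurentSeries A) (Loop A 𝔤) U) ^ (i + j)) X := by
  have h : LieAlgebra.ad (LaurentSeries A) (Loop A 𝔤) (-U) =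
      (-1 : LaurentSeries A) • LieAlgebra.ad (LaurentSeries A) (Loop A 𝔤) U := by
    rw [map_neg, neg_smul, one_smul]
  rw [expTerm_apply, expTerm_apply, h, smul_pow, LinearMap.smul_apply, map_smul, ← Module.End.mul_apply,
    ← pow_add, smul_smul, smul_smul]
  simp only [map_mul, map_pow, map_neg, map_one]

theorem expAd_neg_expAd {U : Loop A 𝔤} (hU : D.Fil (-1) U) (X : Loop A 𝔤) :
    D.expAd (-U) (D.expAd U X) = X := by
  obtain ⟨k, hk⟩ := D.exists_deg_le X
  refine (D.isExpAd_of_fil (k := k) fun M => ?_).expAd_eq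
  have hd : ∀ i, expTerm (-U) i (D.expAd U X) = expTerm (-U) i (D.expAd U X -
      ∑ j ∈ Finset.range M, expTerm U j X) + ∑ j ∈ Finset.range M, expTerm (-U) i (expTerm U j X) := by
    intro i
    rw [← map_sum, ← map_add, sub_add_cancel]
  have hs : ∀ s, ∑ p ∈ Finset.HasAntidiagonal.antidiagonal s, expTerm (-U) p.1 (expTerm U p.2 X) =
      if s = 0 then X else 0 := by
    intro s
    have e : ∀ p ∈ Finset.HasAntidiagonal.antidiagonal s, expTerm (-U) p.1 (expTerm U p.2 X) =
        algebraMap ℂ (LaurentSeries A)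
          ((p.1.factorial : ℂ)⁻¹ * (-1) ^ p.1 * (p.2.factorial : ℂ)⁻¹) •
          ((LieAlgebra.ad (LaurentSeries A) (Loop A 𝔤) U) ^ s) X := by
      intro p hp
      rw [expTerm_neg_expTerm, Finset.HasAntidiagonal.mem_antidiagonal.1 hp]
    rw [Finset.sum_congr rfl e, ← Finset.sum_smul, ← map_sum, sum_antidiagonal_alternating]
    split_ifs with h0
    · rw [map_one, one_smul, h0, pow_zero, Module.End.one_apply]
    · rw [map_zero, zero_smul]
  simp only [hd]
  rw [Finset.sum_add_distrib, sum_range_mul_range (fun i j => expTerm (-U) i (expTerm U j X))]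
  simp only [hs]
  have h1 : D.Fil (k - M) (∑ i ∈ Finset.range M, expTerm (-U) i (D.expAd U X -
      ∑ j ∈ Finset.range M, expTerm U j X)) :=
    Fil.sum _ fun i _ => (hU.neg.expTerm (fil_expAd_sub hU hk M) i).mono (by omega)
  have h2 : D.Fil (k - M) (∑ p ∈ (Finset.range M ×ˢ Finset.range M).filter
      (fun p => ¬ p.1 + p.2 < M), expTerm (-U) p.1 (expTerm U p.2 X)) := by
    refine Fil.sum _ fun p hp => ?_
    have := (Finset.mem_filter.1 hp).2
    exact (hU.neg.expTerm (hU.expTerm hk p.2) p.1).mono (by omega)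
  have h3 : D.Fil (k - M) (X - ∑ s ∈ Finset.range M, if s = 0 then X else 0) := by
    rw [Finset.sum_ite_eq' (Finset.range M) 0 fun _ => X]
    split_ifs with h0
    · rw [sub_self]; exact Fil.zero
    · have : M = 0 := by simpa using h0
      subst this
      have hk' : D.Fil k X := hk
      simpa using hk'
  have := (h3.sub h2).sub h1
  convert this using 1
  abel

theorem expAd_expAd_neg {U : Loop A 𝔤} (hU : D.Fil (-1) U) (X : Loop A 𝔤) :
    D.expAd U (D.expAd (-U) X) = X := by
  have := expAd_neg_expAd hU.neg X
  rwa [neg_neg] at this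

theorem fil_ad_pow_sub {U V X : Loop A 𝔤} (hU : D.Fil (-1) U) (hV : D.Fil (-1) V) {i : ℕ} {k : ℤ}
    (hUV : D.Fil (-1 - i) (V - U)) (hX : D.Fil k X) (s : ℕ) :
    D.Fil (k - i - (s + 1)) (((LieAlgebra.ad (LaurentSeries A) (Loop A 𝔤) V) ^ (s + 1)) X -
      ((LieAlgebra.ad (LaurentSeries A) (Loop A 𝔤) U) ^ (s + 1)) X) := by
  have e : ∀ s : ℕ, ((LieAlgebra.ad (LaurentSeries A) (Loop A 𝔤) V) ^ (s + 1)) X -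
      ((LieAlgebra.ad (LaurentSeries A) (Loop A 𝔤) U) ^ (s + 1)) X =
      ⁅V - U, ((LieAlgebra.ad (LaurentSeries A) (Loop A 𝔤) V) ^ s) X⁆ +
      ⁅U, ((LieAlgebra.ad (LaurentSeries A) (Loop A 𝔤) V) ^ s) X -
        ((LieAlgebra.ad (LaurentSeries A) (Loop A 𝔤) U) ^ s) X⁆ := by
    intro s
    rw [ad_pow_succ, ad_pow_succ, sub_lie, lie_sub]
    abel
  induction s with
  | zero =>
    rw [e]
    simp only [pow_zero, sub_self, lie_zero, add_zero, Module.End.one_apply]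
    exact (hUV.lie hX).mono (by push_cast; omega)
  | succ s ih =>
    rw [e]
    exact ((hUV.lie (hV.ad_pow hX (s + 1))).mono (by push_cast; omega)).add
      ((hU.lie ih).mono (by push_cast; omega))

/-- First order expansion in the exponent. The linear term has degree at most `k - 1 - i`, and the
terms of order two and more lose at least one further degree. -/
theorem fil_expAd_sub_expAd {U V X : Loop A 𝔤} (hU : D.Fil (-1) U) (hV : D.Fil (-1) V) {i : ℕ}
    {k : ℤ} (hUV : D.Fil (-1 - i) (V - U)) (hX : D.Fil k X) :
    D.Fil (k - i - 2) (D.expAd V X - D.expAd U X - ⁅V - U, X⁆) := by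
  have h1 := (fil_expAd_sub hV hX (i + 2)).sub (fil_expAd_sub hU hX (i + 2))
  have h2 : D.Fil (k - i - 2) (∑ s ∈ Finset.range i, (expTerm V (s + 2) X - expTerm U (s + 2) X)) := by
    refine Fil.sum _ fun s _ => ?_
    rw [expTerm_apply, expTerm_apply, ← smul_sub]
    exact Fil.const_smul ((fil_ad_pow_sub hU hV hUV hX (s + 1)).mono (by push_cast; omega)) _
  rw [Finset.sum_range_succ', Finset.sum_range_succ', Finset.sum_range_succ',
    Finset.sum_range_succ'] at h1
  simp only [add_assoc, zero_add, one_add_one_eq_two, expTerm_zero, expTerm_one] at h1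
  have := (h1.mono (l := k - i - 2) (by push_cast; omega)).add h2
  convert this using 1
  rw [Finset.sum_sub_distrib, sub_lie]
  abel

/-! ### Existence of the dressing -/

theorem proj_proj (X : Loop A 𝔤) : D.proj A (D.proj A X) = D.proj A X :=
  D.proj_eq_self _ (D.lie_cyc_proj X)

theorem exists_dressing (W : Loop A 𝔤) (hW : D.Fil 0 (W - D.cyc A)) :
    ∃ U K : Loop A 𝔤, (∃ Y, ⁅D.cyc A, Y⁆ = U) ∧ D.Fil (-1) U ∧ ⁅D.cyc A, K⁆ = 0 ∧ D.Fil 0 K ∧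
      D.expAd (-U) W = D.cyc A + K := by
  let X : Loop A 𝔤 → Loop A 𝔤 := fun U => D.expAd (-U) W - D.cyc A
  -- `P U` is the image part of the error `X U`, which has to vanish; `V U` solves the linearised
  -- equation `[Λ, V] = -P`.
  let P : Loop A 𝔤 → Loop A 𝔤 := fun U => X U - D.proj A (X U)
  let V : Loop A 𝔤 → Loop A 𝔤 := fun U => -⁅D.cyc A, D.sect A (P U)⁆
  let u : ℕ → Loop A 𝔤 := fun i => Nat.rec 0 (fun _ U => U + V U) i
  have u_succ : ∀ i, u (i + 1) - u i = V (u i) := fun i => add_sub_cancel_left _ _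
  have hW1 : D.Fil 1 W := by
    have := (hW.mono zero_le_one).add D.fil_cyc
    rwa [sub_add_cancel] at this
  have hPV : ∀ U k, D.Fil k (P U) → D.Fil (k - 1) (V U) := fun U k h =>
    ((D.fil_cyc.lie h.sect).neg).mono (by omega)
  have hPproj : ∀ U, D.proj A (P U) = 0 := by
    intro U
    rw [map_sub, proj_proj, sub_self]
  have hVP : ∀ U, ⁅D.cyc A, V U⁆ = -P U := by
    intro U
    have := D.eq_proj_add (P U)
    rw [hPproj, zero_add] at this
    rw [lie_neg, ← this]
  -- Each correction keeps the projection of `u i` zero, so that the limit lies in the image of `ad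
  -- Λ`, and lowers the degree of the remaining error by one.
  have key : ∀ i : ℕ, D.Fil (-1) (u i) ∧ D.proj A (u i) = 0 ∧ D.Fil (-i) (P (u i)) := by
    intro i
    induction i with
    | zero =>
      have hX : D.Fil 0 (X (u 0)) := by
        have h1 := fil_expAd_sub_self (U := -u 0) (k := 1) (Fil.neg Fil.zero) hW1
        have h2 := (h1.mono (l := 0) (by omega)).add hW
        rwa [sub_add_sub_cancel] at h2
      exact ⟨Fil.zero, map_zero _, (hX.sub hX.proj).mono (by simp)⟩
    | succ i ih =>
      obtain ⟨h1, h2, h3⟩ := ih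
      have hV := hPV _ _ h3
      have h1' : D.Fil (-1) (u (i + 1)) := h1.add (hV.mono (by omega))
      refine ⟨h1', ?_, ?_⟩
      · change D.proj A (u i + -⁅D.cyc A, _⁆) = 0
        rw [map_add, map_neg, h2, proj_lie_cyc, neg_zero, add_zero]
      · have h4 : -u (i + 1) - -u i = - V (u i) := by
          rw [← u_succ]; abel
        have h5 := fil_expAd_sub_expAd (i := i) h1.neg h1'.neg
          (by rw [h4]; exact hV.neg.mono (by omega)) hW1
        have h6 : D.Fil (-1 - i) ⁅V (u i), W - D.cyc A⁆ :=
          (hV.lie hW).mono (by omega)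
        have h7 : D.Fil (-1 - i) (X (u (i + 1)) - D.proj A (X (u i))) := by
          have h8 := (h5.mono (l := -1 - i) (by omega)).sub h6
          convert h8 using 1
          rw [h4, neg_lie, lie_sub, ← lie_skew (V (u i)) (D.cyc A), hVP]
          simp only [P, X]
          abel
        have h9 := h7.sub h7.proj
        rw [(D.proj A).map_sub (X (u (i + 1))) (D.proj A (X (u i))), proj_proj] at h9
        refine Fil.mono (k := -1 - i) ?_ (by push_cast; omega)
        convert h9 using 1
        simp only [P]
        abel
  obtain ⟨U, hU⟩ := exists_limit (D := D) (-1) u fun i => by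
    rw [u_succ]
    exact (hPV _ _ (key i).2.2).mono (by omega)
  have hU1 : D.Fil (-1) U := by simpa [u] using hU 0
  have hprojU : D.proj A U = 0 := by
    refine eq_zero_of_fil (D := D) (-1) fun i => ?_
    have := (hU i).proj
    rwa [map_sub, (key i).2.1, sub_zero] at this
  have hdiff : ∀ i : ℕ, D.Fil (-i) (X U - X (u i)) := by
    intro i
    have h4 : D.Fil (-1 - i) (-U - -u i) := by
      rw [neg_sub_neg]
      simpa using (hU i).neg
    have h5 := fil_expAd_sub_expAd (i := i) (key i).1.neg hU1.neg h4 hW1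
    have h6 := (h5.mono (l := -i) (by omega)).add ((h4.lie hW1).mono (l := -i) (by omega))
    rw [sub_add_cancel] at h6
    simpa only [X, sub_sub_sub_cancel_right] using h6
  have hPU : P U = 0 := by
    refine eq_zero_of_fil (D := D) 0 fun i => ?_
    have h1 := ((hdiff i).sub (hdiff i).proj).add (key i).2.2
    rw [zero_sub]
    convert h1 using 1
    simp only [P, map_sub]
    abel
  have hXU : X U = D.proj A (X U) := sub_eq_zero.1 hPU
  refine ⟨U, X U, ⟨⁅D.cyc A, D.sect A U⁆, ?_⟩, hU1, ?_, ?_, ?_⟩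
  · have := D.eq_proj_add U
    rw [hprojU, zero_add] at this
    exact this.symm
  · rw [hXU, lie_cyc_proj]
  · have h1 := fil_expAd_sub_self (U := -U) (k := 1) hU1.neg hW1
    have h2 := (h1.mono (l := 0) (by omega)).add hW
    rwa [sub_add_sub_cancel] at h2
  · simp only [X]
    abel

end Data

/-! ### Coefficientwise derivations and truncations of Laurent series -/

section LaurentDerivations

variable {A : Type*} [CommRing A] [Algebra ℂ A]

/-- The coefficientwise extension of a derivation to Laurent series. -/
def coeffDeriv (δ : Derivation ℂ A A) : Derivation ℂ (LaurentSeries A) (LaurentSeries A) :=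
  laurentDeriv δ 0

theorem coeff_coeffDeriv (δ : Derivation ℂ A A) (f : LaurentSeries A) (r : ℤ) :
    (coeffDeriv δ f).coeff r = δ (f.coeff r) := by
  rw [coeffDeriv, coeff_laurentDeriv, zero_mul, zero_smul, add_zero]

theorem coeffDeriv_laurentMap_ofId (δ : Derivation ℂ A A) (f : LaurentSeries ℂ) :
    coeffDeriv δ (laurentMap (Algebra.ofId ℂ A) f) = 0 := by
  apply laurent_ext
  intro r
  rw [coeff_coeffDeriv, coeff_laurentMap, Algebra.ofId_apply, Derivation.map_algebraMap]
  rfl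

theorem derivExt_loopMap_ofId {𝔤 : Type*} [LieRing 𝔤] [LieAlgebra ℂ 𝔤]
    [FiniteDimensional ℂ 𝔤] [LieAlgebra.IsSimple ℂ 𝔤] (δ : Derivation ℂ A A)
    (X : Loop ℂ 𝔤) : derivExt 𝔤 (coeffDeriv δ) (loopMap (Algebra.ofId ℂ A) X) = 0 := by
  induction X using TensorProduct.induction_on with
  | zero => simp
  | tmul f x =>
    rw [loopMap_tmul, derivExt_tmul, coeffDeriv_laurentMap_ofId, TensorProduct.zero_tmul]
  | add X Y hX hY => rw [map_add, map_add, hX, hY, add_zero]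

theorem cut_add_cut_not (p : ℤ → Prop) (f : LaurentSeries A) :
    cut p f + cut (fun r => ¬ p r) f = f := by
  apply laurent_ext
  intro r
  rw [HahnSeries.coeff_add, coeff_cut, coeff_cut]
  by_cases h : p r <;> simp [h]

/-- Only the powers `r` and `-r` meet in the constant coefficient, so truncation is adjoint to the
reflected truncation. -/
theorem coeff_zero_cut_mul (p : ℤ → Prop) (f g : LaurentSeries A) :
    (cut p f * g).coeff 0 = (f * cut (fun r => p (-r)) g).coeff 0 := by
  have h1 : ∀ (p : ℤ → Prop) (f : LaurentSeries A), (cut p f).support ⊆ f.support := by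
    intro p f r hr h
    apply hr
    rw [coeff_cut, h, ite_self]
  rw [HahnSeries.coeff_mul_left' f.isPWO_support (h1 _ _),
    HahnSeries.coeff_mul_right' g.isPWO_support (h1 _ _)]
  refine Finset.sum_congr rfl fun ij hij => ?_
  have h : ij.1 + ij.2 = 0 := (Finset.mem_antidiagonal.1 hij).2.2
  rw [coeff_cut, coeff_cut, eq_neg_of_add_eq_zero_left h]
  split_ifs <;> simp

theorem single_mul_cut (m : ℤ) (p : ℤ → Prop) (f : LaurentSeries A) :
    HahnSeries.single m (1 : A) * cut p f =
      cut (fun r => p (r - m)) (HahnSeries.single m (1 : A) * f) := by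
  apply laurent_ext
  intro r
  rw [HahnSeries.coeff_single_mul, coeff_cut, coeff_cut, HahnSeries.coeff_single_mul]
  split_ifs <;> simp

theorem single_mul_single_one (a b : ℤ) : HahnSeries.single a (1 : A) * HahnSeries.single b (1 : A) =
    HahnSeries.single (a + b) (1 : A) := by
  rw [HahnSeries.single_mul_single, mul_one]

theorem coeff_eq_coeff_zero (f : LaurentSeries A) (r : ℤ) :
    f.coeff r = (HahnSeries.single (-r) (1 : A) * f).coeff 0 := by
  rw [HahnSeries.coeff_single_mul, one_mul, zero_sub, neg_neg]

/-- Moves the truncation from `u` to `f`: the divided difference in the Poisson bracket, a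
truncation of shifted `u`, becomes the polynomial part of `λ^k R_a(λ)`. -/
theorem coeff_cut_mul_eq (f u : LaurentSeries A) (k q : ℤ) :
    (cut (fun r => 1 ≤ r) (HahnSeries.single (1 - q) (1 : A) * u) * f).coeff (k + 1) =
      (cut (fun r => r ≤ 0) (HahnSeries.single (-k) (1 : A) * f) * u).coeff q := by
  rw [coeff_eq_coeff_zero, mul_left_comm, coeff_zero_cut_mul, coeff_eq_coeff_zero _ q,
    ← mul_assoc, single_mul_cut, ← mul_assoc, single_mul_single_one, mul_comm _ u,
    mul_comm _ u, mul_assoc]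
  rw [single_mul_cut, ← mul_assoc (HahnSeries.single (1 - q) (1 : A)), single_mul_single_one,
    show 1 - q + -(k + 1) = -q + -k by ring]
  congr 4
  ext r
  omega

end LaurentDerivations

namespace Data

variable {𝔤 : Type*} [LieRing 𝔤] [LieAlgebra ℂ 𝔤] [FiniteDimensional ℂ 𝔤]
  [LieAlgebra.IsSimple ℂ 𝔤] {H : LieSubalgebra ℂ 𝔤} [H.IsCartanSubalgebra] {n N : ℕ}
  {A : Type*} [CommRing A] [Algebra ℂ A] (D : Data H n N)

/-! ### The coefficients of `W` -/

/-- With `k = r - 1` the range of the indices says that `λ^(-r) e_j` has degree at most `0`. -/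
theorem var_iff (j : Fin N) (r : ℤ) :
    (D.d j : ℚ) / (D.cox : ℚ) - 1 ≤ ((r - 1 : ℤ) : ℚ) ↔ D.d j ≤ D.cox * r := by
  have h : (0 : ℚ) < D.cox := by exact_mod_cast D.cox_pos
  push_cast
  rw [sub_le_sub_iff_right, div_le_iff₀ h]
  norm_cast
  rw [mul_comm]

theorem uCoeff_eq_zero {j : Fin N} {r : ℤ} (h : D.cox * r < D.d j) : D.uCoeff j r = 0 := by
  rw [uCoeff, dif_neg]
  rw [var_iff]
  omega

/-- The index of the generator `u^j_{r - 1}`. -/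
def varOf {j : Fin N} {r : ℤ} (h : D.d j ≤ D.cox * r) : D.Var :=
  ⟨(j, r - 1), (D.var_iff j r).2 h⟩

theorem varOf_val {j : Fin N} {r : ℤ} (h : D.d j ≤ D.cox * r) : (D.varOf h).1 = (j, r - 1) := rfl

theorem uCoeff_eq_X {j : Fin N} {r : ℤ} (h : D.d j ≤ D.cox * r) :
    D.uCoeff j r = MvPolynomial.X (D.varOf h) := by
  rw [uCoeff, dif_pos ((D.var_iff j r).2 h)]
  rfl

theorem valid_of_pos (j : Fin N) {r : ℤ} (h : 1 ≤ r) : D.d j ≤ D.cox * r :=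
  (D.d_lt j).le.trans (le_mul_of_one_le_right D.cox_pos.le h)

theorem not_valid_of_neg (j : Fin N) {r : ℤ} (h : r < 0) : D.cox * r < D.d j := by
  have h1 : D.cox * r ≤ D.cox * (-1) := mul_le_mul_of_nonneg_left (by omega) D.cox_pos.le
  have := D.neg_cox_lt_d j
  linarith

theorem coeff_uSeries (j : Fin N) (r : ℤ) : (D.uSeries j).coeff r = D.uCoeff j r := by
  rw [uSeries, PowerSeries.coeff_coe]
  split_ifs with h
  · rw [D.uCoeff_eq_zero (D.not_valid_of_neg j h)]
  · rw [PowerSeries.coeff_mk, Int.natAbs_of_nonneg (not_lt.1 h)]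

theorem W_sub_cyc : D.W - D.cyc D.Poly = ∑ j, Ext.tmul (D.uSeries j) (D.e j) :=
  add_sub_cancel_left _ _

theorem fil_W_sub_cyc : D.Fil 0 (D.W - D.cyc D.Poly) := by
  rw [W_sub_cyc]
  refine Fil.sum _ fun j _ => Deg.tmul (S := fun k => D.d j + k ≤ 0) ?_ (D.lie_rho_basis j)
    fun a ha => ha
  intro r hr
  rw [coeff_uSeries] at hr
  by_contra h
  exact hr (D.uCoeff_eq_zero (by omega))

/-! ### The dressing transformation -/

theorem isDressing : D.IsDressing D.dressing := by
  have h : ∃ p, D.IsDressing p := by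
    obtain ⟨U, K, h1, h2, h3, h4, h5⟩ := exists_dressing D.W D.fil_W_sub_cyc
    refine ⟨(U, K), h1, h2, h3, h4, ?_⟩
    change D.IsExpAd (-U) D.W (D.cyc D.Poly + K)
    rw [← h5]
    exact isExpAd_expAd (Fil.neg h2)
  rw [dressing, dif_pos h]
  exact h.choose_spec

theorem fil_dressing_fst : D.Fil (-1) D.dressing.1 := D.isDressing.2.1

theorem lie_cyc_dressing_snd : ⁅D.cyc D.Poly, D.dressing.2⁆ = 0 := D.isDressing.2.2.1

theorem fil_dressing_snd : D.Fil 0 D.dressing.2 := D.isDressing.2.2.2.1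

/-- The automorphism `e^{ad U(λ)}`. -/
def dress : Loop D.Poly 𝔤 ≃ₗ⁅LaurentSeries D.Poly⁆ Loop D.Poly 𝔤 where
  toFun X := D.expAd D.dressing.1 X
  map_add' X Y := expAd_add D.fil_dressing_fst X Y
  map_smul' f X := expAd_smul D.fil_dressing_fst f X
  map_lie' {X Y} := expAd_lie D.fil_dressing_fst X Y
  invFun X := D.expAd (-D.dressing.1) X
  left_inv X := expAd_neg_expAd D.fil_dressing_fst X
  right_inv X := expAd_expAd_neg D.fil_dressing_fst X

theorem fil_dress_sub {k : ℤ} {X : Loop D.Poly 𝔤} (hX : D.Fil k X) :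
    D.Fil k (D.dress X) := fil_expAd D.fil_dressing_fst hX

theorem W_eq_dress : D.W = D.dress (D.cyc D.Poly + D.dressing.2) := by
  have h : D.expAd (-D.dressing.1) D.W = D.cyc D.Poly + D.dressing.2 :=
    D.isDressing.2.2.2.2.expAd_eq
  rw [← h]
  exact (expAd_expAd_neg D.fil_dressing_fst D.W).symm

theorem ΛP_eq (a : Fin n) : D.ΛP a = D.lamA D.Poly a :=
  mapLoop_eq_loopMap D.e (Algebra.ofId ℂ D.Poly) (D.Λ a)

theorem R_eq_dress (a : Fin n) : D.R a = D.dress (D.lamA D.Poly a) := by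
  rw [R, ΛP_eq]
  rfl

theorem pair_dress (X Y : Loop D.Poly 𝔤) : D.pair (LaurentSeries D.Poly) (D.dress X) (D.dress Y) =
    D.pair (LaurentSeries D.Poly) X Y := by
  rw [pair_eq, pair_eq, kap, kap, LieAlgebra.killingForm_of_equiv_apply]

theorem lie_R_R (a b : Fin n) : ⁅D.R a, D.R b⁆ = 0 := by
  rw [R_eq_dress, R_eq_dress, ← LieEquiv.map_lie, lie_lamA_lamA, map_zero]

/-- Both elements are images under `e^{ad U}` of elements of the abelian centraliser of `Λ`. -/
theorem lie_W_R (a : Fin n) : ⁅D.W, D.R a⁆ = 0 := by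
  rw [W_eq_dress, R_eq_dress, ← LieEquiv.map_lie, add_lie, lie_cyc_lamA,
    D.lie_eq_zero_of_ker D.lie_cyc_dressing_snd (D.lie_cyc_lamA a), add_zero, map_zero]

theorem pair_R (a b : Fin n) : D.pair (LaurentSeries D.Poly) (D.R a) (D.R b) =
    algebraMap ℂ (LaurentSeries D.Poly) ((D.cox : ℂ) * eta a b) * spec D.Poly := by
  rw [R_eq_dress, R_eq_dress, pair_dress, pair_lamA]

/-- In `g⁻¹ δ g - δ` the derivatives of the scalars cancel, so it is a linear derivation of the
extended Lie algebra and hence inner. This replaces a formula for the derivative of the exponential.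
-/
theorem exists_deriv_dress (δ : Derivation ℂ (LaurentSeries D.Poly) (LaurentSeries D.Poly)) :
    ∃ Z : Loop D.Poly 𝔤, ∀ X, derivExt 𝔤 δ (D.dress X) =
      D.dress (derivExt 𝔤 δ X) + ⁅Z, D.dress X⁆ := by
  let T : Loop D.Poly 𝔤 →ₗ[LaurentSeries D.Poly] Loop D.Poly 𝔤 :=
    { toFun := fun X => D.dress.symm (derivExt 𝔤 δ (D.dress X)) - derivExt 𝔤 δ X
      map_add' := fun X Y => by simp only [map_add]; abel
      map_smul' := fun f X => by
        simp only [map_smul, derivExt_smul, map_add, LieEquiv.symm_apply_apply, RingHom.id_apply,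
          smul_sub]
        abel }
  obtain ⟨Z, hZ⟩ := exists_ad_eq_of_leibniz T fun X Y => by
    change D.dress.symm (derivExt 𝔤 δ (D.dress ⁅X, Y⁆)) - derivExt 𝔤 δ ⁅X, Y⁆ =
      ⁅D.dress.symm (derivExt 𝔤 δ (D.dress X)) - derivExt 𝔤 δ X, Y⁆ +
      ⁅X, D.dress.symm (derivExt 𝔤 δ (D.dress Y)) - derivExt 𝔤 δ Y⁆
    rw [LieEquiv.map_lie, derivExt_lie, derivExt_lie, map_add, LieEquiv.map_lie, LieEquiv.map_lie,
      LieEquiv.symm_apply_apply, LieEquiv.symm_apply_apply, sub_lie, lie_sub]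
    abel
  refine ⟨D.dress Z, fun X => ?_⟩
  have h : D.dress.symm (derivExt 𝔤 δ (D.dress X)) - derivExt 𝔤 δ X = ⁅Z, X⁆ := hZ X
  rw [← LieEquiv.map_lie, ← h, ← map_add, add_sub_cancel, LieEquiv.apply_symm_apply]

/-! ### Hamiltonians -/

/-- `(H(λ) | Λ_{m_a}(λ))` -/
def hamSeries (a : Fin n) : LaurentSeries D.Poly :=
  D.pair (LaurentSeries D.Poly) D.dressing.2 (D.lamA D.Poly a)

theorem coeff_hamSeries_of_neg (a : Fin n) {r : ℤ} (hr : r < 0) : (D.hamSeries a).coeff r = 0 := by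
  by_contra h
  have h1 := coeffIn_pair (U := fun k => k ≤ D.m a) D.fil_dressing_snd (D.deg_lamA a)
    (by rintro x _ hx rfl; omega) r h
  have h2 := D.m_lt a
  have h3 : D.cox * 1 ≤ D.cox * (-r) := mul_le_mul_of_nonneg_left (by omega) D.cox_pos.le
  rw [mul_neg] at h3
  omega

theorem dressing_snd_eq : D.dressing.2 = ∑ a, (algebraMap ℂ (LaurentSeries D.Poly) (D.cox : ℂ)⁻¹ *
    zvar D.Poly * D.hamSeries a.rev) • D.lamA D.Poly a :=
  (D.proj_eq_self _ D.lie_cyc_dressing_snd).symm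

theorem isHamiltonianSeries : D.IsHamiltonianSeries D.hamiltonianSeries := by
  have h : ∃ g, D.IsHamiltonianSeries g := by
    refine ⟨fun a => PowerSeries.mk fun k => (D.hamSeries a).coeff k, ?_⟩
    rw [IsHamiltonianSeries]
    conv_lhs => rw [dressing_snd_eq]
    refine Finset.sum_congr rfl fun a _ => ?_
    rw [ΛP_eq, zvar]
    congr 2
    apply laurent_ext
    intro r
    rw [PowerSeries.coeff_coe]
    split_ifs with hr
    · rw [D.coeff_hamSeries_of_neg _ hr]
    · rw [PowerSeries.coeff_mk, Int.natAbs_of_nonneg (not_lt.1 hr)]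
  rw [hamiltonianSeries, dif_pos h]
  exact h.choose_spec

/-- Pairing with `Λ_{m_a}` recovers the coefficients, so the chosen series of hamiltonians is
determined. -/
theorem hamSeries_eq (a : Fin n) :
    D.hamSeries a = HahnSeries.ofPowerSeries ℤ D.Poly (D.hamiltonianSeries a) := by
  have h := D.isHamiltonianSeries
  rw [IsHamiltonianSeries] at h
  rw [hamSeries, h, pair_sum_left, Finset.sum_eq_single a.rev]
  · rw [pair_smul_left, ΛP_eq, pair_lamA, Fin.rev_rev, eta, if_pos (Fin.rev_rev a).symm, mul_one]
    have e : algebraMap ℂ (LaurentSeries D.Poly) (D.cox : ℂ)⁻¹ *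
        algebraMap ℂ (LaurentSeries D.Poly) (D.cox : ℂ) = 1 := by
      rw [← map_mul, inv_mul_cancel₀ D.cox_ne_zero, map_one]
    have e' : HahnSeries.single (1 : ℤ) (1 : D.Poly) * spec D.Poly = 1 := zvar_mul_spec
    have hr : ∀ x y z F s : LaurentSeries D.Poly, x * z * F * (y * s) = F * ((x * y) * (z * s)) := by
      intros; ring
    rw [hr, e, e', mul_one, mul_one]
  · intro b _ hb
    rw [pair_smul_left, ΛP_eq, pair_lamA, eta, if_neg, mul_zero, map_zero, zero_mul, mul_zero]
    rintro rfl
    exact hb (Fin.rev_rev b).symm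
  · exact fun h => absurd (Finset.mem_univ _) h

theorem hamiltonian_eq (a : Fin n) (k : ℕ) :
    D.hamiltonian (a, k) = (D.hamSeries a).coeff ((k : ℤ) + 1) := by
  rw [hamSeries_eq, hamiltonian]
  exact (HahnSeries.ofPowerSeries_apply_coeff (Γ := ℤ) _ (k + 1)).symm

/-- `Λ` and the `Λ_{m_a}` are constant, so `δ (H | Λ_{m_a})` equals `(g δ(Λ + H) | R_a)`. The first
entry differs from `δW` by `[Z, W]`, which pairs to zero with `R_a` because `[W, R_a] = 0`. -/
theorem deriv_hamSeries (δ : Derivation ℂ D.Poly D.Poly) (a : Fin n) :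
    coeffDeriv δ (D.hamSeries a) =
      D.pair (LaurentSeries D.Poly) (derivExt 𝔤 (coeffDeriv δ) D.W) (D.R a) := by
  obtain ⟨Z, hZ⟩ := D.exists_deriv_dress (coeffDeriv δ)
  have hc : derivExt 𝔤 (coeffDeriv δ) (D.cyc D.Poly) = 0 := by
    rw [← D.loopMap_cyc (Algebra.ofId ℂ D.Poly), derivExt_loopMap_ofId]
  have h0 : ∀ X : Loop D.Poly 𝔤, D.pair (LaurentSeries D.Poly) X 0 = 0 := fun X => by
    have h := D.pair_smul_right (0 : LaurentSeries D.Poly) X 0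
    rwa [zero_smul, zero_mul] at h
  have hl : derivExt 𝔤 (coeffDeriv δ) (D.lamA D.Poly a) = 0 := derivExt_loopMap_ofId δ _
  rw [hamSeries, deriv_pair, hl, h0, add_zero]
  conv_rhs => rw [W_eq_dress, hZ, ← W_eq_dress, pair_add_left, pair_lie, lie_W_R, h0, add_zero,
    map_add, hc, zero_add, R_eq_dress, pair_dress]

/-! ### Dual bases -/

theorem gram_mul : ∃ e' : Fin N → 𝔤, (∀ i j, killingForm ℂ 𝔤 (e' i) (D.e j) = if j = i then 1 else 0) ∧
    ∀ i, D.dualVec i = D.nrm⁻¹ • e' i := by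
  obtain ⟨e', he'⟩ := exists_dual_family D.e
  refine ⟨e', he', fun i => ?_⟩
  have h : (Matrix.of fun i j => form₀ D.gen D.θ (D.e i) (D.e j))⁻¹ =
      Matrix.of fun i j => D.nrm⁻¹ * D.e.repr (e' i) j := by
    apply Matrix.inv_eq_left_inv
    ext i j
    rw [Matrix.mul_apply, Matrix.one_apply]
    have h1 : killingForm ℂ 𝔤 (e' i) (D.e j) =
        ∑ k, D.e.repr (e' i) k * killingForm ℂ 𝔤 (D.e k) (D.e j) := by
      conv_lhs => rw [← D.e.sum_repr (e' i), map_sum, LinearMap.sum_apply]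
      simp only [map_smul, LinearMap.smul_apply, smul_eq_mul]
    rw [he'] at h1
    simp only [Matrix.of_apply, form₀_eq]
    have h2 : ∀ k, D.nrm⁻¹ * D.e.repr (e' i) k * (D.nrm * killingForm ℂ 𝔤 (D.e k) (D.e j)) =
        D.e.repr (e' i) k * killingForm ℂ 𝔤 (D.e k) (D.e j) := by
      intro k
      have := D.nrm_ne_zero
      field_simp
    simp only [h2, ← h1, eq_comm]
  rw [dualVec, h]
  conv_rhs => rw [← D.e.sum_repr (e' i), Finset.smul_sum]
  simp only [Matrix.of_apply, smul_smul]

theorem form₀_dualVec (i j : Fin N) :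
    form₀ D.gen D.θ (D.dualVec i) (D.e j) = if j = i then 1 else 0 := by
  obtain ⟨e', he', h⟩ := D.gram_mul
  rw [h, form₀_eq, map_smul, LinearMap.smul_apply, he', smul_eq_mul, ← mul_assoc,
    mul_inv_cancel₀ D.nrm_ne_zero, one_mul]

theorem lie_rho_dualVec (i : Fin N) :
    ⁅(rho D.gen : 𝔤), D.dualVec i⁆ = ((-D.d i : ℤ) : ℂ) • D.dualVec i := by
  have hn := LieAlgebra.IsKilling.killingForm_nondegenerate ℂ 𝔤
  rw [← sub_eq_zero]
  refine hn.1 _ fun y => ?_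
  rw [← D.e.sum_repr y, map_sum]
  refine Finset.sum_eq_zero fun j _ => ?_
  have key : killingForm ℂ 𝔤 (⁅(rho D.gen : 𝔤), D.dualVec i⁆ -
      ((-D.d i : ℤ) : ℂ) • D.dualVec i) (D.e j) = 0 := by
    have h1 : killingForm ℂ 𝔤 ⁅(rho D.gen : 𝔤), D.dualVec i⁆ (D.e j) =
        -((D.d j : ℂ) * killingForm ℂ 𝔤 (D.dualVec i) (D.e j)) := by
      rw [← lie_skew, map_neg, LinearMap.neg_apply, LieModule.traceForm_apply_lie_apply,
        lie_rho_basis, map_smul, smul_eq_mul]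
    have h2 := D.form₀_dualVec i j
    rw [form₀_eq] at h2
    have h3 : killingForm ℂ 𝔤 (D.dualVec i) (D.e j) = if j = i then D.nrm⁻¹ else 0 := by
      have h4 : killingForm ℂ 𝔤 (D.dualVec i) (D.e j) =
          D.nrm⁻¹ * (D.nrm * killingForm ℂ 𝔤 (D.dualVec i) (D.e j)) := by
        rw [← mul_assoc, inv_mul_cancel₀ D.nrm_ne_zero, one_mul]
      rw [h4, h2]
      split_ifs <;> simp
    rw [map_sub, LinearMap.sub_apply, h1, map_smul, LinearMap.smul_apply, h3]
    split_ifs with h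
    · subst h; push_cast; simp
    · simp
  rw [map_smul, key, smul_zero]

section Pair

variable {K : Type*} [CommRing K] [Algebra ℂ K]

theorem pair_tmul (f g : K) (x y : 𝔤) : D.pair K (f ⊗ₜ x) (g ⊗ₜ y) =
    f * g * algebraMap ℂ K (form₀ D.gen D.θ x y) := by
  rw [pair_eq, kap_tmul, form₀_eq, map_mul]
  ring

theorem pair_dualVec (X : Ext K 𝔤) (j : Fin N) :
    D.pair K ((1 : K) ⊗ₜ D.dualVec j) X = (D.e.baseChange K).repr X j := by
  induction X using TensorProduct.induction_on with
  | zero =>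
    have h := D.pair_smul_right (0 : K) ((1 : K) ⊗ₜ D.dualVec j) 0
    rw [zero_smul, zero_mul] at h
    simp [h]
  | tmul f x =>
    rw [pair_tmul, one_mul, Module.Basis.baseChange_repr_tmul, Algebra.smul_def, mul_comm]
    congr 2
    conv_lhs => rw [← D.e.sum_repr x]
    simp only [form₀_eq, map_sum, map_smul, Finset.mul_sum, smul_eq_mul]
    have h : ∀ k, D.nrm * (D.e.repr x k * killingForm ℂ 𝔤 (D.dualVec j) (D.e k)) =
        D.e.repr x k * if k = j then 1 else 0 := by
      intro k
      rw [← D.form₀_dualVec, form₀_eq]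
      ring
    simp [h]
  | add X Y hX hY => rw [pair_add_right, hX, hY, map_add, Finsupp.add_apply]

theorem sum_pair_dualVec (X : Ext K 𝔤) :
    ∑ i, D.pair K ((1 : K) ⊗ₜ D.e i) X • ((1 : K) ⊗ₜ[ℂ] D.dualVec i) = X := by
  rw [← sub_eq_zero]
  apply eq_zero_of_kap
  intro Y
  rw [kap_eq_pair D, ← sum_repr_tmul D.e Y, pair_sum_right]
  have h : ∀ j, D.pair K (∑ i, D.pair K ((1 : K) ⊗ₜ D.e i) X • ((1 : K) ⊗ₜ[ℂ] D.dualVec i) - X)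
      ((D.e.baseChange K).repr Y j • ((1 : K) ⊗ₜ[ℂ] D.e j)) = 0 := by
    intro j
    rw [pair_smul_right, pair_sub_left, pair_sum_left]
    simp only [pair_smul_left, pair_tmul, form₀_dualVec, one_mul]
    rw [Finset.sum_eq_single j]
    · rw [if_pos rfl, map_one, mul_one, pair_comm, sub_self, mul_zero]
    · intro i _ hi
      rw [if_neg (Ne.symm hi), map_zero, mul_zero]
    · exact fun h => absurd (Finset.mem_univ _) h
  simp only [h, Finset.sum_const_zero, mul_zero]

end Pair

theorem form₀_lie_swap (x y z : 𝔤) : form₀ D.gen D.θ ⁅x, y⁆ z = -form₀ D.gen D.θ ⁅y, x⁆ z := by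
  rw [← lie_skew, form₀_eq, form₀_eq, map_neg, LinearMap.neg_apply, mul_neg]

theorem lie_rho_lie_dualVec (i j : Fin N) : ⁅(rho D.gen : 𝔤), ⁅D.dualVec i, D.dualVec j⁆⁆ =
    ((-D.d i - D.d j : ℤ) : ℂ) • ⁅D.dualVec i, D.dualVec j⁆ := by
  rw [leibniz_lie, lie_rho_dualVec, lie_rho_dualVec, smul_lie, lie_smul, ← add_smul]
  congr 1
  push_cast
  ring

theorem d_of_form₀_Fθ {i j : Fin N} (h : form₀ D.gen D.θ ⁅D.dualVec i, D.dualVec j⁆ D.Fθ ≠ 0) :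
    D.d i + D.d j = 1 - D.cox := by
  by_contra h0
  apply h
  rw [form₀_eq, D.killingForm_eq_zero (D.lie_rho_lie_dualVec i j) D.lie_rho_Fθ
    (by omega), mul_zero]

/-! ### The flows in zero curvature form -/

/-- The derivation `{·, v}` for a generator `v`. -/
def hamDeriv (w : D.Var) : Derivation ℂ D.Poly D.Poly :=
  MvPolynomial.mkDerivation ℂ fun v => D.genBracket v w

theorem flow_X (x : Fin n × ℕ) (w : D.Var) :
    D.flow x (MvPolynomial.X w) = D.hamDeriv w (D.hamiltonian x) := by
  rw [flow, poisson, MvPolynomial.mkDerivation_X]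
  rfl

/-- In the case `p, q ≤ 0` the index `p + q - 1` is negative, and `u^s(λ)` has no positive powers of
`λ`. -/
theorem divDiff_uCoeff (s : Fin N) (p q : ℤ) : divDiff (D.uCoeff s) p q =
    if 1 ≤ p ∧ 1 ≤ q then -D.uCoeff s (p + q - 1) else 0 := by
  unfold divDiff
  split_ifs with h1 h2
  · rfl
  · exact D.uCoeff_eq_zero (D.not_valid_of_neg s (by omega))
  · rfl

theorem coeff_hamDeriv_pos {j : Fin N} {q : ℤ} (hq : 1 ≤ q) (w : D.Var) (hw : w.1 = (j, q - 1))
    (i : Fin N) (p : ℤ) : D.hamDeriv w (D.uCoeff i p) =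
      -∑ s, D.structConst i j s • if 1 ≤ p then D.uCoeff s (p + q - 1) else 0 := by
  by_cases hv : D.d i ≤ D.cox * p
  · rw [D.uCoeff_eq_X hv, hamDeriv, MvPolynomial.mkDerivation_X, genBracket, hw, varOf_val]
    simp only [sub_add_cancel]
    rw [if_neg (by omega), add_zero, ← Finset.sum_neg_distrib]
    refine Finset.sum_congr rfl fun s _ => ?_
    rw [divDiff_uCoeff, MvPolynomial.smul_eq_C_mul]
    by_cases hp : 1 ≤ p
    · rw [if_pos ⟨hp, hq⟩, if_pos hp, mul_neg]
    · rw [if_neg (by tauto), if_neg hp, mul_zero, neg_zero]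
  · have hp : ¬ 1 ≤ p := fun h => hv (D.valid_of_pos i h)
    rw [D.uCoeff_eq_zero (not_le.1 hv), map_zero]
    simp [hp]

theorem coeff_hamDeriv_zero {j : Fin N} (w : D.Var) (hw : w.1 = (j, -1))
    (i : Fin N) (p : ℤ) : D.hamDeriv w (D.uCoeff i p) =
      if p = 0 then algebraMap ℂ D.Poly (form₀ D.gen D.θ ⁅D.dualVec i, D.dualVec j⁆ D.Fθ) else 0 := by
  by_cases hv : D.d i ≤ D.cox * p
  · rw [D.uCoeff_eq_X hv, hamDeriv, MvPolynomial.mkDerivation_X, genBracket, hw, varOf_val]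
    simp only [sub_add_cancel, neg_add_cancel, and_true]
    rw [Finset.sum_eq_zero, zero_add]
    · rfl
    · intro s _
      rw [divDiff_uCoeff, if_neg (by omega), mul_zero]
  · rw [D.uCoeff_eq_zero (not_le.1 hv), map_zero]
    split_ifs with hp
    · subst hp
      by_cases h : form₀ D.gen D.θ ⁅D.dualVec i, D.dualVec j⁆ D.Fθ = 0
      · rw [h, map_zero]
      · have h1 := D.d_of_form₀_Fθ h
        have h2 := D.neg_cox_lt_d j
        omega
    · rfl

/-- The components of the basic resolvent with respect to the dual basis. -/
def Rcomp (a : Fin n) (i : Fin N) : LaurentSeries D.Poly :=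
  D.pair (LaurentSeries D.Poly) (1 ⊗ₜ D.e i) (D.R a)

theorem flow_X_eq (a : Fin n) (k : ℕ) (w : D.Var) : D.flow (a, k) (MvPolynomial.X w) =
    ∑ i, (coeffDeriv (D.hamDeriv w) (D.uSeries i) * D.Rcomp a i).coeff ((k : ℤ) + 1) := by
  rw [flow_X, hamiltonian_eq, ← coeff_coeffDeriv, deriv_hamSeries]
  have h : derivExt 𝔤 (coeffDeriv (D.hamDeriv w)) D.W =
      ∑ i, coeffDeriv (D.hamDeriv w) (D.uSeries i) • ((1 : LaurentSeries D.Poly) ⊗ₜ[ℂ] D.e i) := by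
    have hc : derivExt 𝔤 (coeffDeriv (D.hamDeriv w)) (D.cyc D.Poly) = 0 := by
      rw [← D.loopMap_cyc (Algebra.ofId ℂ D.Poly), derivExt_loopMap_ofId]
    rw [← sub_add_cancel D.W (D.cyc D.Poly), map_add, hc, add_zero, W_sub_cyc, map_sum]
    refine Finset.sum_congr rfl fun i _ => ?_
    rw [derivExt_tmul, TensorProduct.smul_tmul', smul_eq_mul, mul_one]
  rw [h, pair_sum_left, HahnSeries.coeff_sum]
  simp only [pair_smul_left]
  rfl

/-- `λ^k` -/
def specPow (A : Type*) [CommRing A] (k : ℕ) : LaurentSeries A := HahnSeries.single (-(k : ℤ)) 1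

/-- The powers `z^r` with `p r` in `λ^k R_a(λ)`. -/
def Rpart (p : ℤ → Prop) (a : Fin n) (k : ℕ) : Loop D.Poly 𝔤 :=
  ∑ i, cut p (HahnSeries.single (-(k : ℤ)) (1 : D.Poly) * D.Rcomp a i) •
    ((1 : LaurentSeries D.Poly) ⊗ₜ[ℂ] D.dualVec i)

theorem Rpart_add_Rpart (p : ℤ → Prop) (a : Fin n) (k : ℕ) :
    D.Rpart p a k + D.Rpart (fun r => ¬ p r) a k =
      specPow D.Poly k • D.R a := by
  rw [Rpart, Rpart, ← Finset.sum_add_distrib]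
  simp only [← add_smul, cut_add_cut_not]
  conv_rhs => rw [← D.sum_pair_dualVec (D.R a), Finset.smul_sum]
  simp only [smul_smul]
  rfl

theorem pair_W (x : 𝔤) : D.pair (LaurentSeries D.Poly) (1 ⊗ₜ x) D.W =
    algebraMap ℂ _ (form₀ D.gen D.θ x (principalNilpotent D.gen)) +
    algebraMap ℂ _ (form₀ D.gen D.θ x D.Fθ) * spec D.Poly +
    ∑ s, algebraMap ℂ _ (form₀ D.gen D.θ x (D.e s)) * D.uSeries s := by
  rw [W, pair_add_right, pair_sum_right, cyclicElement, pair_add_right]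
  simp only [Ext.tmul, pair_tmul, one_mul, mul_one, mul_comm]

theorem repr_lie_Rpart (p : ℤ → Prop) (a : Fin n) (k : ℕ) (j : Fin N) :
    (D.e.baseChange (LaurentSeries D.Poly)).repr ⁅D.Rpart p a k, D.W⁆ j =
      -∑ i, cut p (HahnSeries.single (-(k : ℤ)) (1 : D.Poly) * D.Rcomp a i) *
        (algebraMap ℂ _ (form₀ D.gen D.θ ⁅D.dualVec i, D.dualVec j⁆ (principalNilpotent D.gen)) +
        algebraMap ℂ _ (form₀ D.gen D.θ ⁅D.dualVec i, D.dualVec j⁆ D.Fθ) * spec D.Poly +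
        ∑ s, algebraMap ℂ _ (D.structConst i j s) * D.uSeries s) := by
  rw [← pair_dualVec, ← pair_lie, Rpart, lie_sum, pair_sum_left, ← Finset.sum_neg_distrib]
  refine Finset.sum_congr rfl fun i _ => ?_
  rw [lie_smul, pair_smul_left, LieAlgebra.ExtendScalars.bracket_tmul, one_mul, ← mul_neg, pair_W]
  congr 1
  simp only [structConst]
  rw [D.form₀_lie_swap (D.dualVec j), D.form₀_lie_swap (D.dualVec j)]
  have hs : ∀ s, form₀ D.gen D.θ ⁅D.dualVec j, D.dualVec i⁆ (D.e s) =
      -form₀ D.gen D.θ ⁅D.dualVec i, D.dualVec j⁆ (D.e s) := fun s => D.form₀_lie_swap _ _ _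
  have hs' : ∑ s, algebraMap ℂ (LaurentSeries D.Poly)
      (form₀ D.gen D.θ ⁅D.dualVec j, D.dualVec i⁆ (D.e s)) * D.uSeries s =
      -∑ s, algebraMap ℂ (LaurentSeries D.Poly)
        (form₀ D.gen D.θ ⁅D.dualVec i, D.dualVec j⁆ (D.e s)) * D.uSeries s := by
    rw [← Finset.sum_neg_distrib]
    refine Finset.sum_congr rfl fun s _ => ?_
    rw [hs, map_neg]
    ring
  rw [hs', map_neg, map_neg]
  ring

theorem coeff_mul_algebraMap (f : LaurentSeries A) (c : ℂ) (r : ℤ) :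
    (f * algebraMap ℂ (LaurentSeries A) c).coeff r = c • f.coeff r := by
  rw [mul_comm, coeff_algebraMap_mul]

theorem coeff_mul_spec (f : LaurentSeries A) (r : ℤ) : (f * spec A).coeff r = f.coeff (r + 1) := by
  rw [mul_comm, spec, HahnSeries.coeff_single_mul, one_mul, sub_neg_eq_add]

theorem coeff_lie_Rpart (p : ℤ → Prop) (a : Fin n) (k : ℕ) (j : Fin N) (q : ℤ) :
    loopCoeff D.e j q ⁅D.Rpart p a k, D.W⁆ =
      -∑ i, (form₀ D.gen D.θ ⁅D.dualVec i, D.dualVec j⁆ (principalNilpotent D.gen) •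
          (cut p (HahnSeries.single (-(k : ℤ)) (1 : D.Poly) * D.Rcomp a i)).coeff q +
        form₀ D.gen D.θ ⁅D.dualVec i, D.dualVec j⁆ D.Fθ •
          (cut p (HahnSeries.single (-(k : ℤ)) (1 : D.Poly) * D.Rcomp a i)).coeff (q + 1) +
        ∑ s, D.structConst i j s •
          (cut p (HahnSeries.single (-(k : ℤ)) (1 : D.Poly) * D.Rcomp a i) *
            D.uSeries s).coeff q) := by
  rw [loopCoeff, repr_lie_Rpart, HahnSeries.coeff_neg, HahnSeries.coeff_sum]
  congr 1
  refine Finset.sum_congr rfl fun i _ => ?_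
  rw [mul_add, mul_add, HahnSeries.coeff_add, HahnSeries.coeff_add, coeff_mul_algebraMap,
    mul_left_comm, coeff_algebraMap_mul, coeff_mul_spec, Finset.mul_sum, HahnSeries.coeff_sum]
  simp only [mul_left_comm _ (algebraMap ℂ (LaurentSeries D.Poly) _), coeff_algebraMap_mul]

theorem lie_Rpart_eq_neg (p : ℤ → Prop) (a : Fin n) (k : ℕ) (X : Loop D.Poly 𝔤)
    (hX : ⁅D.R a, X⁆ = 0) :
    ⁅D.Rpart p a k, X⁆ = -⁅D.Rpart (fun r => ¬ p r) a k, X⁆ := by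
  rw [eq_neg_iff_add_eq_zero, ← add_lie, Rpart_add_Rpart, smul_lie, hX, smul_zero]

/-- Since `[R_a, W] = 0`, either half of `λ^k R_a` may be used. For `q ≥ 1` the half with `r ≤ 0`
has no coefficient at `q` and `q + 1`, so the terms from `Λ` drop out and the `u`-terms match the
bracket by `coeff_cut_mul_eq`. -/
theorem flow_uCoeff (a : Fin n) (k : ℕ) (j : Fin N) (q : ℤ) :
    D.flow (a, k) (D.uCoeff j q) = loopCoeff D.e j q ⁅D.Rpart (fun r => r ≤ 0) a k, D.W⁆ := by
  rcases le_or_gt 1 q with hq | hq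
  · rw [D.uCoeff_eq_X (D.valid_of_pos j hq), flow_X_eq, coeff_lie_Rpart, ← Finset.sum_neg_distrib]
    refine Finset.sum_congr rfl fun i _ => ?_
    rw [coeff_cut, coeff_cut, if_neg (by omega), if_neg (by omega), smul_zero, smul_zero, add_zero,
      zero_add]
    have h : coeffDeriv (D.hamDeriv (D.varOf (D.valid_of_pos j hq)))
        (D.uSeries i) = -∑ s, algebraMap ℂ _ (D.structConst i j s) *
          cut (fun r => 1 ≤ r) (HahnSeries.single (1 - q) (1 : D.Poly) * D.uSeries s) := by
      apply laurent_ext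
      intro p
      rw [coeff_coeffDeriv, coeff_uSeries, D.coeff_hamDeriv_pos hq _ rfl, HahnSeries.coeff_neg,
        HahnSeries.coeff_sum]
      congr 1
      refine Finset.sum_congr rfl fun s _ => ?_
      rw [coeff_algebraMap_mul, coeff_cut, HahnSeries.coeff_single_mul, coeff_uSeries, one_mul,
        show p - (1 - q) = p + q - 1 by ring]
      by_cases hp : 1 ≤ p <;> simp [hp]
    rw [h, neg_mul, HahnSeries.coeff_neg, Finset.sum_mul, HahnSeries.coeff_sum]
    congr 1
    refine Finset.sum_congr rfl fun s _ => ?_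
    rw [mul_assoc, coeff_algebraMap_mul, coeff_cut_mul_eq]
  -- For `q ≤ 0` use the other half: its powers of `z` start at `1` and those of `u^s` at `0`, so
  -- only the `E_{-θ}` term at `q = 0` survives, which is the constant term of the bracket.
  · rw [D.lie_Rpart_eq_neg _ a k D.W (by rw [← lie_skew, lie_W_R, neg_zero]), ← zero_sub,
      loopCoeff_sub, coeff_lie_Rpart]
    have hu : ∀ i s, (cut (fun r => ¬ r ≤ 0) (HahnSeries.single (-(k : ℤ)) (1 : D.Poly) *
        D.Rcomp a i) * D.uSeries s).coeff q = 0 := by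
      intro i s
      by_contra h
      obtain ⟨p, p', rfl, h1, h2⟩ := exists_of_coeff_mul_ne_zero h
      rw [coeff_cut] at h1
      rw [coeff_uSeries] at h2
      have h3 : ¬ p ≤ 0 := fun h => h1 (if_neg (not_not.2 h))
      have h4 : ¬ p' < 0 := fun h => h2 (D.uCoeff_eq_zero (D.not_valid_of_neg s h))
      omega
    have h0 : loopCoeff D.e j q (0 : Loop D.Poly 𝔤) = 0 := by simp [loopCoeff]
    simp only [hu, smul_zero, Finset.sum_const_zero, add_zero, coeff_cut, h0]
    rw [zero_sub, neg_neg]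
    by_cases hq0 : q = 0
    · subst hq0
      simp only [le_refl, not_true, if_false, smul_zero, zero_add]
      have e : ∀ i, (HahnSeries.single (-(k : ℤ)) (1 : D.Poly) * D.Rcomp a i).coeff 1 =
          (D.Rcomp a i).coeff ((k : ℤ) + 1) := by
        intro i
        rw [HahnSeries.coeff_single_mul, one_mul]
        congr 1
        ring
      simp only [e, show ¬ (1 : ℤ) ≤ 0 by omega, not_false_iff, if_true]
      by_cases hv : D.d j ≤ D.cox * 0
      · rw [D.uCoeff_eq_X hv, flow_X_eq]
        refine Finset.sum_congr rfl fun i _ => ?_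
        have h : coeffDeriv (D.hamDeriv (D.varOf hv)) (D.uSeries i) =
            algebraMap ℂ _ (form₀ D.gen D.θ ⁅D.dualVec i, D.dualVec j⁆ D.Fθ) := by
          apply laurent_ext
          intro p
          rw [coeff_coeffDeriv, coeff_uSeries, D.coeff_hamDeriv_zero _ rfl, coeff_algebraMap]
        rw [h, coeff_algebraMap_mul]
      · rw [D.uCoeff_eq_zero (not_le.1 hv), map_zero]
        symm
        refine Finset.sum_eq_zero fun i _ => ?_
        by_cases h : form₀ D.gen D.θ ⁅D.dualVec i, D.dualVec j⁆ D.Fθ = 0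
        · rw [h, zero_smul]
        · have h1 := D.d_of_form₀_Fθ h
          have h2 := D.neg_cox_lt_d i
          omega
    · rw [D.uCoeff_eq_zero (D.not_valid_of_neg j (by omega)), map_zero]
      symm
      refine Finset.sum_eq_zero fun i _ => ?_
      rw [if_neg (by omega), if_neg (by omega), smul_zero, smul_zero, add_zero]

theorem flow_W (a : Fin n) (k : ℕ) : derivExt 𝔤 (coeffDeriv (D.flow (a, k))) D.W =
    ⁅D.Rpart (fun r => r ≤ 0) a k, D.W⁆ := by
  have hc : derivExt 𝔤 (coeffDeriv (D.flow (a, k))) (D.cyc D.Poly) = 0 := by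
    rw [← D.loopMap_cyc (Algebra.ofId ℂ D.Poly), derivExt_loopMap_ofId]
  have h : derivExt 𝔤 (coeffDeriv (D.flow (a, k))) D.W =
      derivExt 𝔤 (coeffDeriv (D.flow (a, k))) (D.W - D.cyc D.Poly) := by
    rw [map_sub, hc, sub_zero]
  rw [h]
  apply (D.e.baseChange (LaurentSeries D.Poly)).repr.injective
  ext1 j
  apply laurent_ext
  intro q
  rw [repr_derivExt, coeff_coeffDeriv]
  have e : (D.e.baseChange (LaurentSeries D.Poly)).repr (D.W - D.cyc D.Poly) j = D.uSeries j := by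
    rw [W_sub_cyc, map_sum, Finsupp.coe_finsetSum, Finset.sum_apply]
    rw [Finset.sum_eq_single j]
    · rw [Module.Basis.baseChange_repr_tmul, D.e.repr_self, Finsupp.single_eq_same,
        Algebra.smul_def, map_one, one_mul]
    · intro i _ hi
      rw [Module.Basis.baseChange_repr_tmul, D.e.repr_self, Finsupp.single_eq_of_ne' hi,
        Algebra.smul_def, map_zero, zero_mul]
    · exact fun h => absurd (Finset.mem_univ _) h
  rw [e, coeff_uSeries, flow_uCoeff]
  rfl

/-- With `Z` from `exists_deriv_dress`, it suffices that `(λ^k R_a)_+ - Z` commutes with `R_b`.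
Undressed to `Y`, the equation for `W` reads `[Y, Λ + K] = δ K`, and the aim is to show that `Y`
lies in the kernel of `ad Λ`. -/
theorem flow_R (a : Fin n) (k : ℕ) (b : Fin n) : derivExt 𝔤 (coeffDeriv (D.flow (a, k))) (D.R b) =
    ⁅D.Rpart (fun r => r ≤ 0) a k, D.R b⁆ := by
  obtain ⟨Z, hZ⟩ := D.exists_deriv_dress (coeffDeriv (D.flow (a, k)))
  set δ := derivExt 𝔤 (coeffDeriv (D.flow (a, k)))
  have hc : δ (D.cyc D.Poly) = 0 := by
    rw [← D.loopMap_cyc (Algebra.ofId ℂ D.Poly)]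
    exact derivExt_loopMap_ofId _ _
  set Y := D.dress.symm (D.Rpart (fun r => r ≤ 0) a k - Z) with hY
  set K := D.dressing.2 with hK
  have hYd : D.dress Y = D.Rpart (fun r => r ≤ 0) a k - Z := LieEquiv.apply_symm_apply _ _
  have h1 : ⁅Y, D.cyc D.Poly + K⁆ = δ K := by
    refine D.dress.injective (?_ : D.dress _ = D.dress _)
    rw [LieEquiv.map_lie, hYd, ← W_eq_dress, sub_lie, ← flow_W, sub_eq_iff_eq_add]
    have := hZ (D.cyc D.Poly + K)
    rwa [← W_eq_dress, map_add, hc, zero_add] at this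
  have hKker : ⁅D.cyc D.Poly, K⁆ = 0 := D.lie_cyc_dressing_snd
  have hδK : ⁅D.cyc D.Poly, δ K⁆ = 0 := by
    have h := derivExt_lie (coeffDeriv (D.flow (a, k))) (D.cyc D.Poly) K
    rw [hKker, map_zero] at h
    change 0 = ⁅δ (D.cyc D.Poly), K⁆ + ⁅D.cyc D.Poly, δ K⁆ at h
    rw [hc, zero_lie, zero_add] at h
    exact h.symm
  set V := Y - D.proj D.Poly Y with hV
  have hVproj : D.proj D.Poly V = 0 := by rw [hV, map_sub, proj_proj, sub_self]
  have h2 : ⁅V, D.cyc D.Poly + K⁆ = δ K := by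
    have h3 : ⁅D.proj D.Poly Y, D.cyc D.Poly + K⁆ = 0 := by
      rw [lie_add, D.lie_eq_zero_of_ker (D.lie_cyc_proj Y) hKker, add_zero, ← lie_skew,
        lie_cyc_proj, neg_zero]
    rw [hV, sub_lie, h1, h3, sub_zero]
  have h4 : D.proj D.Poly ⁅V, K⁆ = 0 := by
    have h0 : ∀ X : Loop D.Poly 𝔤, D.pair (LaurentSeries D.Poly) X 0 = 0 := fun X => by
      have h := D.pair_smul_right (0 : LaurentSeries D.Poly) X 0
      rwa [zero_smul, zero_mul] at h
    simp only [proj_apply, pair_lie, D.lie_eq_zero_of_ker hKker (D.lie_cyc_lamA _), h0, mul_zero,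
      zero_smul, Finset.sum_const_zero]
  -- `δ K` lies in the kernel, while its projection vanishes by `h2` and `h4`; thus the flow
  -- preserves `K`.
  have h5 : δ K = 0 := by
    rw [← D.proj_eq_self _ hδK, ← h2, lie_add, map_add, h4, add_zero, ← lie_skew, map_neg,
      proj_lie_cyc, neg_zero]
  have h6 : ⁅D.cyc D.Poly, V⁆ = ⁅V, K⁆ := by
    rw [h5, lie_add, ← lie_skew V] at h2
    exact (neg_add_eq_zero.1 h2)
  -- `K` has degree at most `0`, so in `[Λ, V] = [V, K]` inverting `ad Λ` on the image improves any
  -- degree bound for `V` by one.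
  have hstep : ∀ l, D.Fil l V → D.Fil (l - 1) V := by
    intro l hl
    have h7 : D.Fil l ⁅D.cyc D.Poly, V⁆ := by
      rw [h6]
      simpa using hl.lie D.fil_dressing_snd
    have h8 := D.eq_proj_add ⁅D.cyc D.Poly, V⁆
    rw [proj_lie_cyc, zero_add] at h8
    have h9 : V = ⁅D.cyc D.Poly, D.sect D.Poly ⁅D.cyc D.Poly, V⁆⁆ := by
      have h10 : ⁅D.cyc D.Poly, V - ⁅D.cyc D.Poly, D.sect D.Poly ⁅D.cyc D.Poly, V⁆⁆⁆ = 0 := by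
        rw [lie_sub, ← h8, sub_self]
      have h11 := D.proj_eq_self _ h10
      rw [map_sub, hVproj, proj_lie_cyc, sub_zero] at h11
      exact sub_eq_zero.1 h11.symm
    rw [h9]
    exact (D.fil_cyc.lie h7.sect).mono (by omega)
  obtain ⟨l, hl⟩ := D.exists_deg_le V
  have hVzero : V = 0 := by
    refine eq_zero_of_fil (D := D) l fun i => ?_
    induction i with
    | zero => simpa using (show D.Fil l V from hl)
    | succ i ih => exact (hstep _ ih).mono (by push_cast; omega)
  have hYker : ⁅D.cyc D.Poly, Y⁆ = 0 := by
    rw [sub_eq_zero.1 (hV.symm.trans hVzero)]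
    exact D.lie_cyc_proj Y
  have h12 : ⁅D.Rpart (fun r => r ≤ 0) a k - Z, D.R b⁆ = 0 := by
    rw [← hYd, R_eq_dress, ← LieEquiv.map_lie, D.lie_eq_zero_of_ker hYker (D.lie_cyc_lamA b),
      map_zero]
  have hl : δ (D.lamA D.Poly b) = 0 := derivExt_loopMap_ofId _ _
  rw [sub_lie] at h12
  have := hZ (D.lamA D.Poly b)
  rw [hl, map_zero, zero_add, ← R_eq_dress] at this
  rw [this, sub_eq_zero.1 h12]

end Data

/-! ### Substitution of a variable -/

section Substitution

variable {A : Type*} [CommRing A] {m : ℕ}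

/-- `p(X_i)` -/
def ev (A : Type*) [CommRing A] {m : ℕ} (i : Fin m) : PowerSeries A →+* MvPowerSeries (Fin m) A :=
  (PowerSeries.substAlgHom (R := A) (PowerSeries.HasSubst.X (S := A) i)).toRingHom

theorem coeff_ev_eq (i : Fin m) (p : PowerSeries A) (J : Fin m →₀ ℕ) :
    MvPowerSeries.coeff J (ev A i p) =
      if J = Finsupp.single i (J i) then PowerSeries.coeff (J i) p else 0 := by
  classical
  change MvPowerSeries.coeff J (PowerSeries.substAlgHom (PowerSeries.HasSubst.X (S := A) i) p) = _
  rw [PowerSeries.coe_substAlgHom, PowerSeries.coeff_subst (PowerSeries.HasSubst.X (S := A) i),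
    finsum_eq_single _ (J i)]
  · rw [MvPowerSeries.coeff_X_pow]
    split_ifs <;> simp
  · intro k hk
    rw [MvPowerSeries.coeff_X_pow, if_neg, smul_zero]
    intro h
    apply hk
    rw [h, Finsupp.single_eq_same]

theorem eq_single_iff (i : Fin m) (J : Fin m →₀ ℕ) :
    J = Finsupp.single i (J i) ↔ ∀ l, l ≠ i → J l = 0 := by
  classical
  constructor
  · intro h l hl
    rw [h, Finsupp.single_eq_of_ne hl]
  · intro h
    ext l
    by_cases hl : l = i
    · rw [hl, Finsupp.single_eq_same]
    · rw [h l hl, Finsupp.single_eq_of_ne hl]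

open Classical in
theorem coeff_ev (i : Fin m) (p : PowerSeries A) (J : Fin m →₀ ℕ) :
    MvPowerSeries.coeff J (ev A i p) =
      if ∀ l, l ≠ i → J l = 0 then PowerSeries.coeff (J i) p else 0 := by
  rw [coeff_ev_eq]
  simp only [eq_single_iff]

theorem coeff_X_mul (i : Fin m) (f : MvPowerSeries (Fin m) A) (J : Fin m →₀ ℕ) :
    MvPowerSeries.coeff J (MvPowerSeries.X i * f) =
      if J i = 0 then 0 else MvPowerSeries.coeff (J - Finsupp.single i 1) f := by
  rw [MvPowerSeries.X, MvPowerSeries.coeff_monomial_mul, one_mul]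
  have h : Finsupp.single i 1 ≤ J ↔ ¬ J i = 0 := by
    rw [Finsupp.single_le_iff]
    omega
  by_cases hJ : J i = 0
  · rw [if_pos hJ, if_neg (by rw [h]; exact not_not.2 hJ)]
  · rw [if_neg hJ, if_pos (h.2 hJ)]

theorem ev_X (i : Fin m) : ev A i PowerSeries.X = MvPowerSeries.X i := by
  change (PowerSeries.substAlgHom (PowerSeries.HasSubst.X (S := A) i)) PowerSeries.X = _
  rw [PowerSeries.coe_substAlgHom, PowerSeries.subst_X (PowerSeries.HasSubst.X i)]

theorem ev_C (i : Fin m) (a : A) : ev A i (PowerSeries.C a) = MvPowerSeries.C a :=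
  (PowerSeries.substAlgHom (R := A) (PowerSeries.HasSubst.X (S := A) i)).commutes a

open Classical in
/-- The divided difference `(p(X_i) - p(X_c)) / (X_i - X_c)`. -/
def divDiffSeries (i c : Fin m) (p : PowerSeries A) : MvPowerSeries (Fin m) A :=
  fun J => if ∀ l, l ≠ i → l ≠ c → J l = 0 then PowerSeries.coeff (J i + J c + 1) p else 0

open Classical in
theorem coeff_divDiffSeries (i c : Fin m) (p : PowerSeries A) (J : Fin m →₀ ℕ) :
    MvPowerSeries.coeff J (divDiffSeries i c p) =
      if ∀ l, l ≠ i → l ≠ c → J l = 0 then PowerSeries.coeff (J i + J c + 1) p else 0 := rfl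

open Classical in
/-- The remainder of the second order Taylor expansion of `p(X_i)` at `X_c`, divided by
`(X_i - X_c)²`. -/
def taylorRemainder (i c : Fin m) (p : PowerSeries A) : MvPowerSeries (Fin m) A :=
  fun J => if ∀ l, l ≠ i → l ≠ c → J l = 0 then
    PowerSeries.coeff (J i + J c + 2) p * ((J c : A) + 1) else 0

open Classical in
theorem coeff_taylorRemainder (i c : Fin m) (p : PowerSeries A) (J : Fin m →₀ ℕ) :
    MvPowerSeries.coeff J (taylorRemainder i c p) =
      if ∀ l, l ≠ i → l ≠ c → J l = 0 then
        PowerSeries.coeff (J i + J c + 2) p * ((J c : A) + 1) else 0 := rfl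

theorem forall_ne_iff {i c : Fin m} (J : Fin m →₀ ℕ) :
    (∀ l, l ≠ i → J l = 0) ↔ (∀ l, l ≠ i → l ≠ c → J l = 0) ∧ (c ≠ i → J c = 0) := by
  constructor
  · exact fun h => ⟨fun l hl _ => h l hl, fun hc => h c hc⟩
  · rintro ⟨h1, h2⟩ l hl
    by_cases hc : l = c
    · subst hc; exact h2 hl
    · exact h1 l hl hc

theorem sub_single_forall {i c : Fin m} (J : Fin m →₀ ℕ) {s : Fin m} (hs : s = i ∨ s = c) :
    (∀ l, l ≠ i → l ≠ c → (J - Finsupp.single s 1 : Fin m →₀ ℕ) l = 0) ↔ ∀ l, l ≠ i → l ≠ c → J l = 0 := by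
  classical
  refine forall_congr' fun l => imp_congr_right fun hi => imp_congr_right fun hc => ?_
  rw [Finsupp.tsub_apply, Finsupp.single_eq_of_ne (by rintro rfl; tauto), Nat.sub_zero]

theorem sub_mul_divDiffSeries {i c : Fin m} (hic : i ≠ c) (p : PowerSeries A) :
    (MvPowerSeries.X i - MvPowerSeries.X c) * divDiffSeries i c p = ev A i p - ev A c p := by
  classical
  ext J
  rw [sub_mul, map_sub, map_sub, coeff_X_mul, coeff_X_mul, coeff_divDiffSeries, coeff_divDiffSeries,
    coeff_ev, coeff_ev]
  have hcomm : (∀ l, l ≠ c → l ≠ i → J l = 0) ↔ ∀ l, l ≠ i → l ≠ c → J l = 0 :=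
    forall_congr' fun l => by tauto
  simp only [sub_single_forall J (s := i) (Or.inl rfl), sub_single_forall J (s := c) (Or.inr rfl)]
  simp only [forall_ne_iff (i := i) (c := c) J, forall_ne_iff (i := c) (c := i) J, hcomm]
  simp only [Finsupp.tsub_apply, Finsupp.single_eq_same, Finsupp.single_eq_of_ne hic,
    Finsupp.single_eq_of_ne hic.symm, Nat.sub_zero]
  by_cases hJ : ∀ l, l ≠ i → l ≠ c → J l = 0
  · have hJ' := eq_true hJ
    simp only [hJ', if_true, hic, hic.symm, ne_eq, not_false_iff, true_implies, true_and]
    by_cases h1 : J i = 0 <;> by_cases h2 : J c = 0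
    · simp [h1, h2]
    · have e : J c - 1 + 1 = J c := by omega
      simp [h1, h2, e]
    · have e : J i - 1 + 0 + 1 = J i := by omega
      simp [h1, h2, e]
    · have e : J i - 1 + J c + 1 = J i + (J c - 1) + 1 := by omega
      simp [h1, h2, e]
  · simp [hJ]

theorem sub_mul_taylorRemainder {i c : Fin m} (hic : i ≠ c) (p : PowerSeries A) :
    (MvPowerSeries.X i - MvPowerSeries.X c) * taylorRemainder i c p =
      divDiffSeries i c p - ev A c (PowerSeries.derivative A p) := by
  classical
  ext J
  rw [sub_mul, map_sub, map_sub, coeff_X_mul, coeff_X_mul, coeff_taylorRemainder,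
    coeff_taylorRemainder, coeff_divDiffSeries, coeff_ev]
  have hcomm : (∀ l, l ≠ c → l ≠ i → J l = 0) ↔ ∀ l, l ≠ i → l ≠ c → J l = 0 :=
    forall_congr' fun l => by tauto
  simp only [sub_single_forall J (s := i) (Or.inl rfl), sub_single_forall J (s := c) (Or.inr rfl)]
  simp only [forall_ne_iff (i := c) (c := i) J, hcomm, PowerSeries.coeff_derivative]
  simp only [Finsupp.tsub_apply, Finsupp.single_eq_same, Finsupp.single_eq_of_ne hic,
    Finsupp.single_eq_of_ne hic.symm, Nat.sub_zero]
  by_cases hJ : ∀ l, l ≠ i → l ≠ c → J l = 0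
  · have hJ' := eq_true hJ
    simp only [hJ', if_true, hic, ne_eq, not_false_iff, true_implies, true_and]
    by_cases h1 : J i = 0 <;> by_cases h2 : J c = 0
    · simp [h1, h2]
    · have e : J c - 1 + 2 = J c + 1 := by omega
      have e2 : ((J c - 1 : ℕ) : A) + 1 = J c := by
        rw [← Nat.cast_succ]
        congr 1
        omega
      simp [h1, h2, e, e2]
      ring
    · have e : J i - 1 + 0 + 2 = J i + 0 + 1 := by omega
      simp [h1, h2, e]
    · have e : J i - 1 + J c + 2 = J i + J c + 1 := by omega
      have e' : J i + (J c - 1) + 2 = J i + J c + 1 := by omega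
      have e2 : ((J c - 1 : ℕ) : A) + 1 = J c := by
        rw [← Nat.cast_succ]
        congr 1
        omega
      simp [h1, h2, e, e', e2]
      ring
  · simp [hJ]

/-- Makes the division by the squared difference in the definition of `ω` explicit within power
series. -/
theorem ev_taylor {i c : Fin m} (hic : i ≠ c) (p : PowerSeries A) :
    ev A i p = ev A c p + (MvPowerSeries.X i - MvPowerSeries.X c) *
      ev A c (PowerSeries.derivative A p) +
      (MvPowerSeries.X i - MvPowerSeries.X c) ^ 2 * taylorRemainder i c p := by
  have h1 := sub_mul_divDiffSeries hic p
  have h2 := sub_mul_taylorRemainder hic p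
  rw [pow_two, mul_assoc, h2]
  linear_combination -h1

variable [IsDomain A]

theorem substLam_ofPowerSeries (i : Fin m) (p : PowerSeries A) :
    substLam A i (HahnSeries.ofPowerSeries ℤ A p) = algebraMap _ (GenField A m) (ev A i p) :=
  IsLocalization.Away.lift_eq (PowerSeries.X : PowerSeries A) (isUnit_subst_X A i) p

theorem algebraMap_X_ne_zero (i : Fin m) :
    algebraMap (MvPowerSeries (Fin m) A) (GenField A m) (MvPowerSeries.X i) ≠ 0 := by
  have h := (isUnit_subst_X A i).ne_zero
  change algebraMap (MvPowerSeries (Fin m) A) (GenField A m) (ev A i PowerSeries.X) ≠ 0 at h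
  rwa [ev_X] at h

theorem substLam_spec (i : Fin m) : substLam A i (spec A) = lam A i := by
  rw [lam]
  apply eq_inv_of_mul_eq_one_left
  rw [← ev_X, ← substLam_ofPowerSeries, ← map_mul, HahnSeries.ofPowerSeries_X, mul_comm]
  have h : HahnSeries.single (1 : ℤ) (1 : A) * spec A = 1 := by
    rw [spec, HahnSeries.single_mul_single]
    simp
  rw [h, map_one]

end Substitution

/-! ### Evaluation at `λ_i` and existence of the `τ`-structure -/

section Evaluation

variable {𝔤 : Type*} [LieRing 𝔤] [LieAlgebra ℂ 𝔤] [FiniteDimensional ℂ 𝔤]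
  [LieAlgebra.IsSimple ℂ 𝔤] {H : LieSubalgebra ℂ 𝔤} [H.IsCartanSubalgebra] {n N : ℕ}
  {A : Type*} [CommRing A] [IsDomain A] [Algebra ℂ A] {m : ℕ}

theorem algebraMap_C_eq (c : ℂ) : algebraMap (MvPowerSeries (Fin m) A) (GenField A m)
    (MvPowerSeries.C (algebraMap ℂ A c)) = algebraMap ℂ (GenField A m) c := by
  rw [IsScalarTower.algebraMap_apply ℂ (MvPowerSeries (Fin m) A) (GenField A m),
    MvPowerSeries.algebraMap_apply]

/-- The substitution `λ = λᵢ` as an algebra homomorphism. -/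
def substAlg (A : Type*) [CommRing A] [IsDomain A] [Algebra ℂ A] {m : ℕ} (i : Fin m) :
    LaurentSeries A →ₐ[ℂ] GenField A m :=
  { substLam A i with
    commutes' := fun c => by
      change substLam A i (algebraMap ℂ (LaurentSeries A) c) = _
      have h : algebraMap ℂ (LaurentSeries A) c =
          HahnSeries.ofPowerSeries ℤ A (PowerSeries.C (algebraMap ℂ A c)) := by
        rw [algebraMap_laurent, HahnSeries.ofPowerSeries_C]
      rw [h, substLam_ofPowerSeries, ev_C, algebraMap_C_eq] }

namespace Data

variable (D : Data H n N)

theorem evalAt_eq_rTensor (i : Fin m) (X : Loop A 𝔤) :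
    D.evalAt i X = LinearMap.rTensor 𝔤 (substAlg A i).toLinearMap X :=
  mapCoord_eq_rTensor D.e (substAlg A i).toLinearMap X

theorem repr_evalAt (i : Fin m) (X : Loop A 𝔤) (j : Fin N) :
    (D.e.baseChange (GenField A m)).repr (D.evalAt i X) j =
      substLam A i ((D.e.baseChange (LaurentSeries A)).repr X j) := by
  rw [evalAt_eq_rTensor]
  exact repr_rTensor D.e (substAlg A i).toLinearMap X j

theorem pair_expand {K : Type*} [CommRing K] [Algebra ℂ K] (X Y : Ext K 𝔤) :
    D.pair K X Y = ∑ i, ∑ j, algebraMap ℂ K (form₀ D.gen D.θ (D.e i) (D.e j)) *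
      (D.e.baseChange K).repr X i * (D.e.baseChange K).repr Y j := by
  rw [pair_eq, kap_expand D.e, Finset.mul_sum]
  refine Finset.sum_congr rfl fun i _ => ?_
  rw [Finset.mul_sum]
  refine Finset.sum_congr rfl fun j _ => ?_
  rw [form₀_eq, map_mul]
  ring

theorem repr_lie_rho {K : Type*} [CommRing K] [Algebra ℂ K] (X : Ext K 𝔤) (j : Fin N) :
    (D.e.baseChange K).repr ⁅((1 : K) ⊗ₜ[ℂ] (rho D.gen : 𝔤) : Ext K 𝔤), X⁆ j =
      algebraMap ℂ K (D.d j) * (D.e.baseChange K).repr X j := by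
  rw [← pair_dualVec, ← pair_lie, LieAlgebra.ExtendScalars.bracket_tmul, ← lie_skew,
    lie_rho_dualVec, ← neg_smul, ← pair_dualVec, mul_one, TensorProduct.tmul_smul,
    ← algebraMap_smul K, pair_smul_left]
  congr 2
  push_cast
  ring

/-! ### The basic resolvents as power series -/

theorem fil_R (a : Fin n) : D.Fil (D.m a) (D.R a) := by
  rw [R_eq_dress]
  exact D.fil_dress_sub ((D.deg_lamA a).mono fun k hk => hk.le)

/-- The bounds `d_j - h r ≤ m_a < h` and `d_j > -h` force `r > -2`. -/
theorem coeff_repr_R_eq_zero (a : Fin n) (j : Fin N) {r : ℤ} (hr : r < -1) :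
    ((D.e.baseChange (LaurentSeries D.Poly)).repr (D.R a) j).coeff r = 0 := by
  by_contra h
  have h1 : D.d j - D.cox * r ≤ D.m a := D.fil_R a j r h
  have h2 := D.m_lt a
  have h3 := D.neg_cox_lt_d j
  have h4 : D.cox * r ≤ D.cox * (-2) := mul_le_mul_of_nonneg_left (by omega) D.cox_pos.le
  linarith

/-- The power series `λ⁻¹ R_a(λ)`, in coordinates. -/
def resSeries (a : Fin n) (j : Fin N) : PowerSeries D.Poly := PowerSeries.mk fun k =>
  ((D.e.baseChange (LaurentSeries D.Poly)).repr (D.R a) j).coeff ((k : ℤ) - 1)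

theorem coeff_ofPowerSeries (f : PowerSeries A) (r : ℤ) :
    (HahnSeries.ofPowerSeries ℤ A f).coeff r =
      if r < 0 then 0 else PowerSeries.coeff r.natAbs f := PowerSeries.coeff_coe f r

theorem repr_R (a : Fin n) (j : Fin N) :
    (D.e.baseChange (LaurentSeries D.Poly)).repr (D.R a) j =
      spec D.Poly * HahnSeries.ofPowerSeries ℤ D.Poly (D.resSeries a j) := by
  apply laurent_ext
  intro r
  rw [mul_comm, coeff_mul_spec, coeff_ofPowerSeries]
  split_ifs with h
  · exact D.coeff_repr_R_eq_zero a j (by omega)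
  · rw [resSeries, PowerSeries.coeff_mk, Int.natAbs_of_nonneg (not_lt.1 h), add_sub_cancel_right]

/-- `resSeries` is `z R_a`, `laurentDeriv 0 1` is `z d/dz`, and `d/dz (z R_a) = R_a + z dR_a/dz`. -/
theorem ofPowerSeries_derivative_resSeries (a : Fin n) (j : Fin N) :
    HahnSeries.ofPowerSeries ℤ D.Poly (PowerSeries.derivative D.Poly (D.resSeries a j)) =
      (D.e.baseChange (LaurentSeries D.Poly)).repr (D.R a + derivExt 𝔤 (laurentDeriv 0 1) (D.R a)) j := by
  rw [map_add, Finsupp.add_apply, repr_derivExt]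
  apply laurent_ext
  intro r
  rw [HahnSeries.coeff_add, coeff_laurentDeriv, coeff_ofPowerSeries, Derivation.zero_apply,
    zero_add, one_mul]
  split_ifs with h
  · rcases eq_or_ne r (-1) with rfl | hr
    · simp
    · rw [D.coeff_repr_R_eq_zero a j (by omega), smul_zero, add_zero]
  · rw [PowerSeries.coeff_derivative, resSeries, PowerSeries.coeff_mk]
    obtain ⟨k, rfl⟩ := Int.eq_ofNat_of_zero_le (not_lt.1 h)
    rw [Int.natAbs_natCast, Nat.cast_succ, add_sub_cancel_right, Algebra.smul_def]
    push_cast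
    ring

/-- Euler's identity: the principal degree is the eigenvalue of `ad ρ + h λ d/dλ`, and `λ d/dλ = -z
d/dz`. -/
theorem cox_smul_deriv_lamA (a : Fin n) :
    algebraMap ℂ (LaurentSeries A) D.cox • derivExt 𝔤 (laurentDeriv 0 1) (D.lamA A a) =
      ⁅((1 : LaurentSeries A) ⊗ₜ[ℂ] (rho D.gen : 𝔤) : Loop A 𝔤), D.lamA A a⁆ -
        algebraMap ℂ (LaurentSeries A) (D.m a) • D.lamA A a := by
  apply (D.e.baseChange (LaurentSeries A)).repr.injective
  ext j : 1
  rw [map_sub, map_smul, map_smul, Finsupp.sub_apply, Finsupp.smul_apply, Finsupp.smul_apply,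
    repr_derivExt, repr_lie_rho, smul_eq_mul, smul_eq_mul]
  apply laurent_ext
  intro r
  rw [HahnSeries.coeff_sub, coeff_algebraMap_mul, coeff_algebraMap_mul, coeff_algebraMap_mul,
    coeff_laurentDeriv, Derivation.zero_apply, zero_add, one_mul, smul_smul, ← sub_smul]
  by_cases h : ((D.e.baseChange (LaurentSeries A)).repr (D.lamA A a) j).coeff r = 0
  · rw [h, smul_zero, smul_zero]
  · have h1 : D.d j - D.cox * r = D.m a := D.deg_lamA a j r h
    congr 1
    have h2 : ((D.d j - D.cox * r : ℤ) : ℂ) = ((D.m a : ℤ) : ℂ) := by rw [h1]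
    push_cast at h2
    rw [← h2]
    ring

/-- In Euler's identity the term `([ρ, Λ_{m_a}] | Λ_{m_b}) = (ρ | [Λ_{m_a}, Λ_{m_b}])` vanishes. -/
theorem pair_deriv_lamA (a b : Fin n) :
    D.pair (LaurentSeries A) (derivExt 𝔤 (laurentDeriv 0 1) (D.lamA A a)) (D.lamA A b) =
      algebraMap ℂ (LaurentSeries A) (-(D.m a) * eta a b) * spec A := by
  have hc := D.cox_ne_zero
  have h := congrArg (fun X => D.pair (LaurentSeries A) X (D.lamA A b)) (D.cox_smul_deriv_lamA (A := A) a)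
  simp only [pair_smul_left, pair_sub_left, pair_lie, lie_lamA_lamA, pair_lamA] at h
  have h0 : ∀ X : Loop A 𝔤, D.pair (LaurentSeries A) X 0 = 0 := fun X => by
    have := D.pair_smul_right (0 : LaurentSeries A) X 0
    rwa [zero_smul, zero_mul] at this
  rw [h0, zero_sub] at h
  have h2 := congrArg (fun f => algebraMap ℂ (LaurentSeries A) (D.cox : ℂ)⁻¹ * f) h
  simp only [← mul_assoc, ← map_mul, ← neg_mul, ← map_neg] at h2
  rw [inv_mul_cancel₀ hc, map_one, one_mul] at h2
  rw [h2]
  congr 2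
  field_simp

/-- Dressing changes the derivative by a commutator `[Z, R_a]`, invisible to `R_b` because `[R_a,
R_b] = 0`. -/
theorem pair_deriv_R (a b : Fin n) :
    D.pair (LaurentSeries D.Poly) (derivExt 𝔤 (laurentDeriv 0 1) (D.R a)) (D.R b) =
      algebraMap ℂ (LaurentSeries D.Poly) (-(D.m a) * eta a b) * spec D.Poly := by
  obtain ⟨Z, hZ⟩ := D.exists_deriv_dress (laurentDeriv 0 1)
  have h0 : ∀ X : Loop D.Poly 𝔤, D.pair (LaurentSeries D.Poly) X 0 = 0 := fun X => by
    have := D.pair_smul_right (0 : LaurentSeries D.Poly) X 0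
    rwa [zero_smul, zero_mul] at this
  rw [R_eq_dress, hZ, pair_add_left, ← R_eq_dress, pair_lie, lie_R_R, h0, add_zero, R_eq_dress,
    pair_dress, pair_deriv_lamA]

theorem sum_resSeries (a b : Fin n) :
    ∑ i, ∑ j, PowerSeries.C (algebraMap ℂ D.Poly (form₀ D.gen D.θ (D.e i) (D.e j))) *
      D.resSeries a i * D.resSeries b j =
      PowerSeries.C (algebraMap ℂ D.Poly ((D.cox : ℂ) * eta a b)) * PowerSeries.X := by
  apply HahnSeries.ofPowerSeries_injective (Γ := ℤ)
  have h := D.pair_R a b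
  rw [pair_expand] at h
  have h1 : zvar D.Poly * spec D.Poly = 1 := zvar_mul_spec
  have h2 := congrArg (fun f => zvar D.Poly * zvar D.Poly * f) h
  simp only [repr_R] at h2
  simp only [map_sum, map_mul, HahnSeries.ofPowerSeries_C, ← algebraMap_laurent,
    HahnSeries.ofPowerSeries_X]
  simp only [← map_mul]
  refine Eq.trans ?_ (h2.trans ?_)
  · rw [Finset.mul_sum]
    refine Finset.sum_congr rfl fun i _ => ?_
    rw [Finset.mul_sum]
    refine Finset.sum_congr rfl fun j _ => ?_
    linear_combination -(zvar D.Poly * spec D.Poly + 1) *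
      (algebraMap ℂ (LaurentSeries D.Poly) (form₀ D.gen D.θ (D.e i) (D.e j)) *
      HahnSeries.ofPowerSeries ℤ D.Poly (D.resSeries a i) *
      HahnSeries.ofPowerSeries ℤ D.Poly (D.resSeries b j)) * h1
  · change _ = algebraMap ℂ (LaurentSeries D.Poly) ((D.cox : ℂ) * eta a b) * zvar D.Poly
    linear_combination zvar D.Poly * algebraMap ℂ (LaurentSeries D.Poly) ((D.cox : ℂ) * eta a b) * h1

theorem sum_derivative_resSeries (a b : Fin n) :
    ∑ i, ∑ j, PowerSeries.C (algebraMap ℂ D.Poly (form₀ D.gen D.θ (D.e i) (D.e j))) *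
      PowerSeries.derivative D.Poly (D.resSeries a i) * D.resSeries b j =
      PowerSeries.C (algebraMap ℂ D.Poly ((D.m b : ℂ) * eta a b)) := by
  apply HahnSeries.ofPowerSeries_injective (Γ := ℤ)
  have h := D.pair_add_left (D.R a) (derivExt 𝔤 (laurentDeriv 0 1) (D.R a)) (D.R b)
  have hm : ((D.m b : ℂ) * eta a b) = (D.cox : ℂ) * eta a b + -(D.m a : ℂ) * eta a b := by
    by_cases hab : b = a.rev
    · have := D.m_add_m_rev a
      have h2 : (((D.m a : ℤ) + D.m a.rev : ℤ) : ℂ) = D.cox := by rw [this]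
      push_cast at h2
      rw [← h2, hab]
      ring
    · rw [eta, if_neg hab]
      ring
  rw [pair_deriv_R, pair_R, pair_expand, ← add_mul, ← map_add, ← hm] at h
  have h1 : zvar D.Poly * spec D.Poly = 1 := zvar_mul_spec
  have h2 := congrArg (fun f => zvar D.Poly * f) h
  simp only [repr_R D b, ← ofPowerSeries_derivative_resSeries] at h2
  simp only [map_sum, map_mul, HahnSeries.ofPowerSeries_C, ← algebraMap_laurent]
  simp only [← map_mul]
  refine Eq.trans ?_ (h2.trans ?_)
  · rw [Finset.mul_sum]
    refine Finset.sum_congr rfl fun i _ => ?_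
    rw [Finset.mul_sum]
    refine Finset.sum_congr rfl fun j _ => ?_
    linear_combination -(algebraMap ℂ (LaurentSeries D.Poly) (form₀ D.gen D.θ (D.e i) (D.e j)) *
      HahnSeries.ofPowerSeries ℤ D.Poly (PowerSeries.derivative D.Poly (D.resSeries a i)) *
      HahnSeries.ofPowerSeries ℤ D.Poly (D.resSeries b j)) * h1
  · linear_combination algebraMap ℂ (LaurentSeries D.Poly) ((D.m b : ℂ) * eta a b) * h1

/-- The generating series of the `τ`-structure. -/
def tauSeries (a b : Fin n) : MvPowerSeries (Fin 2) D.Poly :=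
  ∑ i, ∑ j, MvPowerSeries.C (algebraMap ℂ D.Poly (form₀ D.gen D.θ (D.e i) (D.e j))) *
    taylorRemainder 0 1 (D.resSeries a i) * ev D.Poly 1 (D.resSeries b j)

/-- Taylor expansion in `X_0` at `X_1`, with value `h η X_1` and slope `m_b η`. As `h = m_a + m_b`
where `η ≠ 0`, they add up to `η (m_b X_0 + m_a X_1)`, so the numerator of `ω` is divisible by `(λ -
μ)²`. -/
theorem sum_ev_resSeries (a b : Fin n) :
    ∑ i, ∑ j, MvPowerSeries.C (algebraMap ℂ D.Poly (form₀ D.gen D.θ (D.e i) (D.e j))) *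
      ev D.Poly (0 : Fin 2) (D.resSeries a i) * ev D.Poly 1 (D.resSeries b j) =
      MvPowerSeries.C (algebraMap ℂ D.Poly (eta a b)) *
        (MvPowerSeries.C (algebraMap ℂ D.Poly (D.m b)) * MvPowerSeries.X 0 +
          MvPowerSeries.C (algebraMap ℂ D.Poly (D.m a)) * MvPowerSeries.X 1) +
      (MvPowerSeries.X 0 - MvPowerSeries.X 1) ^ 2 * D.tauSeries a b := by
  have h1 := congrArg (ev D.Poly (1 : Fin 2)) (D.sum_resSeries a b)
  have h2 := congrArg (ev D.Poly (1 : Fin 2)) (D.sum_derivative_resSeries a b)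
  simp only [map_sum, map_mul, ev_C, ev_X] at h1 h2
  have hm : MvPowerSeries.C (σ := Fin 2) (algebraMap ℂ D.Poly (D.cox : ℂ)) *
      MvPowerSeries.C (algebraMap ℂ D.Poly (eta a b)) =
      (MvPowerSeries.C (algebraMap ℂ D.Poly (D.m a)) +
        MvPowerSeries.C (algebraMap ℂ D.Poly (D.m b))) *
        MvPowerSeries.C (algebraMap ℂ D.Poly (eta a b)) := by
    rw [← map_mul, ← map_mul, ← map_add, ← map_add, ← map_mul, ← map_mul]
    congr 2
    by_cases hab : b = a.rev
    · have := D.m_add_m_rev a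
      have h2 : (((D.m a : ℤ) + D.m a.rev : ℤ) : ℂ) = D.cox := by rw [this]
      push_cast at h2
      rw [← h2, hab]
    · rw [eta, if_neg hab]
      ring
  have h3 : ∑ i, ∑ j, MvPowerSeries.C (algebraMap ℂ D.Poly (form₀ D.gen D.θ (D.e i) (D.e j))) *
      ev D.Poly (0 : Fin 2) (D.resSeries a i) * ev D.Poly 1 (D.resSeries b j) =
      (∑ i, ∑ j, MvPowerSeries.C (algebraMap ℂ D.Poly (form₀ D.gen D.θ (D.e i) (D.e j))) *
        ev D.Poly (1 : Fin 2) (D.resSeries a i) * ev D.Poly 1 (D.resSeries b j)) +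
      (MvPowerSeries.X 0 - MvPowerSeries.X 1) *
      (∑ i, ∑ j, MvPowerSeries.C (algebraMap ℂ D.Poly (form₀ D.gen D.θ (D.e i) (D.e j))) *
        ev D.Poly (1 : Fin 2) (PowerSeries.derivative D.Poly (D.resSeries a i)) *
          ev D.Poly 1 (D.resSeries b j)) +
      (MvPowerSeries.X 0 - MvPowerSeries.X 1) ^ 2 * D.tauSeries a b := by
    rw [tauSeries, Finset.mul_sum, Finset.mul_sum, ← Finset.sum_add_distrib,
      ← Finset.sum_add_distrib]
    refine Finset.sum_congr rfl fun i _ => ?_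
    rw [Finset.mul_sum, Finset.mul_sum, ← Finset.sum_add_distrib,
      ← Finset.sum_add_distrib]
    refine Finset.sum_congr rfl fun j _ => ?_
    rw [ev_taylor (show (0 : Fin 2) ≠ 1 by decide) (D.resSeries a i)]
    ring
  rw [h3, h1, h2]
  linear_combination MvPowerSeries.X 1 * hm

theorem lam_mul_X (i : Fin m) :
    lam A i * algebraMap (MvPowerSeries (Fin m) A) (GenField A m) (MvPowerSeries.X i) = 1 :=
  inv_mul_cancel₀ (algebraMap_X_ne_zero i)

theorem lam_sub_ne_zero {i j : Fin m} (h : i ≠ j) : lam A i - lam A j ≠ 0 := by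
  classical
  intro h0
  have h1 := inv_injective (sub_eq_zero.1 h0)
  have h2 := IsFractionRing.injective (MvPowerSeries (Fin m) A) (GenField A m) h1
  have h3 := congrArg (MvPowerSeries.coeff (Finsupp.single i 1)) h2
  rw [MvPowerSeries.coeff_index_single_self_X, MvPowerSeries.coeff_index_single_X, if_neg h] at h3
  exact one_ne_zero h3

theorem substLam_repr_R (i : Fin m) (a : Fin n) (j : Fin N) :
    substLam D.Poly i ((D.e.baseChange (LaurentSeries D.Poly)).repr (D.R a) j) =
      lam D.Poly i * algebraMap _ (GenField D.Poly m) (ev D.Poly i (D.resSeries a j)) := by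
  rw [repr_R, map_mul, substLam_spec, substLam_ofPowerSeries]

theorem form_evalAt (s t : Fin m) (a b : Fin n) :
    form D.gen D.θ (GenField D.Poly m) (D.evalAt s (D.R a)) (D.evalAt t (D.R b)) =
      lam D.Poly s * lam D.Poly t * algebraMap _ (GenField D.Poly m)
      (∑ i, ∑ j, MvPowerSeries.C (algebraMap ℂ D.Poly (form₀ D.gen D.θ (D.e i) (D.e j))) *
        ev D.Poly s (D.resSeries a i) * ev D.Poly t (D.resSeries b j)) := by
  change D.pair _ _ _ = _
  rw [pair_expand, map_sum, Finset.mul_sum]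
  refine Finset.sum_congr rfl fun i _ => ?_
  rw [map_sum, Finset.mul_sum]
  refine Finset.sum_congr rfl fun j _ => ?_
  rw [repr_evalAt, repr_evalAt, substLam_repr_R, substLam_repr_R, map_mul, map_mul, algebraMap_C_eq]
  ring

theorem tau_identity {K : Type*} [Field K] {x y l k c p r q : K} (hx : l * x = 1) (hy : k * y = 1)
    (h0 : l - k ≠ 0) :
    x * y * q = l * k * (c * (r * x + p * y) + (x - y) ^ 2 * q) / (l - k) ^ 2 -
      c * (p * l + r * k) / (l - k) ^ 2 := by
  rw [← sub_div, eq_div_iff (pow_ne_zero 2 h0)]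
  have hx0 : x ≠ 0 := right_ne_zero_of_mul_eq_one hx
  have hy0 : y ≠ 0 := right_ne_zero_of_mul_eq_one hy
  obtain rfl : l = x⁻¹ := eq_inv_of_mul_eq_one_left hx
  obtain rfl : k = y⁻¹ := eq_inv_of_mul_eq_one_left hy
  field_simp
  ring

theorem tauSeries_spec (a b : Fin n) :
    algebraMap _ (GenField D.Poly 2) (MvPowerSeries.X 0 * MvPowerSeries.X 1 * D.tauSeries a b) =
    form D.gen D.θ (GenField D.Poly 2) (D.evalAt 0 (D.R a)) (D.evalAt 1 (D.R b)) /
        (lam D.Poly 0 - lam D.Poly 1) ^ 2 -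
      D.etaTerm a b (lam D.Poly (0 : Fin 2)) (lam D.Poly 1) := by
  have h0 := lam_sub_ne_zero (A := D.Poly) (show (0 : Fin 2) ≠ 1 by decide)
  have hx := lam_mul_X (A := D.Poly) (0 : Fin 2)
  have hy := lam_mul_X (A := D.Poly) (1 : Fin 2)
  rw [form_evalAt, sum_ev_resSeries, etaTerm]
  simp only [map_add, map_sub, map_mul, map_pow, algebraMap_C_eq]
  rw [map_natCast, map_natCast]
  exact tau_identity hx hy h0

theorem genSeries_eq {A : Type*} [CommRing A] {m : ℕ} (a : Fin m → Fin n)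
    (w : (Fin m → Fin n × ℕ) → A) (f : MvPowerSeries (Fin m) A)
    (h : ∀ k, MvPowerSeries.coeff k f = w fun i => (a i, k i)) :
    genSeries a w = algebraMap (MvPowerSeries (Fin m) A) (GenField A m)
      ((∏ i, MvPowerSeries.X i) * f) := by
  have e : (show MvPowerSeries (Fin m) A from fun k : Fin m →₀ ℕ => w fun i => (a i, k i)) = f :=
    funext fun k => (h k).symm
  rw [genSeries, e]

theorem isTauStructure : D.IsTauStructure D.tauStructure := by
  have h : ∃ ω, D.IsTauStructure ω := by
    refine ⟨fun x y => MvPowerSeries.coeff (Finsupp.single 0 x.2 + Finsupp.single 1 y.2)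
      (D.tauSeries x.1 y.1), fun a b => ?_⟩
    rw [← tauSeries_spec, genSeries_eq _ _ (D.tauSeries a b), Fin.prod_univ_two]
    intro k
    have hk : k = Finsupp.single 0 (k 0) + Finsupp.single 1 (k 1) := by
      ext i
      fin_cases i <;> simp
    exact congrArg (fun J => MvPowerSeries.coeff J (D.tauSeries a b)) hk
  rw [tauStructure, dif_pos h]
  exact h.choose_spec

end Data
end Evaluation

/-! ### Generating derivations -/

section GeneratingDerivation

variable {A : Type*} [CommRing A] {m : ℕ}

theorem eq_zero_of_X_pow_dvd (c : Fin m) {f : MvPowerSeries (Fin m) A}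
    (h : ∀ k : ℕ, MvPowerSeries.X c ^ k ∣ f) : f = 0 := by
  ext J
  exact MvPowerSeries.X_pow_dvd_iff.1 (h (J c + 1)) J (Nat.lt_succ_self _)

/-- The sum of `X_c^k f_k` over all `k`, as a function of the sequence `f`. -/
def seriesSumFun (c : Fin m) (f : ℕ → MvPowerSeries (Fin m) A) : MvPowerSeries (Fin m) A :=
  fun J => MvPowerSeries.coeff J (∑ k ∈ Finset.range (J c + 1), MvPowerSeries.X c ^ k * f k)

theorem coeff_seriesSumFun (c : Fin m) (f : ℕ → MvPowerSeries (Fin m) A) (J : Fin m →₀ ℕ) :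
    MvPowerSeries.coeff J (seriesSumFun c f) =
      MvPowerSeries.coeff J (∑ k ∈ Finset.range (J c + 1), MvPowerSeries.X c ^ k * f k) := rfl

theorem X_pow_dvd_seriesSumFun_sub (c : Fin m) (f : ℕ → MvPowerSeries (Fin m) A) (K : ℕ) :
    MvPowerSeries.X c ^ K ∣
      seriesSumFun c f - ∑ k ∈ Finset.range K, MvPowerSeries.X c ^ k * f k := by
  rw [MvPowerSeries.X_pow_dvd_iff]
  intro J hJ
  rw [map_sub, coeff_seriesSumFun, map_sum, map_sum, sub_eq_zero]
  refine Finset.sum_subset (Finset.range_subset_range.2 hJ) fun k _ hk => ?_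
  exact MvPowerSeries.X_pow_dvd_iff.1 (dvd_mul_right _ _) J (by simpa using hk)

/-- A series is determined modulo all powers of `X_c`, so linearity of the infinite sum can be
checked on partial sums. -/
theorem seriesSumFun_eq (c : Fin m) {f : ℕ → MvPowerSeries (Fin m) A} {g : MvPowerSeries (Fin m) A}
    (h : ∀ K, MvPowerSeries.X c ^ K ∣
      g - ∑ k ∈ Finset.range K, MvPowerSeries.X c ^ k * f k) : seriesSumFun c f = g := by
  rw [← sub_eq_zero]
  refine eq_zero_of_X_pow_dvd c fun K => ?_
  have := dvd_sub (X_pow_dvd_seriesSumFun_sub c f K) (h K)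
  rwa [sub_sub_sub_cancel_right] at this

/-- The sum of `X_c^k f_k` over all `k`. -/
def seriesSum (A : Type*) [CommRing A] {m : ℕ} (c : Fin m) :
    (ℕ → MvPowerSeries (Fin m) A) →ₗ[MvPowerSeries (Fin m) A] MvPowerSeries (Fin m) A where
  toFun := seriesSumFun c
  map_add' f g := by
    refine seriesSumFun_eq c fun K => ?_
    have := dvd_add (X_pow_dvd_seriesSumFun_sub c f K) (X_pow_dvd_seriesSumFun_sub c g K)
    simp only [Pi.add_apply, mul_add, Finset.sum_add_distrib]
    rwa [add_sub_add_comm]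
  map_smul' r f := by
    refine seriesSumFun_eq c fun K => ?_
    have := (X_pow_dvd_seriesSumFun_sub c f K).mul_left r
    simp only [Pi.smul_apply, smul_eq_mul, mul_left_comm _ r, ← Finset.mul_sum, RingHom.id_apply]
    rwa [← mul_sub]

open Classical in
theorem coeff_seriesSum_ev {i c : Fin m} (hic : i ≠ c) (q : ℕ → PowerSeries A) (J : Fin m →₀ ℕ) :
    MvPowerSeries.coeff J (seriesSum A c fun k => ev A i (q k)) =
      if ∀ l, l ≠ i → l ≠ c → J l = 0 then PowerSeries.coeff (J i) (q (J c)) else 0 := by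
  change MvPowerSeries.coeff J (seriesSumFun c fun k => ev A i (q k)) = _
  rw [coeff_seriesSumFun, map_sum, Finset.sum_eq_single (J c)]
  · rw [MvPowerSeries.X_pow_eq, MvPowerSeries.coeff_monomial_mul,
      if_pos (by rw [Finsupp.single_le_iff]), one_mul, coeff_ev]
    simp only [Finsupp.tsub_apply, Finsupp.single_eq_of_ne hic, Nat.sub_zero]
    refine if_congr (forall_congr' fun l => ⟨fun h hi hc => ?_, fun h hi => ?_⟩) rfl rfl
    · have := h hi
      rwa [Finsupp.single_eq_of_ne hc, Nat.sub_zero] at this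
    · by_cases hc : l = c
      · rw [hc, Finsupp.single_eq_same, Nat.sub_self]
      · rw [h hi hc, Nat.zero_sub]
  · intro k hk hne
    rw [MvPowerSeries.X_pow_eq, MvPowerSeries.coeff_monomial_mul]
    split_ifs with h
    · rw [one_mul, coeff_ev, if_neg]
      intro h0
      have h1 := h0 c hic.symm
      rw [Finsupp.tsub_apply, Finsupp.single_eq_same] at h1
      rw [Finset.mem_range] at hk
      omega
    · rfl
  · intro h
    simp at h

variable [Algebra ℂ A]

/-- A derivation of the coefficients, applied coefficient by coefficient, as a function. -/
def mvDerivFun {σ : Type*} (δ : Derivation ℂ A A) (f : MvPowerSeries σ A) : MvPowerSeries σ A :=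
  fun J => δ (MvPowerSeries.coeff J f)

theorem coeff_mvDerivFun {σ : Type*} (δ : Derivation ℂ A A) (f : MvPowerSeries σ A) (J : σ →₀ ℕ) :
    MvPowerSeries.coeff J (mvDerivFun δ f) = δ (MvPowerSeries.coeff J f) := rfl

/-- A derivation of the coefficients, applied coefficient by coefficient. -/
def mvDeriv {σ : Type*} (δ : Derivation ℂ A A) :
    Derivation ℂ (MvPowerSeries σ A) (MvPowerSeries σ A) :=
  derivationOfLeibniz (K := MvPowerSeries σ A) (mvDerivFun δ)
    (fun f g => by
      ext J
      simp only [coeff_mvDerivFun, map_add])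
    (fun c f => by
      ext J
      have h : ∀ g : MvPowerSeries σ A, MvPowerSeries.coeff J
          (algebraMap ℂ (MvPowerSeries σ A) c * g) = c • MvPowerSeries.coeff J g := fun g => by
        rw [MvPowerSeries.algebraMap_apply, MvPowerSeries.coeff_C_mul, Algebra.smul_def]
      rw [h, coeff_mvDerivFun, coeff_mvDerivFun, h, Derivation.map_smul])
    (fun f g => by
      classical
      ext J
      rw [mul_comm g, map_add, MvPowerSeries.coeff_mul, MvPowerSeries.coeff_mul,
        ← Finset.sum_add_distrib, coeff_mvDerivFun, MvPowerSeries.coeff_mul, map_sum]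
      refine Finset.sum_congr rfl fun p _ => ?_
      rw [Derivation.leibniz, smul_eq_mul, smul_eq_mul, mul_comm (MvPowerSeries.coeff p.2 g),
        coeff_mvDerivFun, coeff_mvDerivFun])

theorem coeff_mvDeriv {σ : Type*} (δ : Derivation ℂ A A) (f : MvPowerSeries σ A) (J : σ →₀ ℕ) :
    MvPowerSeries.coeff J (mvDeriv δ f) = δ (MvPowerSeries.coeff J f) := rfl

theorem mvDeriv_ev (δ : Derivation ℂ A A) (i : Fin m) (p : PowerSeries A) :
    mvDeriv δ (ev A i p) = ev A i (PowerSeries.mk fun k => δ (PowerSeries.coeff k p)) := by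
  classical
  ext J
  rw [coeff_mvDeriv, coeff_ev, coeff_ev, PowerSeries.coeff_mk, apply_ite δ, map_zero]

theorem mvDeriv_X {σ : Type*} (δ : Derivation ℂ A A) (i : σ) :
    mvDeriv δ (MvPowerSeries.X i : MvPowerSeries σ A) = 0 := by
  classical
  ext J
  rw [coeff_mvDeriv, MvPowerSeries.coeff_X, apply_ite δ, map_zero, Derivation.map_one_eq_zero,
    ite_self, map_zero]

/-- The derivation `∑ X_c^k δ_k`. -/
def nabla (δ : ℕ → Derivation ℂ A A) (c : Fin m) :
    Derivation ℂ (MvPowerSeries (Fin m) A) (MvPowerSeries (Fin m) A) :=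
  derivationOfLeibniz (K := MvPowerSeries (Fin m) A)
    (fun f => seriesSum A c fun k => mvDeriv (δ k) f)
    (fun f g => by
      rw [← map_add]
      congr 1
      funext k
      exact map_add _ _ _)
    (fun a f => by
      rw [← smul_eq_mul (algebraMap ℂ _ a) (seriesSum A c _), ← map_smul]
      congr 1
      funext k
      rw [Derivation.leibniz, Derivation.map_algebraMap, smul_zero, add_zero]
      rfl)
    (fun f g => by
      have h : ∀ (r : MvPowerSeries (Fin m) A) (q : ℕ → MvPowerSeries (Fin m) A),
          r * seriesSum A c q = seriesSum A c (r • q) := fun r q => (map_smul _ r q).symm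
      rw [h, h, ← map_add]
      congr 1
      funext k
      exact Derivation.leibniz _ _ _)

theorem nabla_apply (δ : ℕ → Derivation ℂ A A) (c : Fin m) (f : MvPowerSeries (Fin m) A) :
    nabla δ c f = seriesSum A c fun k => mvDeriv (δ k) f := rfl

theorem nabla_X (δ : ℕ → Derivation ℂ A A) (c i : Fin m) :
    nabla δ c (MvPowerSeries.X i) = 0 := by
  rw [nabla_apply]
  simp only [mvDeriv_X]
  exact map_zero (seriesSum A c)

theorem nabla_ev (δ : ℕ → Derivation ℂ A A) (c i : Fin m) (p : PowerSeries A) :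
    nabla δ c (ev A i p) = seriesSum A c fun k =>
      ev A i (PowerSeries.mk fun l => δ k (PowerSeries.coeff l p)) := by
  rw [nabla_apply]
  simp only [mvDeriv_ev]

/-- When `f` does not involve `X_c`, the summand `k = J c` is the only one that reaches `J`. -/
theorem coeff_nabla_of_forall (δ : ℕ → Derivation ℂ A A) (c : Fin m) (f : MvPowerSeries (Fin m) A)
    (hf : ∀ J, J c ≠ 0 → MvPowerSeries.coeff J f = 0) (J : Fin m →₀ ℕ) :
    MvPowerSeries.coeff J (nabla δ c f) = δ (J c) (MvPowerSeries.coeff (J.erase c) f) := by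
  classical
  change MvPowerSeries.coeff J (seriesSumFun c fun k => mvDeriv (δ k) f) = _
  rw [coeff_seriesSumFun, map_sum, Finset.sum_eq_single (J c)]
  · rw [MvPowerSeries.X_pow_eq, MvPowerSeries.coeff_monomial_mul,
      if_pos (by rw [Finsupp.single_le_iff]), one_mul, coeff_mvDeriv]
    have e : J - Finsupp.single c (J c) = J.erase c := by
      ext l
      by_cases hl : l = c
      · rw [hl]; simp
      · rw [Finsupp.tsub_apply, Finsupp.single_eq_of_ne hl, Finsupp.erase_ne hl, Nat.sub_zero]
    rw [e]
  · intro k hk hne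
    rw [MvPowerSeries.X_pow_eq, MvPowerSeries.coeff_monomial_mul]
    split_ifs with h
    · rw [one_mul, coeff_mvDeriv, hf, map_zero]
      rw [Finsupp.tsub_apply, Finsupp.single_eq_same]
      rw [Finset.mem_range] at hk
      omega
    · rfl
  · intro h
    simp at h

end GeneratingDerivation

/-! ### Extension of derivations to the fraction field -/

section FractionField

variable {R : Type*} [CommRing R] [IsDomain R] [Algebra ℂ R]

/-- The homomorphism `f ↦ f + ε δ f` to the dual numbers over the fraction field. -/
def dualHom (δ : Derivation ℂ R R) : R →+* TrivSqZeroExt (FractionRing R) (FractionRing R) where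
  toFun f := TrivSqZeroExt.inl (algebraMap R (FractionRing R) f) +
    TrivSqZeroExt.inr (algebraMap R (FractionRing R) (δ f))
  map_one' := by ext <;> simp
  map_zero' := by ext <;> simp
  map_add' f g := by
    ext
    · simp
    · simp only [TrivSqZeroExt.snd_add, TrivSqZeroExt.snd_inl, TrivSqZeroExt.snd_inr, map_add,
        zero_add]
  map_mul' f g := by
    ext
    · simp
    · simp only [TrivSqZeroExt.snd_add, TrivSqZeroExt.snd_inl, TrivSqZeroExt.snd_inr, map_add,
        zero_add, TrivSqZeroExt.snd_mul, TrivSqZeroExt.fst_add, TrivSqZeroExt.fst_inl,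
        TrivSqZeroExt.fst_inr, add_zero, Derivation.leibniz, smul_eq_mul, map_mul,
        MulOpposite.smul_eq_mul_unop, MulOpposite.unop_op]
      ring

theorem snd_dualHom (δ : Derivation ℂ R R) (f : R) :
    (dualHom δ f).snd = algebraMap R (FractionRing R) (δ f) := by
  change (TrivSqZeroExt.inl (algebraMap R (FractionRing R) f) +
    TrivSqZeroExt.inr (algebraMap R (FractionRing R) (δ f))).snd = _
  rw [TrivSqZeroExt.snd_add, TrivSqZeroExt.snd_inl, TrivSqZeroExt.snd_inr, zero_add]

/-- A dual number is invertible as soon as its first component is; the universal property of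
localisation then extends `f + ε δ f`, and with it `δ`. -/
theorem dualHom_isUnit (δ : Derivation ℂ R R) (y : nonZeroDivisors R) : IsUnit (dualHom δ y) := by
  rw [TrivSqZeroExt.isUnit_iff_isUnit_fst]
  simp [dualHom]

/-- The extension of `dualHom` to the fraction field. -/
def dualHomFrac (δ : Derivation ℂ R R) :
    FractionRing R →+* TrivSqZeroExt (FractionRing R) (FractionRing R) :=
  IsLocalization.lift (M := nonZeroDivisors R) (dualHom_isUnit δ)

theorem dualHomFrac_algebraMap (δ : Derivation ℂ R R) (f : R) :
    dualHomFrac δ (algebraMap R (FractionRing R) f) = dualHom δ f :=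
  IsLocalization.lift_eq (dualHom_isUnit δ) f

theorem fst_dualHomFrac (δ : Derivation ℂ R R) (x : FractionRing R) :
    (dualHomFrac δ x).fst = x := by
  have h : ((TrivSqZeroExt.fstHom ℂ (FractionRing R) (FractionRing R)).toRingHom.comp
      (dualHomFrac δ)) = RingHom.id _ := by
    apply IsLocalization.ringHom_ext (nonZeroDivisors R)
    ext f
    change (dualHomFrac δ (algebraMap R (FractionRing R) f)).fst = algebraMap R (FractionRing R) f
    rw [dualHomFrac_algebraMap]
    simp [dualHom]
  exact congrArg (fun g => g x) h

/-- The extension of a derivation to the fraction field. -/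
def fracDeriv (δ : Derivation ℂ R R) : Derivation ℂ (FractionRing R) (FractionRing R) :=
  derivationOfLeibniz (fun x => (dualHomFrac δ x).snd)
    (fun x y => by rw [map_add, TrivSqZeroExt.snd_add])
    (fun c x => by
      have h : (dualHomFrac δ (algebraMap ℂ (FractionRing R) c)).snd = 0 := by
        rw [IsScalarTower.algebraMap_apply ℂ R (FractionRing R), dualHomFrac_algebraMap]
        simp [dualHom]
      rw [map_mul, TrivSqZeroExt.snd_mul, h, fst_dualHomFrac]
      simp)
    (fun x y => by
      rw [map_mul, TrivSqZeroExt.snd_mul, fst_dualHomFrac, fst_dualHomFrac]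
      simp [mul_comm])

theorem fracDeriv_algebraMap (δ : Derivation ℂ R R) (f : R) :
    fracDeriv δ (algebraMap R (FractionRing R) f) = algebraMap R (FractionRing R) (δ f) := by
  change (dualHomFrac δ (algebraMap R (FractionRing R) f)).snd = _
  rw [dualHomFrac_algebraMap, snd_dualHom]

end FractionField

/-! ### Cyclic products of matrices -/

section Paths

variable {K : Type*} [Field K] {N : ℕ} {ι : Type*}
  (A : ι → Matrix (Fin N) (Fin N) K) (v : ι → K)

/-- The product of the matrices along a list of indices, divided by the product of the differences
of successive parameters on the path from `x` to `y` through the list. -/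
def pathProd : ι → List ι → ι → Matrix (Fin N) (Fin N) K
  | x, [], y => (v x - v y)⁻¹ • (1 : Matrix (Fin N) (Fin N) K)
  | x, s :: q, y => (v x - v s)⁻¹ • (A s * pathProd s q y)

theorem pathProd_nil (x y : ι) :
    pathProd A v x [] y = (v x - v y)⁻¹ • (1 : Matrix (Fin N) (Fin N) K) := rfl

theorem pathProd_cons (x s y : ι) (q : List ι) :
    pathProd A v x (s :: q) y = (v x - v s)⁻¹ • (A s * pathProd A v s q y) := rfl

/-- The sum over the cycles which start at `x` and run through the elements of `l`. -/
def cycleSum (x : ι) (l : List ι) : K :=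
  (l.permutations'.map fun q => (A x * pathProd A v x q x).trace).sum

variable [Algebra ℂ K] (δ : Derivation ℂ K K)

theorem map_deriv_mul (X Y : Matrix (Fin N) (Fin N) K) :
    (X * Y).map δ = X.map δ * Y + X * Y.map δ := by
  ext i j
  simp only [Matrix.map_apply, Matrix.mul_apply, Matrix.add_apply, map_sum, Derivation.leibniz,
    smul_eq_mul, Finset.sum_add_distrib]
  rw [add_comm]
  congr 1
  exact Finset.sum_congr rfl fun k _ => mul_comm _ _

theorem map_deriv_smul (c : K) (hc : δ c = 0) (X : Matrix (Fin N) (Fin N) K) :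
    (c • X).map δ = c • X.map δ := by
  ext i j
  simp [hc]

theorem map_deriv_one : (1 : Matrix (Fin N) (Fin N) K).map δ = 0 := by
  ext i j
  rw [Matrix.map_apply, Matrix.one_apply, apply_ite δ]
  simp

theorem deriv_inv_sub {a b : K} (ha : δ a = 0) (hb : δ b = 0) : δ (a - b)⁻¹ = 0 := by
  by_cases h : a - b = 0
  · simp [h]
  · have h1 : δ ((a - b) * (a - b)⁻¹) = 0 := by rw [mul_inv_cancel₀ h, Derivation.map_one_eq_zero]
    rw [Derivation.leibniz, map_sub, ha, hb, sub_zero, smul_zero, add_zero, smul_eq_mul,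
      mul_eq_zero] at h1
    exact h1.resolve_left h

/-- The partial fractions for inserting `c` between neighbours `a` and `b`. -/
theorem smul_mul_inv_sub {a b c : K} (hab : a ≠ b) (hca : c ≠ a) (hcb : c ≠ b) :
    (a - c)⁻¹ * (c - b)⁻¹ = (a - b)⁻¹ * (c - b)⁻¹ - (a - b)⁻¹ * (c - a)⁻¹ := by
  have h1 := sub_ne_zero.2 hab
  have h2 := sub_ne_zero.2 hca
  have h3 := sub_ne_zero.2 hcb
  have h4 := sub_ne_zero.2 hca.symm
  field_simp
  ring

variable {A v δ} {c : ι} {Q : Matrix (Fin N) (Fin N) K} {κ : K}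

/-- Each factor contributes its commutator with `A c`. The two contributions with `A c` in the same
gap combine by partial fractions into an insertion of `c`, leaving boundary terms at `x` and `y`;
the commutators with `Q` add up to that of the whole product. -/
theorem map_deriv_pathProd (hv : ∀ s, δ (v s) = 0) (x y : ι) (q : List ι)
    (hA : ∀ s ∈ q, (A s).map δ =
      κ • ((v c - v s)⁻¹ • (A c * A s - A s * A c) - (Q * A s - A s * Q)))
    (hc : ∀ s ∈ x :: (q ++ [y]), v c ≠ v s)
    (hq : (x :: (q ++ [y])).IsChain fun s t => v s ≠ v t) :
    (pathProd A v x q y).map δ = κ •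
      (((q.permutations'Aux c).map fun p => pathProd A v x p y).sum +
        (v c - v x)⁻¹ • (A c * pathProd A v x q y) - (v c - v y)⁻¹ • (pathProd A v x q y * A c) -
        (Q * pathProd A v x q y - pathProd A v x q y * Q)) := by
  induction q generalizing x with
  | nil =>
    have h := smul_mul_inv_sub (K := K) (a := v x) (b := v y) (c := v c)
      (by simpa using hq) (hc x (by simp)) (hc y (by simp))
    rw [pathProd_nil, map_deriv_smul _ _ (deriv_inv_sub δ (hv x) (hv y)), map_deriv_one,
      List.permutations'Aux, List.map_singleton, List.sum_singleton, pathProd_cons, pathProd_nil]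
    simp only [mul_smul_comm, smul_mul_assoc, mul_one, one_mul, smul_smul, sub_self, sub_zero,
      smul_zero]
    rw [h, ← add_smul, ← sub_smul]
    have e : (v x - v y)⁻¹ * (v c - v y)⁻¹ - (v x - v y)⁻¹ * (v c - v x)⁻¹ +
      (v c - v x)⁻¹ * (v x - v y)⁻¹ - (v c - v y)⁻¹ * (v x - v y)⁻¹ = 0 := by ring
    rw [e, zero_smul, smul_zero]
  | cons s q ih =>
    rw [List.cons_append, List.isChain_cons_cons] at hq
    have h := smul_mul_inv_sub (K := K) (a := v x) (b := v s) (c := v c)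
      hq.1 (hc x (by simp)) (hc s (by simp))
    have ih' := ih s (fun t ht => hA t (by simp [ht])) (fun t ht => hc t (by
      rw [List.cons_append, List.mem_cons]; exact Or.inr ht)) hq.2
    have e : ((List.map (List.cons s) (q.permutations'Aux c)).map fun p => pathProd A v x p y).sum =
        (v x - v s)⁻¹ • (A s * ((q.permutations'Aux c).map fun p => pathProd A v s p y).sum) := by
      rw [List.map_map, ← List.sum_map_mul_left, List.smul_sum, List.map_map]
      rfl
    rw [List.permutations'Aux, List.map_cons, List.sum_cons, e]
    simp only [pathProd_cons]
    rw [map_deriv_smul _ _ (deriv_inv_sub δ (hv x) (hv s)), map_deriv_mul, ih', hA s (by simp)]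
    generalize pathProd A v s q y = W
    generalize ((q.permutations'Aux c).map fun p => pathProd A v s p y).sum = S
    simp only [mul_smul_comm, smul_mul_assoc, smul_smul, h, smul_add, smul_sub, sub_smul, mul_add,
      mul_sub, sub_mul, mul_assoc]
    module

theorem deriv_trace (X : Matrix (Fin N) (Fin N) K) : δ X.trace = (X.map δ).trace := by
  simp [Matrix.trace]

/-- On closing the cycle, the commutator from `A x` cancels the two boundary terms, and the trace of
the commutator with `Q` is zero. -/
theorem deriv_trace_mul_pathProd (hv : ∀ s, δ (v s) = 0) (x : ι) (q : List ι)
    (hA : ∀ s ∈ x :: q, (A s).map δ =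
      κ • ((v c - v s)⁻¹ • (A c * A s - A s * A c) - (Q * A s - A s * Q)))
    (hc : ∀ s ∈ x :: q, v c ≠ v s)
    (hq : (x :: (q ++ [x])).IsChain fun s t => v s ≠ v t) :
    δ (A x * pathProd A v x q x).trace = κ *
      ((q.permutations'Aux c).map fun p => (A x * pathProd A v x p x).trace).sum := by
  have h := map_deriv_pathProd hv x x q (fun s hs => hA s (by simp [hs])) (by
    intro s hs
    apply hc
    simp only [List.mem_cons, List.mem_append, List.not_mem_nil, or_false] at hs ⊢
    tauto) hq
  have e : ((q.permutations'Aux c).map fun p => (A x * pathProd A v x p x).trace).sum =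
      (A x * ((q.permutations'Aux c).map fun p => pathProd A v x p x).sum).trace := by
    rw [← List.sum_map_mul_left, ← Matrix.traceAddMonoidHom_apply, map_list_sum, List.map_map]
    rfl
  rw [deriv_trace, map_deriv_mul, h, hA x (by simp), e]
  generalize pathProd A v x q x = W
  generalize ((q.permutations'Aux c).map fun p => pathProd A v x p x).sum = S
  simp only [mul_smul_comm, smul_mul_assoc, Matrix.trace_add, Matrix.trace_smul, Matrix.trace_sub,
    mul_sub, mul_add, sub_mul, smul_eq_mul, mul_assoc]
  have h1 : (A c * (A x * W)).trace = (A x * (W * A c)).trace := by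
    rw [Matrix.trace_mul_comm, mul_assoc]
  have h2 : (Q * (A x * W)).trace = (A x * (W * Q)).trace := by
    rw [Matrix.trace_mul_comm, mul_assoc]
  rw [h1, h2]
  ring

/-- `q` must be nonempty, since otherwise `x` would be its own neighbour. -/
theorem isChain_cycle {x : ι} {q : List ι} (hq : q ≠ []) (h : (x :: q).Nodup) :
    (x :: (q ++ [x])).IsChain fun s t => s ≠ t := by
  rw [← List.cons_append, List.isChain_append]
  refine ⟨List.Pairwise.isChain h, List.isChain_singleton _, ?_⟩
  intro a ha b hb
  rw [List.getLast?_cons, Option.mem_some,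
    List.getLast?_eq_some_getLast hq, Option.getD_some] at ha
  rw [List.head?_cons, Option.mem_some] at hb
  subst ha hb
  intro h0
  have h1 := List.getLast_mem hq
  rw [h0] at h1
  exact (List.nodup_cons.1 h).1 h1

/-- `List.permutations'` of `c :: l` consists of the insertions of `c` into the permutations of `l`,
which is what the derivative of each cycle produces. -/
theorem deriv_cycleSum (hv : ∀ s, δ (v s) = 0) (hvi : Function.Injective v) (x : ι) (l : List ι)
    (hl : l ≠ []) (hcl : (c :: x :: l).Nodup)
    (hA : ∀ s, s ≠ c → (A s).map δ =
      κ • ((v c - v s)⁻¹ • (A c * A s - A s * A c) - (Q * A s - A s * Q))) :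
    δ (cycleSum A v x l) = κ * cycleSum A v x (c :: l) := by
  rw [cycleSum, cycleSum, List.permutations']
  have h : ∀ q ∈ l.permutations', q.Perm l := fun q hq => List.mem_permutations'.1 hq
  generalize l.permutations' = P at h ⊢
  induction P with
  | nil => simp
  | cons q P ih =>
    have hp := h q (by simp)
    have hcq : (c :: x :: q).Nodup := ((hp.cons x).cons c).nodup_iff.2 hcl
    have hne : ∀ s ∈ x :: q, s ≠ c := by
      rintro s hs rfl
      exact (List.nodup_cons.1 hcq).1 hs
    have hq0 : q ≠ [] := by
      rintro rfl
      exact hl (List.nil_perm.1 hp)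
    have h1 := deriv_trace_mul_pathProd (A := A) (v := v) (δ := δ) (Q := Q) (κ := κ) hv x q
      (fun s hs => hA s (hne s hs)) (fun s hs h0 => hne s hs (hvi h0).symm)
      ((isChain_cycle hq0 (List.nodup_cons.1 hcq).2).imp fun s t hst h0 => hst (hvi h0))
    rw [List.map_cons, List.sum_cons, map_add, h1, ih fun p hp => h p (by simp [hp]),
      List.flatMap_cons, List.map_append, List.sum_append, mul_add]

/-- The product of the differences along the path from `x` to `y` through a list. -/
def pathDen (v : ι → K) : ι → List ι → ι → K
  | x, [], y => v x - v y
  | x, s :: q, y => (v x - v s) * pathDen v s q y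

theorem pathProd_eq (x y : ι) (q : List ι) :
    pathProd A v x q y = (pathDen v x q y)⁻¹ • (q.map A).prod := by
  induction q generalizing x with
  | nil => rfl
  | cons s q ih =>
    rw [pathProd_cons, ih, pathDen, List.map_cons, List.prod_cons, mul_smul_comm, smul_smul,
      mul_inv]

theorem pathDen_ofFn (k : ℕ) (f : Fin (k + 1) → ι) (y : ι) :
    pathDen v (f 0) (List.ofFn fun i => f (Fin.succ i)) y =
      (∏ i : Fin k, (v (f i.castSucc) - v (f i.succ))) * (v (f (Fin.last k)) - v y) := by
  induction k with
  | zero => simp [pathDen]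
  | succ k ih =>
    rw [List.ofFn_succ, pathDen, ih (fun i => f i.succ), Fin.prod_univ_succ, mul_assoc]
    rfl

theorem trace_cycle_eq (k : ℕ) (f : Fin (k + 1) → ι) :
    (A (f 0) * pathProd A v (f 0) (List.ofFn fun i : Fin k => f i.succ) (f 0)).trace =
      ((List.ofFn fun i => A (f i)).prod).trace /
        ∏ i, (v (f i) - v (f (finRotate (k + 1) i))) := by
  have h : ∏ i, (v (f i) - v (f (finRotate (k + 1) i))) =
      pathDen v (f 0) (List.ofFn fun i => f (Fin.succ i)) (f 0) := by
    rw [pathDen_ofFn, Fin.prod_univ_castSucc, finRotate_last]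
    congr 1
    refine Finset.prod_congr rfl fun i _ => ?_
    rw [finRotate_apply, Fin.coeSucc_eq_succ]
  rw [h, pathProd_eq, mul_smul_comm, Matrix.trace_smul, List.ofFn_succ, List.prod_cons,
    List.map_ofFn, smul_eq_mul, div_eq_inv_mul]
  rfl

/-- The summand of the sum over all permutations. -/
def cycleTerm (A : ι → Matrix (Fin N) (Fin N) K) (v : ι → K) {m : ℕ} (f : Fin m → ι) : K :=
  ((List.ofFn fun i => A (f i)).prod).trace / ∏ i, (v (f i) - v (f (finRotate m i)))

theorem trace_prod_rotate {m : ℕ} (X : Fin m → Matrix (Fin N) (Fin N) K) :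
    ((List.ofFn fun i => X (finRotate m i)).prod).trace = ((List.ofFn X).prod).trace := by
  cases m with
  | zero => simp
  | succ k =>
    rw [List.ofFn_succ' (fun i => X (finRotate (k + 1) i)), List.ofFn_succ, List.prod_cons,
      List.prod_concat, Matrix.trace_mul_comm, finRotate_last]
    congr 4
    funext i
    rw [finRotate_apply, Fin.coeSucc_eq_succ]

theorem cycleTerm_rotate {m : ℕ} (f : Fin m → ι) :
    cycleTerm A v (fun i => f (finRotate m i)) = cycleTerm A v f := by
  rw [cycleTerm, cycleTerm, trace_prod_rotate fun i => A (f i)]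
  congr 1
  exact Equiv.prod_comp (finRotate m) fun i => v (f i) - v (f (finRotate m i))

end Paths

/-! ### Sums over permutations and over cycles with a fixed starting point -/

section Permutations

variable {M : Type*} [AddCommMonoid M] {k : ℕ}

/-- Rotation moves the position of `x` cyclically, so all `k + 1` positions contribute equally; this
accounts for the factor `1/m`. -/
theorem sum_perm_eq_nsmul (F : Equiv.Perm (Fin (k + 1)) → M)
    (hF : ∀ s, F (s * finRotate (k + 1)) = F s)
    (x : Fin (k + 1)) :
    ∑ s, F s = (k + 1) • ∑ s with s 0 = x, F s := by
  classical
  have h1 : ∀ j : Fin (k + 1), ∑ s with s j = x, F s = ∑ s with s 0 = x, F s := by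
    intro j
    induction j using Fin.induction with
    | zero => rfl
    | succ j ih =>
      rw [← ih]
      refine Finset.sum_equiv (Equiv.mulRight (finRotate (k + 1))) ?_ ?_
      · intro s
        simp only [Finset.mem_filter, Finset.mem_univ, true_and, Equiv.coe_mulRight,
          Equiv.Perm.mul_apply, finRotate_apply, Fin.coeSucc_eq_succ]
      · intro s _
        rw [Equiv.coe_mulRight, hF]
  have h2 : ∑ s, F s = ∑ j : Fin (k + 1), ∑ s with s j = x, F s := by
    rw [← Finset.sum_fiberwise (s := Finset.univ) (g := fun s : Equiv.Perm (Fin (k + 1)) => s.symm x)]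
    refine Finset.sum_congr rfl fun j _ => ?_
    refine Finset.sum_congr ?_ fun _ _ => rfl
    ext s
    rw [Finset.mem_filter, Finset.mem_filter, Equiv.symm_apply_eq, eq_comm (a := x)]
  rw [h2, Finset.sum_congr rfl fun j _ => h1 j, Finset.sum_const, Finset.card_univ,
    Fintype.card_fin]

theorem nodup_permutations' {α : Type*} (l : List α) (h : l.Nodup) : l.permutations'.Nodup :=
  ((List.permutations_perm_permutations' l).nodup_iff).1 (List.nodup_permutations l h)

/-- A permutation with `s 0 = x` is the same as an ordering of the remaining indices. -/
theorem sum_permutations'_eq (x : Fin (k + 1)) (l : List (Fin (k + 1)))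
    (hl : (x :: l).Perm (List.finRange (k + 1))) (f : List (Fin (k + 1)) → M) :
    (l.permutations'.map f).sum =
      ∑ s : Equiv.Perm (Fin (k + 1)) with s 0 = x, f (List.ofFn fun i : Fin k => s i.succ) := by
  classical
  have hx : (x :: l).Nodup := hl.nodup_iff.2 (List.nodup_finRange _)
  rw [← List.sum_toFinset f (nodup_permutations' l (List.nodup_cons.1 hx).2)]
  symm
  have hof : ∀ s : Equiv.Perm (Fin (k + 1)), s 0 = x →
      x :: (List.ofFn fun i : Fin k => s i.succ) = List.ofFn s := by
    rintro s rfl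
    rw [List.ofFn_succ]
  refine Finset.sum_bij (fun s _ => List.ofFn fun i : Fin k => s i.succ) ?_ ?_ ?_ ?_
  · intro s hs
    simp only [Finset.mem_filter, Finset.mem_univ, true_and] at hs
    rw [List.mem_toFinset, List.mem_permutations', ← List.perm_cons x, hof s hs]
    exact (Equiv.Perm.ofFn_comp_perm s id).trans (by rw [List.ofFn_id]; exact hl.symm)
  · intro s hs t ht h
    simp only [Finset.mem_filter, Finset.mem_univ, true_and] at hs ht
    have h1 : List.ofFn s = List.ofFn t := by rw [← hof s hs, ← hof t ht]; exact congrArg _ h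
    exact DFunLike.coe_injective (List.ofFn_injective h1)
  · intro q hq
    rw [List.mem_toFinset, List.mem_permutations', ← List.perm_cons x] at hq
    have hq2 := hq.trans hl
    have hlen : (x :: q).length = k + 1 := by rw [hq2.length_eq, List.length_finRange]
    have hnd : (x :: q).Nodup := hq2.nodup_iff.2 (List.nodup_finRange _)
    have hinj : Function.Injective fun i : Fin (k + 1) => (x :: q).get (i.cast hlen.symm) :=
      (List.nodup_iff_injective_get.1 hnd).comp (Fin.cast_injective _)
    have hofq : List.ofFn (fun i : Fin (k + 1) => (x :: q).get (i.cast hlen.symm)) = x :: q := by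
      apply List.ext_get
      · simp [hlen]
      · intro i h1 h2
        rw [List.get_ofFn]
        rfl
    refine ⟨Equiv.ofBijective _ (Finite.injective_iff_bijective.1 hinj), ?_, ?_⟩
    · simp
    · rw [List.ofFn_succ] at hofq
      exact (List.cons.inj hofq).2
  · intro s _
    rfl

end Permutations

section Rename

variable {A : Type*} [CommRing A] {k m : ℕ}

theorem rename_ev (e : Fin k ↪ Fin m) (i : Fin k) (p : PowerSeries A) :
    MvPowerSeries.rename e (ev A i p) = ev A (e i) p := by
  classical
  ext J
  rw [coeff_ev_eq]
  by_cases hJ : ∃ x : Fin k →₀ ℕ, Finsupp.embDomain e x = J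
  · obtain ⟨x, rfl⟩ := hJ
    rw [MvPowerSeries.coeff_embDomain_rename, coeff_ev_eq, Finsupp.embDomain_apply_self,
      ← Finsupp.embDomain_single]
    refine if_congr ?_ rfl rfl
    rw [Finsupp.embDomain_inj]
  · rw [MvPowerSeries.coeff_rename_eq_zero, if_neg]
    · intro h
      exact hJ ⟨Finsupp.single i (J (e i)), by rw [Finsupp.embDomain_single]; exact h.symm⟩
    · rintro ⟨x, hx⟩
      exact hJ ⟨x, by rw [Finsupp.embDomain_eq_mapDomain]; exact hx⟩

end Rename

/-! ### The `τ`-structure in several variables and the resummed flows -/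

section ResolventFlows

variable {𝔤 : Type*} [LieRing 𝔤] [LieAlgebra ℂ 𝔤] [FiniteDimensional ℂ 𝔤]
  [LieAlgebra.IsSimple ℂ 𝔤] {H : LieSubalgebra ℂ 𝔤} [H.IsCartanSubalgebra] {n N : ℕ} {m : ℕ}

namespace Data

variable (D : Data H n N)

/-- The coefficient ring embeds in its fraction field and the variables can be cancelled, so the
chosen `tauStructure` is determined. -/
theorem coeff_tauSeries (a b : Fin n) (k : Fin 2 →₀ ℕ) :
    MvPowerSeries.coeff k (D.tauSeries a b) = D.tauStructure (a, k 0) (b, k 1) := by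
  have h := D.isTauStructure a b
  let f : MvPowerSeries (Fin 2) D.Poly := fun k => D.tauStructure (a, k 0) (b, k 1)
  have hf : ∀ k, MvPowerSeries.coeff k f = D.tauStructure (a, k 0) (b, k 1) := fun _ => rfl
  rw [← tauSeries_spec, genSeries_eq _ _ f hf, Fin.prod_univ_two] at h
  have h2 := IsFractionRing.injective (MvPowerSeries (Fin 2) D.Poly) (GenField D.Poly 2) h
  have hX : ∀ i : Fin 2, (MvPowerSeries.X i : MvPowerSeries (Fin 2) D.Poly) ≠ 0 := fun i h0 =>
    algebraMap_X_ne_zero (A := D.Poly) i (by rw [h0, map_zero])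
  rw [← mul_left_cancel₀ (mul_ne_zero (hX 0) (hX 1)) h2, hf]

theorem tauSeries_rename_spec (e : Fin 2 ↪ Fin m) (a b : Fin n) :
    algebraMap _ (GenField D.Poly m) (MvPowerSeries.X (e 0) * MvPowerSeries.X (e 1) *
      MvPowerSeries.rename e (D.tauSeries a b)) =
    form D.gen D.θ (GenField D.Poly m) (D.evalAt (e 0) (D.R a)) (D.evalAt (e 1) (D.R b)) /
        (lam D.Poly (e 0) - lam D.Poly (e 1)) ^ 2 -
      D.etaTerm a b (lam D.Poly (e 0)) (lam D.Poly (e 1)) := by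
  have h0 := lam_sub_ne_zero (A := D.Poly) (i := e 0) (j := e 1) (fun h => by simpa using e.injective h)
  have hx := lam_mul_X (A := D.Poly) (e 0)
  have hy := lam_mul_X (A := D.Poly) (e 1)
  have h := congrArg (MvPowerSeries.rename e) (D.sum_ev_resSeries a b)
  simp only [map_sum, map_mul, map_add, map_sub, map_pow, rename_ev, MvPowerSeries.rename_C,
    MvPowerSeries.rename_X] at h
  rw [form_evalAt, h, etaTerm]
  simp only [map_add, map_sub, map_mul, map_pow, algebraMap_C_eq]
  rw [map_natCast, map_natCast]
  exact tau_identity hx hy h0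

/-! ### The flows of the basic resolvents -/

theorem repr_neg {K : Type*} [CommRing K] [Algebra ℂ K] (X : Ext K 𝔤) (j : Fin N) :
    (D.e.baseChange K).repr (-X) j = -(D.e.baseChange K).repr X j := by
  rw [map_neg, Finsupp.neg_apply]

theorem repr_Rpart (p : ℤ → Prop) (a : Fin n) (k : ℕ) (s : Fin N) :
    (D.e.baseChange (LaurentSeries D.Poly)).repr (D.Rpart p a k) s =
      cut p (specPow D.Poly k * (D.e.baseChange (LaurentSeries D.Poly)).repr (D.R a) s) := by
  conv_rhs => rw [← D.sum_pair_dualVec (D.R a)]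
  rw [Rpart, map_sum, map_sum, Finsupp.coe_finsetSum, Finset.sum_apply, Finsupp.coe_finsetSum,
    Finset.sum_apply, Finset.mul_sum]
  apply laurent_ext
  intro r
  have h : ∀ (f : LaurentSeries D.Poly) (x : 𝔤), (D.e.baseChange (LaurentSeries D.Poly)).repr
      (f • ((1 : LaurentSeries D.Poly) ⊗ₜ[ℂ] x)) s =
        f * algebraMap ℂ (LaurentSeries D.Poly) (D.e.repr x s) := fun f x => by
    rw [map_smul, Finsupp.smul_apply, Module.Basis.baseChange_repr_tmul, smul_eq_mul,
      Algebra.smul_def, mul_one]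
  rw [coeff_cut, HahnSeries.coeff_sum, HahnSeries.coeff_sum]
  by_cases hp : p r
  · rw [if_pos hp]
    refine Finset.sum_congr rfl fun i _ => ?_
    rw [h, h, ← mul_assoc, coeff_mul_algebraMap, coeff_mul_algebraMap, coeff_cut, if_pos hp]
    rfl
  · rw [if_neg hp]
    refine Finset.sum_eq_zero fun i _ => ?_
    rw [h, coeff_mul_algebraMap, coeff_cut, if_neg hp, smul_zero]

theorem coeffDeriv_spec_mul (δ : Derivation ℂ D.Poly D.Poly) (p : PowerSeries D.Poly) :
    coeffDeriv δ (spec D.Poly * HahnSeries.ofPowerSeries ℤ D.Poly p) =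
      spec D.Poly * HahnSeries.ofPowerSeries ℤ D.Poly
        (PowerSeries.mk fun l => δ (PowerSeries.coeff l p)) := by
  apply laurent_ext
  intro r
  rw [coeff_coeffDeriv, mul_comm, mul_comm (spec D.Poly), coeff_mul_spec, coeff_mul_spec,
    coeff_ofPowerSeries, coeff_ofPowerSeries, PowerSeries.coeff_mk, apply_ite δ, map_zero]

/-- Index `t` of `resSeries` is the power `z^(t-1)` of `R_a`. After the shift by `λ^k`, the power
`z^(l+1)` therefore has index `l + k + 2`. -/
theorem repr_Rpart_not (a : Fin n) (k : ℕ) (s : Fin N) :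
    (D.e.baseChange (LaurentSeries D.Poly)).repr (D.Rpart (fun r => ¬ r ≤ 0) a k) s =
      HahnSeries.ofPowerSeries ℤ D.Poly (PowerSeries.X *
        PowerSeries.mk fun l => PowerSeries.coeff (l + k + 2) (D.resSeries a s)) := by
  rw [repr_Rpart, repr_R]
  apply laurent_ext
  intro r
  rw [coeff_cut, coeff_ofPowerSeries, specPow, HahnSeries.coeff_single_mul, one_mul, mul_comm,
    coeff_mul_spec, coeff_ofPowerSeries]
  by_cases h : r ≤ 0
  · rw [if_neg (not_not.2 h)]
    rcases h.lt_or_eq with h | rfl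
    · rw [if_pos h]
    · rw [if_neg (by omega), Int.natAbs_zero, PowerSeries.coeff_zero_X_mul]
  · obtain ⟨l, rfl⟩ : ∃ l : ℕ, r = l + 1 := ⟨(r - 1).toNat, by omega⟩
    have e1 : ((l : ℤ) + 1).natAbs = l + 1 := by omega
    have e2 : ((l : ℤ) + 1 - -(k : ℤ) + 1).natAbs = l + k + 2 := by omega
    rw [if_pos h, if_neg (by omega), if_neg (by omega), e1, e2, PowerSeries.coeff_succ_X_mul,
      PowerSeries.coeff_mk]

/-- The commutator with the polynomial part of `λ^k R_a` is rewritten with the complementary part,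
so that only power series in `z` occur. -/
theorem flow_resSeries (a b : Fin n) (k : ℕ) (j : Fin N) :
    (PowerSeries.mk fun l => D.flow (a, k) (PowerSeries.coeff l (D.resSeries b j))) =
      -∑ s, ∑ t, PowerSeries.C (algebraMap ℂ D.Poly (D.e.repr ⁅D.e s, D.e t⁆ j)) *
        D.resSeries b t * (PowerSeries.X *
          PowerSeries.mk fun l => PowerSeries.coeff (l + k + 2) (D.resSeries a s)) := by
  apply HahnSeries.ofPowerSeries_injective (Γ := ℤ)
  have h := D.flow_R a k b
  rw [D.lie_Rpart_eq_neg _ a k _ (D.lie_R_R a b)] at h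
  have h2 := congrArg (fun X => zvar D.Poly * (D.e.baseChange (LaurentSeries D.Poly)).repr X j) h
  simp only [repr_derivExt, repr_neg, repr_lie, repr_Rpart_not, repr_R, coeffDeriv_spec_mul] at h2
  have h1 : zvar D.Poly * spec D.Poly = 1 := zvar_mul_spec
  rw [← mul_assoc, h1, one_mul] at h2
  rw [h2]
  simp only [map_neg, map_sum, map_mul, HahnSeries.ofPowerSeries_C, ← algebraMap_laurent]
  simp only [← map_mul]
  rw [mul_neg, Finset.mul_sum]
  congr 1
  refine Finset.sum_congr rfl fun s _ => ?_
  rw [Finset.mul_sum]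
  refine Finset.sum_congr rfl fun t _ => ?_
  linear_combination (algebraMap ℂ (LaurentSeries D.Poly) (D.e.repr ⁅D.e s, D.e t⁆ j) *
    HahnSeries.ofPowerSeries ℤ D.Poly (D.resSeries b t) *
    HahnSeries.ofPowerSeries ℤ D.Poly (PowerSeries.X *
      PowerSeries.mk fun l => PowerSeries.coeff (l + k + 2) (D.resSeries a s))) * h1

/-- The derivation `∑ X_c^k d/dT^a_k`. -/
def flowSum (a : Fin n) (c : Fin m) :
    Derivation ℂ (MvPowerSeries (Fin m) D.Poly) (MvPowerSeries (Fin m) D.Poly) :=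
  nabla (fun k => D.flow (a, k)) c

/-- The double series with coefficients `p_{l+k+2}` is the divided difference of `(p - p_0) / X`;
this is how all times `k` are summed at once. -/
theorem seriesSum_shift {A : Type*} [CommRing A] {i c : Fin m} (hic : i ≠ c) (p : PowerSeries A) :
    (seriesSum A c fun k => ev A i (PowerSeries.X *
      PowerSeries.mk fun l => PowerSeries.coeff (l + k + 2) p)) =
      MvPowerSeries.X i * divDiffSeries i c (PowerSeries.mk fun l => PowerSeries.coeff (l + 1) p) := by
  classical
  have h : (fun k => ev A i (PowerSeries.X *
      PowerSeries.mk fun l => PowerSeries.coeff (l + k + 2) p)) =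
      (MvPowerSeries.X i : MvPowerSeries (Fin m) A) •
        fun k => ev A i (PowerSeries.mk fun l => PowerSeries.coeff (l + k + 2) p) := by
    funext k
    rw [map_mul, ev_X]
    rfl
  rw [h, map_smul, smul_eq_mul]
  congr 1
  ext J
  rw [coeff_seriesSum_ev hic, coeff_divDiffSeries, PowerSeries.coeff_mk, PowerSeries.coeff_mk]

theorem flowSum_ev_resSeries (a b : Fin n) {i c : Fin m} (hic : i ≠ c) (j : Fin N) :
    D.flowSum a c (ev D.Poly i (D.resSeries b j)) =
      -∑ s, ∑ t, MvPowerSeries.C (algebraMap ℂ D.Poly (D.e.repr ⁅D.e s, D.e t⁆ j)) *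
        ev D.Poly i (D.resSeries b t) * (MvPowerSeries.X i *
          divDiffSeries i c (PowerSeries.mk fun l => PowerSeries.coeff (l + 1) (D.resSeries a s))) := by
  rw [flowSum, nabla_ev]
  have h : (fun k => ev D.Poly i (PowerSeries.mk fun l =>
      D.flow (a, k) (PowerSeries.coeff l (D.resSeries b j)))) =
      -∑ s, ∑ t, (MvPowerSeries.C (σ := Fin m) (algebraMap ℂ D.Poly (D.e.repr ⁅D.e s, D.e t⁆ j)) *
        ev D.Poly i (D.resSeries b t)) • fun k => ev D.Poly i (PowerSeries.X *
          PowerSeries.mk fun l => PowerSeries.coeff (l + k + 2) (D.resSeries a s)) := by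
    funext k
    rw [flow_resSeries, map_neg, map_sum, Pi.neg_apply, Finset.sum_apply]
    congr 1
    refine Finset.sum_congr rfl fun s _ => ?_
    rw [map_sum, Finset.sum_apply]
    refine Finset.sum_congr rfl fun t _ => ?_
    rw [map_mul, map_mul, ev_C]
    rfl
  rw [h, map_neg, map_sum]
  congr 1
  refine Finset.sum_congr rfl fun s _ => ?_
  rw [map_sum]
  refine Finset.sum_congr rfl fun t _ => ?_
  rw [map_smul, seriesSum_shift hic, smul_eq_mul]

end Data
end ResolventFlows

/-! ### The resummed flows in terms of the `λ_i` -/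

section Evaluated

variable {A : Type*} [CommRing A] [IsDomain A] [Algebra ℂ A] {m : ℕ}

/-- Passage from `X = λ⁻¹` to `λ`: a component of `R` is `λ p`, and the constant term of `p`,
dropped by the shift, reappears as the coefficient of `λ` in `R`. -/
theorem algebraMap_X_mul_divDiffSeries {i c : Fin m} (hic : i ≠ c) (p : PowerSeries A) :
    algebraMap (MvPowerSeries (Fin m) A) (GenField A m) (MvPowerSeries.X i *
      divDiffSeries i c (PowerSeries.mk fun l => PowerSeries.coeff (l + 1) p)) =
    lam A c * (lam A c - lam A i)⁻¹ *
      (lam A i * algebraMap _ (GenField A m) (ev A i p) -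
        lam A c * algebraMap _ (GenField A m) (ev A c p) -
        (lam A i - lam A c) * algebraMap (MvPowerSeries (Fin m) A) (GenField A m)
          (MvPowerSeries.C (PowerSeries.coeff 0 p))) := by
  have hp := PowerSeries.eq_X_mul_shift_add_const p
  have hd := congrArg (algebraMap _ (GenField A m))
    (sub_mul_divDiffSeries hic (PowerSeries.mk fun l => PowerSeries.coeff (l + 1) p))
  have hi := congrArg (fun q => algebraMap _ (GenField A m) (ev A i q)) hp
  have hc := congrArg (fun q => algebraMap _ (GenField A m) (ev A c q)) hp
  simp only [map_add, map_mul, map_sub, ev_X, ev_C] at hd hi hc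
  rw [hi, hc, PowerSeries.coeff_zero_eq_constantCoeff_apply, map_mul]
  have h1 := Data.lam_mul_X (A := A) i
  have h2 := Data.lam_mul_X (A := A) c
  have h3 := Data.lam_sub_ne_zero (A := A) hic.symm
  field_simp
  linear_combination (lam A c) * hd +
    (algebraMap _ (GenField A m) (divDiffSeries i c
      (PowerSeries.mk fun l => PowerSeries.coeff (l + 1) p)) + lam A c *
      algebraMap _ (GenField A m) (ev A c (PowerSeries.mk fun l => PowerSeries.coeff (l + 1) p))) * h2 -
    (algebraMap _ (GenField A m) (divDiffSeries i c
      (PowerSeries.mk fun l => PowerSeries.coeff (l + 1) p)) + lam A c *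
      algebraMap _ (GenField A m) (ev A i (PowerSeries.mk fun l => PowerSeries.coeff (l + 1) p))) * h1

theorem neg_smul_sub_sub {K V : Type*} [Field K] [AddCommGroup V] [Module K V] {c i : K}
    (h : c - i ≠ 0) (X Y : V) :
    -((c * (c - i)⁻¹) • (0 - X - (i - c) • Y)) = c • ((c - i)⁻¹ • X - Y) := by
  have e : (c - i)⁻¹ * (i - c) = -1 := by
    rw [← neg_sub c i, mul_neg, inv_mul_cancel₀ h]
  have e' : c * (c - i)⁻¹ * (i - c) = -c := by rw [mul_assoc, e, mul_neg, mul_one]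
  rw [zero_sub, smul_sub, smul_smul, e', smul_neg, smul_sub, smul_smul, neg_smul]
  abel

theorem mul_div_sq_eq {K : Type*} [Field K] {x y : K} (h : x - y ≠ 0) (c t : K) :
    c * t / (x - y) ^ 2 = -c * ((x - y)⁻¹ * ((y - x)⁻¹ * t)) := by
  rw [← neg_sub x y, inv_neg]
  field_simp

end Evaluated

section Evaluated

variable {𝔤 : Type*} [LieRing 𝔤] [LieAlgebra ℂ 𝔤] [FiniteDimensional ℂ 𝔤]
  [LieAlgebra.IsSimple ℂ 𝔤] {H : LieSubalgebra ℂ 𝔤} [H.IsCartanSubalgebra] {n N : ℕ} {m : ℕ}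

namespace Data

variable (D : Data H n N)

theorem repr_sum_tmul {K : Type*} [CommRing K] [Algebra ℂ K] (f : Fin N → K) (j : Fin N) :
    (D.e.baseChange K).repr (∑ s, f s • ((1 : K) ⊗ₜ[ℂ] D.e s)) j = f j := by
  have h : ∑ s, f s • ((1 : K) ⊗ₜ[ℂ] D.e s) = ∑ s, f s • D.e.baseChange K s := by
    simp only [Module.Basis.baseChange_apply]
  rw [h, Module.Basis.repr_sum_self]

/-- The coefficient of `λ` in `R_a(λ)`. -/
def leadR (m : ℕ) (a : Fin n) : Ext (GenField D.Poly m) 𝔤 :=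
  ∑ s, algebraMap (MvPowerSeries (Fin m) D.Poly) (GenField D.Poly m) (MvPowerSeries.C (PowerSeries.coeff 0 (D.resSeries a s))) •
    ((1 : GenField D.Poly m) ⊗ₜ[ℂ] D.e s)

theorem lie_evalAt (i : Fin m) (X Y : Loop D.Poly 𝔤) :
    ⁅D.evalAt i X, D.evalAt i Y⁆ = D.evalAt i ⁅X, Y⁆ := by
  rw [evalAt_eq_rTensor, evalAt_eq_rTensor, evalAt_eq_rTensor]
  exact (rTensor_lie (substAlg D.Poly i) X Y).symm

theorem fracDeriv_lam (δ : Derivation ℂ (MvPowerSeries (Fin m) D.Poly) (MvPowerSeries (Fin m) D.Poly))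
    (i : Fin m) (h : δ (MvPowerSeries.X i) = 0) : fracDeriv δ (lam D.Poly i) = 0 := by
  rw [lam, Derivation.leibniz_inv, fracDeriv_algebraMap, h, map_zero, smul_zero]

theorem fracDeriv_flowSum_lam (a : Fin n) (c i : Fin m) :
    fracDeriv (D.flowSum a c) (lam D.Poly i) = 0 :=
  D.fracDeriv_lam _ i (nabla_X _ c i)

/-- The element of `K ⊗ 𝔤` generating the flows `∑ X_c^k d/dT^a_k`. -/
def flowGen (a : Fin n) (i c : Fin m) : Ext (GenField D.Poly m) 𝔤 :=
  ∑ s, algebraMap _ (GenField D.Poly m) (MvPowerSeries.X i *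
    divDiffSeries i c (PowerSeries.mk fun l => PowerSeries.coeff (l + 1) (D.resSeries a s))) •
    ((1 : GenField D.Poly m) ⊗ₜ[ℂ] D.e s)

theorem flowGen_eq (a : Fin n) {i c : Fin m} (hic : i ≠ c) :
    D.flowGen a i c = (lam D.Poly c * (lam D.Poly c - lam D.Poly i)⁻¹) •
      (D.evalAt i (D.R a) - D.evalAt c (D.R a) - (lam D.Poly i - lam D.Poly c) • D.leadR m a) := by
  apply (D.e.baseChange (GenField D.Poly m)).repr.injective
  ext s : 1
  rw [map_smul, map_sub, map_sub, map_smul, Finsupp.smul_apply, Finsupp.sub_apply,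
    Finsupp.sub_apply, Finsupp.smul_apply, repr_evalAt, repr_evalAt, flowGen, leadR, repr_sum_tmul,
    repr_sum_tmul, substLam_repr_R, substLam_repr_R, algebraMap_X_mul_divDiffSeries hic]
  rfl

theorem deriv_evalAt (a b : Fin n) {i c : Fin m} (hic : i ≠ c) :
    derivExt 𝔤 (fracDeriv (D.flowSum a c)) (D.evalAt i (D.R b)) =
      -⁅D.flowGen a i c, D.evalAt i (D.R b)⁆ := by
  apply (D.e.baseChange (GenField D.Poly m)).repr.injective
  ext j : 1
  rw [repr_derivExt, repr_neg, repr_lie, repr_evalAt, substLam_repr_R, Derivation.leibniz,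
    fracDeriv_flowSum_lam, smul_zero, add_zero, fracDeriv_algebraMap, flowSum_ev_resSeries _ _ _ hic,
    map_neg, smul_neg, map_sum, Finset.smul_sum]
  congr 1
  refine Finset.sum_congr rfl fun s _ => ?_
  rw [map_sum, Finset.smul_sum]
  refine Finset.sum_congr rfl fun t _ => ?_
  rw [flowGen, repr_sum_tmul, repr_evalAt, substLam_repr_R, map_mul, map_mul, algebraMap_C_eq,
    smul_eq_mul]
  ring

/-- In `flowGen` the term `R_a(λ_i)` commutes with `R_b(λ_i)`. The overall factor `λ_c` is there
because `flowSum` carries `X_c^k` rather than `X_c^(k+1)`. -/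
theorem deriv_evalAt_eq (a b : Fin n) {i c : Fin m} (hic : i ≠ c) :
    derivExt 𝔤 (fracDeriv (D.flowSum a c)) (D.evalAt i (D.R b)) =
      lam D.Poly c • ((lam D.Poly c - lam D.Poly i)⁻¹ • ⁅D.evalAt c (D.R a), D.evalAt i (D.R b)⁆ -
        ⁅D.leadR m a, D.evalAt i (D.R b)⁆) := by
  have h3 := lam_sub_ne_zero (A := D.Poly) hic.symm
  have h0 : D.evalAt (m := m) i (0 : Loop D.Poly 𝔤) = 0 := by
    rw [evalAt_eq_rTensor, map_zero]
  rw [deriv_evalAt _ _ _ hic, flowGen_eq _ _ hic, smul_lie, sub_lie, sub_lie, smul_lie, lie_evalAt,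
    lie_R_R, h0]
  generalize ⁅D.evalAt c (D.R a), D.evalAt i (D.R b)⁆ = X
  generalize ⁅D.leadR m a, D.evalAt i (D.R b)⁆ = Y
  exact neg_smul_sub_sub h3 X Y

/-- The matrices of `ad R_{a_i}(λ_i)`. -/
def adR (a : Fin m → Fin n) (i : Fin m) : Matrix (Fin N) (Fin N) (GenField D.Poly m) :=
  adMat D.e (D.evalAt i (D.R (a i)))

theorem map_deriv_adR (a : Fin m → Fin n) (c i : Fin m) (hic : i ≠ c) :
    (D.adR a i).map (fracDeriv (D.flowSum (a c) c)) = lam D.Poly c •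
      ((lam D.Poly c - lam D.Poly i)⁻¹ • (D.adR a c * D.adR a i - D.adR a i * D.adR a c) -
        (adMat D.e (D.leadR m (a c)) * D.adR a i - D.adR a i * adMat D.e (D.leadR m (a c)))) := by
  rw [adR, ← adMat_derivExt, deriv_evalAt_eq _ _ _ hic, adMat_smul, adMat_sub, adMat_smul, adMat_lie,
    adMat_lie]
  rfl

theorem lam_injective (A : Type*) [CommRing A] [IsDomain A] [Algebra ℂ A] :
    Function.Injective fun i : Fin m => lam A i := by
  intro i j h
  by_contra hij
  exact lam_sub_ne_zero hij (sub_eq_zero.2 h)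

/-- The minus sign comes from the denominator `(λ_i - λ_j)(λ_j - λ_i)` of a 2-cycle. -/
theorem form_evalAt_eq (a : Fin m → Fin n) {i j : Fin m} (hij : i ≠ j) :
    form D.gen D.θ (GenField D.Poly m) (D.evalAt i (D.R (a i))) (D.evalAt j (D.R (a j))) /
      (lam D.Poly i - lam D.Poly j) ^ 2 = -algebraMap ℂ (GenField D.Poly m) D.nrm *
        cycleSum (D.adR a) (fun i => lam D.Poly i) i [j] := by
  have h := lam_sub_ne_zero (A := D.Poly) hij
  rw [form_eq, kap_eq_trace D.e, cycleSum]
  simp only [List.permutations', List.permutations'Aux, List.flatMap_cons, List.flatMap_nil,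
    List.append_nil, List.map_cons, List.map_nil, List.sum_cons, List.sum_nil, add_zero,
    pathProd_cons, pathProd_nil, mul_smul_comm, mul_one, Matrix.trace_smul, smul_eq_mul]
  change _ * (D.adR a i * D.adR a j).trace / _ = _
  exact mul_div_sq_eq h _ _

/-- The generating series of the `ω`'s whose first two indices are `e 0`, `e 1`, and whose other
indices are listed in `l`. -/
def omegaSeries (a : Fin m → Fin n) (e : Fin 2 ↪ Fin m) (l : List (Fin m)) :
    MvPowerSeries (Fin m) D.Poly :=
  l.foldr (fun c f => D.flowSum (a c) c f)
    (MvPowerSeries.rename e (D.tauSeries (a (e 0)) (a (e 1))))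

/-- Induction on `l`: a further flow inserts its index into the cycles, and its factor `λ_c` cancels
the additional `X_c`. The `η`-term depends on no coefficient of `W`, so the first flow kills it. -/
theorem omegaSeries_eq (a : Fin m → Fin n) (e : Fin 2 ↪ Fin m) (l : List (Fin m))
    (hl : (e 0 :: e 1 :: l).Nodup) :
    algebraMap _ (GenField D.Poly m) (((e 0 :: e 1 :: l).map fun i => MvPowerSeries.X i).prod *
      D.omegaSeries a e l) =
    -algebraMap ℂ (GenField D.Poly m) D.nrm *
      cycleSum (D.adR a) (fun i => lam D.Poly i) (e 0) (l ++ [e 1]) -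
      if l = [] then D.etaTerm (a (e 0)) (a (e 1)) (lam D.Poly (e 0)) (lam D.Poly (e 1)) else 0 := by
  induction l with
  | nil =>
    rw [if_pos rfl, List.nil_append, ← form_evalAt_eq, ← tauSeries_rename_spec, omegaSeries]
    · simp only [List.map_cons, List.map_nil, List.prod_cons, List.prod_nil, mul_one, List.foldr_nil]
    · exact fun h => (List.nodup_cons.1 hl).1 (by simp [h])
  | cons c l ih =>
    have hp : (e 0 :: e 1 :: c :: l).Perm (c :: e 0 :: e 1 :: l) :=
      ((List.Perm.swap c (e 1) l).cons _).trans (List.Perm.swap c (e 0) _)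
    have hcl := hp.nodup_iff.1 hl
    have ih' := congrArg (fracDeriv (D.flowSum (a c) c)) (ih (List.nodup_cons.1 hcl).2)
    have hX : ∀ l : List (Fin m), D.flowSum (a c) c (l.map fun i => MvPowerSeries.X i).prod = 0 := by
      intro l
      induction l with
      | nil => simp
      | cons s l ih =>
        rw [List.map_cons, List.prod_cons, Derivation.leibniz, ih, flowSum, nabla_X, smul_zero,
          smul_zero, add_zero]
    have hv : ∀ s : Fin m, fracDeriv (D.flowSum (a c) c) (lam D.Poly s) = 0 :=
      D.fracDeriv_flowSum_lam (a c) c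
    have heta : fracDeriv (D.flowSum (a c) c) (if l = [] then
        D.etaTerm (a (e 0)) (a (e 1)) (lam D.Poly (e 0)) (lam D.Poly (e 1)) else 0) = 0 := by
      split_ifs
      · rw [etaTerm, div_eq_mul_inv, Derivation.leibniz, Derivation.leibniz_inv, Derivation.leibniz,
          Derivation.leibniz_pow, map_sub, map_add, Derivation.leibniz, Derivation.leibniz, hv, hv,
          Derivation.map_algebraMap, Derivation.map_natCast, Derivation.map_natCast]
        simp
      · exact map_zero _
    have hcyc := deriv_cycleSum (A := D.adR a) (v := fun i => lam D.Poly i)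
      (δ := fracDeriv (D.flowSum (a c) c)) (c := c) (Q := adMat D.e (D.leadR m (a c)))
      (κ := lam D.Poly c) hv (lam_injective D.Poly) (e 0) (l ++ [e 1]) (by simp)
      ((((List.perm_append_singleton (e 1) l).cons _).cons _).nodup_iff.2 hcl)
      (fun s hs => D.map_deriv_adR a c s hs)
    rw [map_sub, heta, sub_zero, Derivation.leibniz, hcyc, ← map_neg, Derivation.map_algebraMap,
      smul_zero, add_zero, fracDeriv_algebraMap, Derivation.leibniz, hX, smul_zero, add_zero] at ih'
    rw [if_neg (by simp), sub_zero, (hp.map _).prod_eq, List.map_cons, List.prod_cons, mul_assoc,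
      map_mul]
    have ih2 : algebraMap _ (GenField D.Poly m)
        (((e 0 :: e 1 :: l).map fun i => MvPowerSeries.X i).prod * D.omegaSeries a e (c :: l)) =
        algebraMap ℂ (GenField D.Poly m) (-D.nrm) * (lam D.Poly c *
          cycleSum (D.adR a) (fun i => lam D.Poly i) (e 0) (c :: (l ++ [e 1]))) := ih'
    rw [ih2, List.cons_append, ← map_neg]
    have hx := lam_mul_X (A := D.Poly) c
    linear_combination (algebraMap ℂ (GenField D.Poly m) (-D.nrm) *
      cycleSum (D.adR a) (fun i => lam D.Poly i) (e 0) (c :: (l ++ [e 1]))) * hx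

open Classical in
theorem coeff_omegaSeries (a : Fin m → Fin n) (e : Fin 2 ↪ Fin m) (l : List (Fin m))
    (hl : (e 0 :: e 1 :: l).Nodup) (J : Fin m →₀ ℕ) :
    MvPowerSeries.coeff J (D.omegaSeries a e l) =
      if ∀ i, i ∉ e 0 :: e 1 :: l → J i = 0 then
        D.omega ((e 0 :: e 1 :: l).map fun i => (a i, J i)) else 0 := by
  induction l generalizing J with
  | nil =>
    rw [omegaSeries, List.foldr_nil]
    by_cases hJ : ∃ x : Fin 2 →₀ ℕ, Finsupp.embDomain e x = J
    · obtain ⟨x, rfl⟩ := hJ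
      rw [MvPowerSeries.coeff_embDomain_rename, coeff_tauSeries, if_pos]
      · simp only [List.map_cons, List.map_nil, Finsupp.embDomain_apply_self]
        rfl
      · intro i hi
        rw [Finsupp.embDomain_of_notMem_range]
        rintro ⟨s, rfl⟩
        apply hi
        fin_cases s <;> simp
    · rw [MvPowerSeries.coeff_rename_eq_zero, if_neg]
      · intro h
        apply hJ
        refine ⟨Finsupp.single 0 (J (e 0)) + Finsupp.single 1 (J (e 1)), ?_⟩
        have h01 : e 0 ≠ e 1 := fun h => by simpa using e.injective h
        rw [Finsupp.embDomain_eq_mapDomain, Finsupp.mapDomain_add, Finsupp.mapDomain_single,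
          Finsupp.mapDomain_single]
        ext i
        by_cases h0 : i = e 0
        · subst h0
          simp [Finsupp.single_eq_of_ne h01]
        · by_cases h1 : i = e 1
          · subst h1
            simp [Finsupp.single_eq_of_ne h01.symm]
          · rw [h i (by simp [h0, h1])]
            simp [Finsupp.single_eq_of_ne h0, Finsupp.single_eq_of_ne h1]
      · rintro ⟨x, hx⟩
        exact hJ ⟨x, by rw [Finsupp.embDomain_eq_mapDomain]; exact hx⟩
  | cons c l ih =>
    have hp : (e 0 :: e 1 :: c :: l).Perm (c :: e 0 :: e 1 :: l) :=
      ((List.Perm.swap c (e 1) l).cons _).trans (List.Perm.swap c (e 0) _)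
    have hcl := List.nodup_cons.1 (hp.nodup_iff.1 hl)
    have hf : ∀ J : Fin m →₀ ℕ, J c ≠ 0 → MvPowerSeries.coeff J (D.omegaSeries a e l) = 0 := by
      intro J hJ
      rw [ih hcl.2, if_neg]
      exact fun h => hJ (h c hcl.1)
    -- The previous series does not involve `X_c`, so the exponent `J c` selects the time of the
    -- flow and the other exponents select the coefficient it acts on.
    change MvPowerSeries.coeff J (nabla (fun k => D.flow (a c, k)) c (D.omegaSeries a e l)) = _
    rw [coeff_nabla_of_forall _ _ _ hf, ih hcl.2, apply_ite (D.flow (a c, J c)), Derivation.map_zero]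
    refine if_congr (forall_congr' fun i => ?_) ?_ rfl
    · rw [hp.mem_iff, List.mem_cons (a := i) (b := c)]
      by_cases hi : i = c
      · subst hi
        simp
      · rw [Finsupp.erase_ne hi]
        simp [hi]
    · have hm : ∀ s ∈ e 0 :: e 1 :: l, (a s, (J.erase c) s) = (a s, J s) := by
        intro s hs
        rw [Finsupp.erase_ne]
        rintro rfl
        exact hcl.1 hs
      rw [List.map_congr_left hm]
      rfl

end Data
end Evaluated

/-! ### The generating series over `𝒫` -/

section Main

variable {𝔤 : Type*} [LieRing 𝔤] [LieAlgebra ℂ 𝔤] [FiniteDimensional ℂ 𝔤]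
  [LieAlgebra.IsSimple ℂ 𝔤] {H : LieSubalgebra ℂ 𝔤} [H.IsCartanSubalgebra] {n N : ℕ} {m : ℕ}

namespace Data

variable (D : Data H n N)

/-- The right hand side of the identity for the generating series; `i` and `j` are the first two
indices. -/
def cyclicSide {A : Type*} [CommRing A] [IsDomain A] [Algebra ℂ A] (R : Fin n → Loop A 𝔤)
    (i j : Fin m) (a : Fin m → Fin n) : GenField A m :=
  -(1 / (2 * (m : GenField A m) * (D.dualCox : GenField A m))) * D.traceSum R a -
    (if m = 2 then D.etaTerm (a i) (a j) (lam A i) (lam A j) else 0)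

theorem traceSum_eq {A : Type*} [CommRing A] [IsDomain A] [Algebra ℂ A] (R : Fin n → Loop A 𝔤)
    (a : Fin m → Fin n) : D.traceSum R a = ∑ s : Equiv.Perm (Fin m),
      cycleTerm (fun i => adMat D.e (D.evalAt i (R (a i)))) (fun i => lam A i) s := by
  refine Finset.sum_congr rfl fun s _ => ?_
  rw [cycleTerm, multiTrace]
  congr 1
  have h := trace_ad_list D.e (List.ofFn fun i => D.evalAt (s i) (R (a (s i))))
  rw [List.map_ofFn, List.map_ofFn] at h
  exact h

theorem algebraMap_nrm (K : Type*) [Field K] [Algebra ℂ K] :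
    algebraMap ℂ K D.nrm = (2 * (D.dualCox : K))⁻¹ := by
  change algebraMap ℂ K (2 * (D.dualCox : ℂ))⁻¹ = _
  rw [map_inv₀, map_mul, map_intCast, map_ofNat]

theorem genSeries_omega (hm : 2 ≤ m) (i j : Fin m) (hi : (i : ℕ) = 0) (hj : (j : ℕ) = 1)
    (a : Fin m → Fin n) :
    genSeries a (fun x => D.omega (List.ofFn x)) = D.cyclicSide D.R i j a := by
  obtain ⟨k, rfl⟩ : ∃ k, m = k + 2 := ⟨m - 2, by omega⟩
  let e : Fin 2 ↪ Fin (k + 2) := Fin.castLEEmb hm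
  have e0 : e 0 = 0 := rfl
  have e1 : e 1 = 1 := rfl
  obtain rfl : i = 0 := Fin.ext hi
  obtain rfl : j = 1 := Fin.ext hj
  let l : List (Fin (k + 2)) := ((List.finRange k).map Fin.succ).map Fin.succ
  have hl : e 0 :: e 1 :: l = List.finRange (k + 2) := by
    rw [List.finRange_succ, List.finRange_succ]
    rfl
  have hnd : (e 0 :: e 1 :: l).Nodup := hl ▸ List.nodup_finRange _
  have hl0 : l = [] ↔ k + 2 = 2 := by
    simp [l, List.finRange_eq_nil_iff]
  -- The base cycle runs from `0` through `1`, and all other indices are inserted in front of `1`.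
  have hp : ((0 : Fin (k + 2)) :: (l ++ [1])).Perm (List.finRange (k + 2)) := by
    rw [← hl]
    exact (List.perm_append_singleton _ _).cons _
  have h1 := D.omegaSeries_eq a e l hnd
  rw [hl, ← Fin.prod_univ_def] at h1
  rw [genSeries_eq a _ (D.omegaSeries a e l), h1, cyclicSide, traceSum_eq,
    sum_perm_eq_nsmul (k := k + 1) _ (fun s => cycleTerm_rotate _) 0]
  · congr 1
    · have h2 : cycleSum (D.adR a) (fun i => lam D.Poly i) (e 0) (l ++ [e 1]) =
          ∑ s : Equiv.Perm (Fin (k + 1 + 1)) with s 0 = 0,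
            cycleTerm (D.adR a) (fun i => lam D.Poly i) s := by
        rw [cycleSum, e0, e1, sum_permutations'_eq 0 _ hp]
        refine Finset.sum_congr rfl fun s hs => ?_
        have hs0 : s 0 = 0 := by simpa using hs
        have h3 := trace_cycle_eq (A := D.adR a) (v := fun i => lam D.Poly i) (k + 1) s
        rw [hs0] at h3
        exact h3
      rw [h2, algebraMap_nrm, nsmul_eq_mul]
      have hk : ((k + 2 : ℕ) : GenField D.Poly (k + 2)) ≠ 0 := by
        rw [← map_natCast (algebraMap ℂ (GenField D.Poly (k + 2)))]
        exact (map_ne_zero _).2 (Nat.cast_ne_zero.2 (by omega))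
      generalize ((k + 2 : ℕ) : GenField D.Poly (k + 2)) = r at hk ⊢
      -- Here `r = m`: the `m` rotations of each cycle cancel the factor `1/m`.
      have h4 : ∀ c S : GenField D.Poly (k + 2),
          -(2 * c)⁻¹ * S = -(1 / (2 * r * c)) * (r * S) := fun c S => by
        rw [one_div, mul_right_comm, mul_inv (2 * c), neg_mul, neg_mul, mul_assoc _ r⁻¹,
          inv_mul_cancel_left₀ hk]
      exact h4 _ _
    · exact if_congr hl0 rfl rfl
  · intro J
    rw [coeff_omegaSeries D a e l hnd, if_pos, hl, List.ofFn_eq_map]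
    intro i hi
    rw [hl] at hi
    exact absurd (List.mem_finRange i) hi

end Data
end Main

/-! ### Change of the coefficient ring -/

section Transfer

variable {A B : Type*} [CommRing A] [IsDomain A] [Algebra ℂ A] [CommRing B] [IsDomain B]
  [Algebra ℂ B] (φ : A →ₐ[ℂ] B) {m : ℕ}

/-- A series with complex coefficients as an element of the fraction field. -/
def constSeries (A : Type*) [CommRing A] [IsDomain A] [Algebra ℂ A] (m : ℕ) :
    MvPowerSeries (Fin m) ℂ →+* GenField A m :=
  (algebraMap (MvPowerSeries (Fin m) A) (GenField A m)).comp (MvPowerSeries.map (algebraMap ℂ A))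

theorem constSeries_ne_zero {s : MvPowerSeries (Fin m) ℂ} (hs : s ≠ 0) :
    constSeries A m s ≠ 0 := by
  intro h
  apply hs
  have h1 : MvPowerSeries.map (algebraMap ℂ A) s = 0 :=
    IsFractionRing.injective (MvPowerSeries (Fin m) A) (GenField A m) (by rw [map_zero]; exact h)
  ext J
  apply (algebraMap ℂ A).injective
  rw [← MvPowerSeries.coeff_map, h1, map_zero, map_zero, map_zero]

/-- `x` is a fraction `p / s`, where `s` has complex coefficients, and `y` is obtained from it by
applying `φ` to the coefficients of `p`. -/
def Corr (x : GenField A m) (y : GenField B m) : Prop :=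
  ∃ (p : MvPowerSeries (Fin m) A) (s : MvPowerSeries (Fin m) ℂ), s ≠ 0 ∧
    x * constSeries A m s = algebraMap _ (GenField A m) p ∧
    y * constSeries B m s = algebraMap _ (GenField B m) (MvPowerSeries.map (φ : A →+* B) p)

theorem map_map_algebraMap (s : MvPowerSeries (Fin m) ℂ) :
    MvPowerSeries.map (φ : A →+* B) (MvPowerSeries.map (algebraMap ℂ A) s) =
      MvPowerSeries.map (algebraMap ℂ B) s := by
  ext J
  simp

variable {φ}

/-- `φ` may have a kernel and then does not extend to the fraction fields. Denominators with complex
coefficients stay nonzero over any coefficient ring, so cross-multiplication applies. -/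
theorem Corr.unique {x : GenField A m} {y y' : GenField B m} (h : Corr φ x y) (h' : Corr φ x y') :
    y = y' := by
  obtain ⟨p, s, hs, h1, h2⟩ := h
  obtain ⟨p', s', hs', h1', h2'⟩ := h'
  have h3 : p * MvPowerSeries.map (algebraMap ℂ A) s' = p' * MvPowerSeries.map (algebraMap ℂ A) s := by
    apply IsFractionRing.injective (MvPowerSeries (Fin m) A) (GenField A m)
    rw [map_mul, map_mul, ← h1, ← h1', constSeries, RingHom.comp_apply, RingHom.comp_apply]
    ring
  have h4 := congrArg (fun q => algebraMap _ (GenField B m) (MvPowerSeries.map (φ : A →+* B) q)) h3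
  simp only [map_mul, map_map_algebraMap] at h4
  rw [← h2, ← h2'] at h4
  change y * _ * constSeries B m s' = y' * _ * constSeries B m s at h4
  have h5 := constSeries_ne_zero (A := B) hs
  have h6 := constSeries_ne_zero (A := B) hs'
  refine mul_right_cancel₀ (mul_ne_zero h5 h6) ?_
  linear_combination h4

theorem Corr.of_algebraMap (p : MvPowerSeries (Fin m) A) :
    Corr φ (algebraMap _ (GenField A m) p)
      (algebraMap _ (GenField B m) (MvPowerSeries.map (φ : A →+* B) p)) :=
  ⟨p, 1, one_ne_zero, by rw [map_one, mul_one], by rw [map_one, mul_one]⟩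

theorem Corr.constSeries (s : MvPowerSeries (Fin m) ℂ) :
    Corr φ (constSeries A m s) (constSeries B m s) := by
  have h := Corr.of_algebraMap (φ := φ) (MvPowerSeries.map (algebraMap ℂ A) s)
  rwa [map_map_algebraMap] at h

theorem Corr.inv_constSeries {s : MvPowerSeries (Fin m) ℂ} (hs : s ≠ 0) :
    Corr φ (DrinfeldSokolov.constSeries A m s)⁻¹ (DrinfeldSokolov.constSeries B m s)⁻¹ :=
  ⟨1, s, hs, by rw [inv_mul_cancel₀ (constSeries_ne_zero hs), map_one],
    by rw [inv_mul_cancel₀ (constSeries_ne_zero hs), map_one, map_one]⟩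

theorem Corr.of_complex (c : ℂ) :
    Corr φ (algebraMap ℂ (GenField A m) c) (algebraMap ℂ (GenField B m) c) := by
  have h := Corr.constSeries (φ := φ) (m := m) (MvPowerSeries.C c)
  simp only [DrinfeldSokolov.constSeries, RingHom.comp_apply, MvPowerSeries.map_C,
    algebraMap_C_eq] at h
  exact h

theorem Corr.zero : Corr φ (0 : GenField A m) (0 : GenField B m) :=
  ⟨0, 1, one_ne_zero, by simp, by simp⟩

theorem Corr.one : Corr φ (1 : GenField A m) (1 : GenField B m) :=
  ⟨1, 1, one_ne_zero, by simp, by simp⟩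

theorem Corr.add {x x' : GenField A m} {y y' : GenField B m} (h : Corr φ x y) (h' : Corr φ x' y') :
    Corr φ (x + x') (y + y') := by
  obtain ⟨p, s, hs, h1, h2⟩ := h
  obtain ⟨p', s', hs', h1', h2'⟩ := h'
  refine ⟨p * MvPowerSeries.map (algebraMap ℂ A) s' +
    p' * MvPowerSeries.map (algebraMap ℂ A) s, s * s', mul_ne_zero hs hs', ?_, ?_⟩
  · rw [map_add, map_mul, map_mul, map_mul, ← h1, ← h1']
    change _ = _ * DrinfeldSokolov.constSeries A m s' + _ * DrinfeldSokolov.constSeries A m s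
    ring
  · rw [map_add, map_add, map_mul, map_mul, map_mul, map_mul, map_mul, ← h2, ← h2',
      map_map_algebraMap, map_map_algebraMap]
    change _ = _ * DrinfeldSokolov.constSeries B m s' + _ * DrinfeldSokolov.constSeries B m s
    ring

theorem Corr.mul {x x' : GenField A m} {y y' : GenField B m} (h : Corr φ x y) (h' : Corr φ x' y') :
    Corr φ (x * x') (y * y') := by
  obtain ⟨p, s, hs, h1, h2⟩ := h
  obtain ⟨p', s', hs', h1', h2'⟩ := h'
  refine ⟨p * p', s * s', mul_ne_zero hs hs', ?_, ?_⟩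
  · rw [map_mul, map_mul, ← h1, ← h1']
    ring
  · rw [map_mul, map_mul, map_mul, ← h2, ← h2']
    ring

theorem Corr.neg {x : GenField A m} {y : GenField B m} (h : Corr φ x y) : Corr φ (-x) (-y) := by
  obtain ⟨p, s, hs, h1, h2⟩ := h
  exact ⟨-p, s, hs, by rw [neg_mul, h1, map_neg], by rw [neg_mul, h2, map_neg, map_neg]⟩

theorem Corr.sub {x x' : GenField A m} {y y' : GenField B m} (h : Corr φ x y) (h' : Corr φ x' y') :
    Corr φ (x - x') (y - y') := by
  rw [sub_eq_add_neg, sub_eq_add_neg]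
  exact h.add h'.neg

theorem Corr.sum {ι : Type*} (s : Finset ι) {f : ι → GenField A m} {g : ι → GenField B m}
    (h : ∀ i ∈ s, Corr φ (f i) (g i)) : Corr φ (∑ i ∈ s, f i) (∑ i ∈ s, g i) := by
  classical
  induction s using Finset.induction_on with
  | empty => exact Corr.zero
  | insert i s hi ih =>
    rw [Finset.sum_insert hi, Finset.sum_insert hi]
    exact (h i (by simp)).add (ih fun j hj => h j (by simp [hj]))

theorem Corr.prod {ι : Type*} (s : Finset ι) {f : ι → GenField A m} {g : ι → GenField B m}
    (h : ∀ i ∈ s, Corr φ (f i) (g i)) : Corr φ (∏ i ∈ s, f i) (∏ i ∈ s, g i) := by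
  classical
  induction s using Finset.induction_on with
  | empty => exact Corr.one
  | insert i s hi ih =>
    rw [Finset.prod_insert hi, Finset.prod_insert hi]
    exact (h i (by simp)).mul (ih fun j hj => h j (by simp [hj]))

theorem constSeries_X (i : Fin m) : constSeries A m (MvPowerSeries.X i) =
    algebraMap (MvPowerSeries (Fin m) A) (GenField A m) (MvPowerSeries.X i) := by
  rw [constSeries, RingHom.comp_apply, MvPowerSeries.map_X]

theorem X_ne_zero' (i : Fin m) : (MvPowerSeries.X i : MvPowerSeries (Fin m) ℂ) ≠ 0 := fun h0 =>
  algebraMap_X_ne_zero (A := ℂ) i (by rw [h0, map_zero])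

theorem Corr.lam (i : Fin m) : Corr φ (lam A i) (lam B i) := by
  have h := Corr.inv_constSeries (φ := φ) (X_ne_zero' i)
  rwa [constSeries_X, constSeries_X] at h

/-- Written with `X = λ⁻¹`, the denominator `X_j - X_i` has complex coefficients, as `Corr`
requires. -/
theorem inv_lam_sub_lam {i j : Fin m} (hij : i ≠ j) :
    (lam A i - lam A j)⁻¹ = constSeries A m (MvPowerSeries.X i * MvPowerSeries.X j) *
      (constSeries A m (MvPowerSeries.X j - MvPowerSeries.X i))⁻¹ := by
  have h := Data.lam_sub_ne_zero (A := A) hij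
  have hi := Data.lam_mul_X (A := A) i
  have hj := Data.lam_mul_X (A := A) j
  rw [map_sub, map_mul, constSeries_X, constSeries_X, ← div_eq_mul_inv, inv_eq_one_div, div_eq_div_iff h]
  · linear_combination -(algebraMap (MvPowerSeries (Fin m) A) (GenField A m) (MvPowerSeries.X j)) * hi +
      (algebraMap (MvPowerSeries (Fin m) A) (GenField A m) (MvPowerSeries.X i)) * hj
  · intro h0
    apply h
    rw [DrinfeldSokolov.lam, DrinfeldSokolov.lam, sub_eq_zero.1 h0, sub_self]

theorem Corr.inv_lam_sub_lam (i j : Fin m) :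
    Corr φ (DrinfeldSokolov.lam A i - DrinfeldSokolov.lam A j)⁻¹
      (DrinfeldSokolov.lam B i - DrinfeldSokolov.lam B j)⁻¹ := by
  by_cases hij : i = j
  -- For equal indices both inverses are `0⁻¹ = 0`.
  · rw [hij, sub_self, sub_self, inv_zero, inv_zero]
    exact Corr.zero
  · rw [DrinfeldSokolov.inv_lam_sub_lam hij, DrinfeldSokolov.inv_lam_sub_lam hij]
    refine (Corr.constSeries _).mul (Corr.inv_constSeries ?_)
    intro h
    apply hij
    apply Data.lam_injective ℂ
    change (_)⁻¹ = (_)⁻¹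
    rw [sub_eq_zero.1 h]

theorem map_ev (i : Fin m) (p : PowerSeries A) :
    MvPowerSeries.map (φ : A →+* B) (ev A i p) = ev B i (PowerSeries.map (φ : A →+* B) p) := by
  classical
  ext J
  rw [MvPowerSeries.coeff_map, coeff_ev, coeff_ev, PowerSeries.coeff_map, apply_ite (φ : A →+* B),
    map_zero]

theorem laurentMap_ofPowerSeries (p : PowerSeries A) :
    laurentMap φ (HahnSeries.ofPowerSeries ℤ A p) =
      HahnSeries.ofPowerSeries ℤ B (PowerSeries.map (φ : A →+* B) p) := by
  apply laurent_ext
  intro r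
  rw [coeff_laurentMap, Data.coeff_ofPowerSeries, Data.coeff_ofPowerSeries, PowerSeries.coeff_map,
    apply_ite φ, map_zero]
  rfl

theorem exists_mul_X_pow (f : LaurentSeries A) : ∃ (k : ℕ) (p : PowerSeries A),
    f * HahnSeries.ofPowerSeries ℤ A (PowerSeries.X ^ k) = HahnSeries.ofPowerSeries ℤ A p := by
  obtain ⟨⟨p, ⟨_, k, rfl⟩⟩, h⟩ := IsLocalization.surj
    (Submonoid.powers (PowerSeries.X : PowerSeries A)) f
  exact ⟨k, p, h⟩

/-- A power of `z` clears the positive powers of `λ`; substituted, it is a denominator `X_i^k`. -/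
theorem Corr.substLam (i : Fin m) (f : LaurentSeries A) :
    Corr φ (substLam A i f) (substLam B i (laurentMap φ f)) := by
  obtain ⟨k, p, h⟩ := exists_mul_X_pow f
  have h2 := congrArg (laurentMap φ) h
  rw [map_mul, laurentMap_ofPowerSeries, laurentMap_ofPowerSeries] at h2
  have h3 := congrArg (DrinfeldSokolov.substLam A i) h
  have h4 := congrArg (DrinfeldSokolov.substLam B i) h2
  rw [map_mul, substLam_ofPowerSeries, substLam_ofPowerSeries] at h3 h4
  refine ⟨ev A i p, MvPowerSeries.X i ^ k, pow_ne_zero k (X_ne_zero' i), ?_, ?_⟩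
  · rw [← h3, map_pow, constSeries_X, map_pow, ev_X, map_pow]
  · rw [map_ev, ← h4, map_pow, constSeries_X, map_pow, PowerSeries.map_X, map_pow, ev_X, map_pow]

theorem Corr.list_prod {N : ℕ} {ι : Type*} {X : ι → Matrix (Fin N) (Fin N) (GenField A m)}
    {Y : ι → Matrix (Fin N) (Fin N) (GenField B m)} (h : ∀ t i j, Corr φ (X t i j) (Y t i j))
    (l : List ι) (i j : Fin N) : Corr φ ((l.map X).prod i j) ((l.map Y).prod i j) := by
  induction l generalizing i j with
  | nil =>
    rw [List.map_nil, List.map_nil, List.prod_nil, List.prod_nil, Matrix.one_apply, Matrix.one_apply]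
    split_ifs
    · exact Corr.one
    · exact Corr.zero
  | cons t l ih =>
    rw [List.map_cons, List.map_cons, List.prod_cons, List.prod_cons, Matrix.mul_apply,
      Matrix.mul_apply]
    exact Corr.sum _ fun s _ => (h t i s).mul (ih s j)

theorem Corr.cycleTerm {N : ℕ} {X : Fin m → Matrix (Fin N) (Fin N) (GenField A m)}
    {Y : Fin m → Matrix (Fin N) (Fin N) (GenField B m)} (h : ∀ t i j, Corr φ (X t i j) (Y t i j))
    (f : Fin m → Fin m) : Corr φ (cycleTerm X (fun i => DrinfeldSokolov.lam A i) f)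
      (cycleTerm Y (fun i => DrinfeldSokolov.lam B i) f) := by
  rw [DrinfeldSokolov.cycleTerm, DrinfeldSokolov.cycleTerm, div_eq_mul_inv, div_eq_mul_inv,
    ← Finset.prod_inv_distrib, ← Finset.prod_inv_distrib]
  refine Corr.mul ?_ (Corr.prod _ fun i _ => Corr.inv_lam_sub_lam _ _)
  have hX : (List.ofFn fun i => X (f i)) = (List.ofFn f).map X := by rw [List.map_ofFn]; rfl
  have hY : (List.ofFn fun i => Y (f i)) = (List.ofFn f).map Y := by rw [List.map_ofFn]; rfl
  rw [hX, hY]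
  exact Corr.sum _ fun i _ => Corr.list_prod h _ i i

variable {𝔤 : Type*} [LieRing 𝔤] [LieAlgebra ℂ 𝔤] [FiniteDimensional ℂ 𝔤]
  [LieAlgebra.IsSimple ℂ 𝔤] {H : LieSubalgebra ℂ 𝔤} [H.IsCartanSubalgebra] {n N : ℕ}

namespace Data

variable (D : Data H n N)

theorem corr_adMat (i : Fin m) (X : Loop A 𝔤) (s t : Fin N) :
    Corr φ (adMat D.e (D.evalAt i X) s t) (adMat D.e (D.evalAt i (loopMap φ X)) s t) := by
  rw [evalAt_eq_rTensor, evalAt_eq_rTensor, adMat_rTensor, adMat_rTensor, loopMap, adMat_rTensor]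
  exact Corr.substLam i _

theorem corr_etaTerm (a b : Fin n) (i j : Fin m) :
    Corr φ (D.etaTerm a b (lam A i) (lam A j)) (D.etaTerm a b (lam B i) (lam B j)) := by
  have hc : ∀ k : ℕ, Corr φ (k : GenField A m) (k : GenField B m) := fun k => by
    have := Corr.of_complex (φ := φ) (m := m) (k : ℂ)
    rwa [map_natCast, map_natCast] at this
  rw [etaTerm, etaTerm, div_eq_mul_inv, div_eq_mul_inv, ← inv_pow, ← inv_pow, pow_two, pow_two]
  exact ((Corr.of_complex _).mul (((hc _).mul (Corr.lam i)).add ((hc _).mul (Corr.lam j)))).mul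
    ((Corr.inv_lam_sub_lam i j).mul (Corr.inv_lam_sub_lam i j))

theorem one_div_eq (m : ℕ) {K : Type*} [Field K] [Algebra ℂ K] :
    1 / (2 * (m : K) * (D.dualCox : K)) =
      algebraMap ℂ K (1 / (2 * (m : ℂ) * (D.dualCox : ℂ))) := by
  rw [map_div₀, map_mul, map_mul, map_one, map_ofNat, map_natCast, map_intCast]

theorem corr_cyclicSide (R : Fin n → Loop A 𝔤) (i j : Fin m) (a : Fin m → Fin n) :
    Corr φ (D.cyclicSide R i j a) (D.cyclicSide (fun a => loopMap φ (R a)) i j a) := by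
  rw [cyclicSide, cyclicSide, traceSum_eq, traceSum_eq, 
    D.one_div_eq m (K := GenField A m), D.one_div_eq m (K := GenField B m)]
  have h1 (s : Equiv.Perm (Fin m)) := Corr.cycleTerm (φ := φ)
    (X := fun i => adMat D.e (D.evalAt i (R (a i))))
    (Y := fun i => adMat D.e (D.evalAt i (loopMap φ (R (a i)))))
    (fun i => D.corr_adMat i (R (a i))) s
  have h2 := (Corr.of_complex (φ := φ) (m := m) (1 / (2 * (m : ℂ) * (D.dualCox : ℂ)))).neg
  refine (h2.mul (Corr.sum Finset.univ fun s _ => h1 s)).sub ?_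
  split_ifs
  · exact D.corr_etaTerm _ _ _ _
  · exact Corr.zero

/-- The generating series with coefficients mapped by `φ` and the cyclic side over `B` both
correspond to the same element over `A`, hence agree. -/
theorem genSeries_map (R : Fin n → Loop A 𝔤) (i j : Fin m) (a : Fin m → Fin n)
    (w : (Fin m → Fin n × ℕ) → A) (h : genSeries a w = D.cyclicSide R i j a) :
    genSeries a (fun x => φ (w x)) = D.cyclicSide (fun a => loopMap φ (R a)) i j a := by
  have h1 := D.corr_cyclicSide (φ := φ) R i j a
  rw [← h] at h1
  refine Corr.unique (φ := φ) ?_ h1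
  let f : MvPowerSeries (Fin m) A := fun k => w fun i => (a i, k i)
  have hf : ∀ k, MvPowerSeries.coeff k f = w fun i => (a i, k i) := fun _ => rfl
  rw [genSeries_eq a w f hf, genSeries_eq a _ (MvPowerSeries.map (φ : A →+* B) f) fun k => by
    rw [MvPowerSeries.coeff_map, hf]; rfl]
  have h2 := Corr.of_algebraMap (φ := φ) ((∏ i, MvPowerSeries.X i) * f)
  have h3 : MvPowerSeries.map (φ : A →+* B) ((∏ i, MvPowerSeries.X i) * f) =
      (∏ i, MvPowerSeries.X i) * MvPowerSeries.map (φ : A →+* B) f := by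
    rw [map_mul, map_prod]
    simp only [MvPowerSeries.map_X]
  rwa [h3] at h2

end Data
end Transfer

/-! ### Solutions and `τ`-functions -/

section Solutions

variable {𝔤 : Type*} [LieRing 𝔤] [LieAlgebra ℂ 𝔤] [FiniteDimensional ℂ 𝔤]
  [LieAlgebra.IsSimple ℂ 𝔤] {H : LieSubalgebra ℂ 𝔤} [H.IsCartanSubalgebra] {n N : ℕ}

namespace Data

variable {D : Data H n N} {u : D.Var → MvPowerSeries (Fin n × ℕ) ℂ}
  {τ : MvPowerSeries (Fin n × ℕ) ℂ}

theorem pderiv_comm {σ : Type*} (x y : σ) (f : MvPowerSeries σ ℂ) :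
    MvPowerSeries.pderiv ℂ x (MvPowerSeries.pderiv ℂ y f) =
      MvPowerSeries.pderiv ℂ y (MvPowerSeries.pderiv ℂ x f) := by
  classical
  by_cases h : x = y
  · rw [h]
  ext k
  rw [MvPowerSeries.coeff_pderiv, MvPowerSeries.coeff_pderiv, MvPowerSeries.coeff_pderiv,
    MvPowerSeries.coeff_pderiv, Finsupp.add_apply, Finsupp.add_apply,
    Finsupp.single_eq_of_ne h, Finsupp.single_eq_of_ne (Ne.symm h), add_right_comm]
  rw [add_zero, add_zero]
  ring

/-- Both sides are derivations along `aeval u`, and on generators they agree by the equation of a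
solution. -/
theorem aeval_flow (hu : D.IsSolution u) (x : Fin n × ℕ) (p : D.Poly) :
    MvPolynomial.aeval u (D.flow x p) = MvPowerSeries.pderiv ℂ x (MvPolynomial.aeval u p) := by
  induction p using MvPolynomial.induction_on with
  | C c =>
    rw [← MvPolynomial.algebraMap_eq, Derivation.map_algebraMap, map_zero, AlgHom.commutes,
      Derivation.map_algebraMap]
  | add p q hp hq => rw [map_add, map_add, hp, hq, map_add, map_add]
  | mul_X p v hp =>
    rw [Derivation.leibniz, map_add, smul_eq_mul, smul_eq_mul, map_mul, map_mul, map_mul,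
      Derivation.leibniz, hp, MvPolynomial.aeval_X, hu x v]
    rfl

theorem logDeriv_eq (hu : D.IsSolution u) (hτ : D.IsTauFunction u τ) (x y : Fin n × ℕ)
    (l : List (Fin n × ℕ)) :
    logDeriv τ (x :: y :: l) = MvPolynomial.aeval u (D.omega (x :: y :: l)) := by
  induction l with
  | nil => exact hτ.2 x y
  | cons t l ih =>
    change _ = MvPolynomial.aeval u (D.flow t (D.omega (x :: y :: l)))
    rw [aeval_flow hu, ← ih]
    simp only [logDeriv, List.foldr_cons]
    -- `omega` applies the flow of `t` outermost, while `logDeriv` applies `x` and `y` outside `t`.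
    -- Commuting partial derivatives settles this without commutativity of the flows.
    rw [pderiv_comm y t, pderiv_comm x t]

theorem Rsol_eq (a : Fin n) : D.Rsol u a = loopMap (MvPolynomial.aeval u) (D.R a) :=
  mapLoop_eq_loopMap D.e (MvPolynomial.aeval u) (D.R a)

/-- The constant coefficient as an algebra homomorphism. -/
def constantCoeffAlg (σ : Type*) : MvPowerSeries σ ℂ →ₐ[ℂ] ℂ :=
  { MvPowerSeries.constantCoeff (σ := σ) (R := ℂ) with
    commutes' := fun c => by
      change MvPowerSeries.constantCoeff (algebraMap ℂ (MvPowerSeries σ ℂ) c) = c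
      rw [MvPowerSeries.algebraMap_apply, MvPowerSeries.constantCoeff_C]
      rfl }

theorem Rsol₀_eq (a : Fin n) :
    D.Rsol₀ u a = loopMap (constantCoeffAlg (Fin n × ℕ)) (D.Rsol u a) :=
  mapLoop_eq_loopMap D.e (constantCoeffAlg (Fin n × ℕ)) (D.Rsol u a)

end Data
end Solutions

end DrinfeldSokolov

end

theorem mainTheorem5 {𝔤 : Type*} [LieRing 𝔤] [LieAlgebra ℂ 𝔤] [FiniteDimensional ℂ 𝔤]
    [LieAlgebra.IsSimple ℂ 𝔤] (H : LieSubalgebra ℂ 𝔤) [H.IsCartanSubalgebra] {n N : ℕ}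
    (D : DrinfeldSokolov.Data H n N) (m : ℕ) (hm : 2 ≤ m) (a : Fin m → Fin n) :
    (DrinfeldSokolov.Data.genSeries a (fun x => D.omega (List.ofFn x)) =
      -(1 / (2 * (m : DrinfeldSokolov.GenField D.Poly m) *
          (D.dualCox : DrinfeldSokolov.GenField D.Poly m))) * D.traceSum D.R a -
        (if m = 2 then D.etaTerm (a ⟨0, by omega⟩) (a ⟨1, by omega⟩)
          (DrinfeldSokolov.lam D.Poly ⟨0, by omega⟩)
          (DrinfeldSokolov.lam D.Poly (⟨1, by omega⟩ : Fin m)) else 0)) ∧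
    ∀ (u : D.Var → MvPowerSeries (Fin n × ℕ) ℂ) (τ : MvPowerSeries (Fin n × ℕ) ℂ),
      D.IsSolution u → D.IsTauFunction u τ →
      (DrinfeldSokolov.Data.genSeries a (fun x => DrinfeldSokolov.logDeriv τ (List.ofFn x)) =
        -(1 / (2 * (m : DrinfeldSokolov.GenField (MvPowerSeries (Fin n × ℕ) ℂ) m) *
            (D.dualCox : DrinfeldSokolov.GenField (MvPowerSeries (Fin n × ℕ) ℂ) m))) *
            D.traceSum (D.Rsol u) a -
          (if m = 2 then D.etaTerm (a ⟨0, by omega⟩) (a ⟨1, by omega⟩)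
            (DrinfeldSokolov.lam (MvPowerSeries (Fin n × ℕ) ℂ) ⟨0, by omega⟩)
            (DrinfeldSokolov.lam (MvPowerSeries (Fin n × ℕ) ℂ) (⟨1, by omega⟩ : Fin m))
            else 0)) ∧
      (DrinfeldSokolov.Data.genSeries a (fun x =>
          MvPowerSeries.constantCoeff (DrinfeldSokolov.logDeriv τ (List.ofFn x))) =
        -(1 / (2 * (m : DrinfeldSokolov.GenField ℂ m) *
            (D.dualCox : DrinfeldSokolov.GenField ℂ m))) * D.traceSum (D.Rsol₀ u) a -
          (if m = 2 then D.etaTerm (a ⟨0, by omega⟩) (a ⟨1, by omega⟩)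
            (DrinfeldSokolov.lam ℂ ⟨0, by omega⟩)
            (DrinfeldSokolov.lam ℂ (⟨1, by omega⟩ : Fin m)) else 0)) := by
  have h0 := D.genSeries_omega hm ⟨0, by omega⟩ ⟨1, by omega⟩ rfl rfl a
  refine ⟨h0, fun u τ hu hτ => ?_⟩
  -- The identity over `𝒫` is pushed along `aeval u`, and the result along the constant coefficient.
  have h1 := DrinfeldSokolov.Data.genSeries_map (φ := MvPolynomial.aeval u) D D.R _ _ a _ h0
  have h2 : (fun x : Fin m → Fin n × ℕ => MvPolynomial.aeval u (D.omega (List.ofFn x))) =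
      fun x => DrinfeldSokolov.logDeriv τ (List.ofFn x) := by
    obtain ⟨k, rfl⟩ : ∃ k, m = k + 2 := ⟨m - 2, by omega⟩
    funext x
    rw [List.ofFn_succ, List.ofFn_succ, DrinfeldSokolov.Data.logDeriv_eq hu hτ]
  have h3 : (fun b => DrinfeldSokolov.loopMap (MvPolynomial.aeval u) (D.R b)) = D.Rsol u :=
    funext fun b => (DrinfeldSokolov.Data.Rsol_eq b).symm
  rw [h2, h3] at h1
  have h4 := DrinfeldSokolov.Data.genSeries_map
    (φ := DrinfeldSokolov.Data.constantCoeffAlg (Fin n × ℕ)) D (D.Rsol u) _ _ a _ h1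
  have h5 : (fun b => DrinfeldSokolov.loopMap
      (DrinfeldSokolov.Data.constantCoeffAlg (Fin n × ℕ)) (D.Rsol u b)) = D.Rsol₀ u :=
    funext fun b => (DrinfeldSokolov.Data.Rsol₀_eq b).symm
  rw [h5] at h4
  exact ⟨h1, h4⟩
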